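/- **Setting.** Let $M\subseteq\mathbb R^m$, $N\subseteq\mathbb R^n$ be open and let $J=J^\infty(M,N)$ be the infinite jet space, with coordinates $x^i,u^j_\sigma$ ($\sigma\in\mathbb N_0^m$, $u^j_0=u^j$) and the product topology. $\mathfrak F$ is the algebra of smooth functions on $J$ that depend on finitely many coordinates. Put $D_i=\partial_{x^i}+\sum_{k,\sigma}u^k_{\sigma+1_i}\partial_{u^k_\sigma}$ and $D^\sigma=D_1^{\sigma_1}\cdots D_m^{\sigma_m}$; for $F\in\mathfrak F^n$ let $V_F=\sum_{j,\sigma}D^\sigma(F^j)\,\partial_{u^j_\sigma}$ and $[F,G]^j=V_F(G^j)-V_G(F^j)$, so that $[V_F,V_G]=V_{[F,G]}$. Let $G_1,\dots,G_h\in\mathfrak F^n$ satisfy $[G_i,G_j]=\sum_k\lambda^k_{i,j}G_k$ with real constants $\lambda^k_{i,j}$. Assume that they admit characteristics: there are $\eta_i^l\in\mathfrak F$ such that each $\bar V_{G_i}=V_{G_i}-\sum_l\eta^l_iD_l$ has a local flow $\Phi^i_a$ on $J$, defined on an open set of pairs $(a,p)$ that contains all $(0,p)$ and whose section over each $p$ is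 an interval, with components that are smooth functions of $a$ and finitely many coordinates. Assume also that they have a common filtration: there are algebras $\mathfrak G_0\subseteq\mathfrak G_1\subseteq\cdots$ with union $\mathfrak F$, where $\mathfrak G_0$ is generated under composition with smooth functions by finitely many elements of $\mathfrak F$, $\mathfrak G_{k+1}$ is generated in the same sense by $\mathfrak G_k$ and all $D_i(\mathfrak G_k)$, and $\bar V_{G_i}(\mathfrak G_k)\subseteq\mathfrak G_k$ for all $i,k$. Write $\mathbf\Phi_b=\Phi^h_{b^h}\circ\cdots\circ\Phi^1_{b^1}$ for $b\in\mathbb R^h$. Let $f\in C^\infty(M,N)$, let $j^\infty f(x)=(x,\partial^\sigma f(x))_\sigma$ be its infinite jet and $\mathcal H=\{j^\infty f(x):x\in M\}$. Let $x_0\in M$, and let $i_1,\dots,i_h\in\{1,\dots,n\}$ and multi-indices $\sigma^1,\dots,\sigma^h$ be such that the matrix $\big(D^{\sigma^r}(G^{i_r}_s)(j^\infty f(x_0))\big)_{r,s=1,\dots,h}$ is non-singular. **Theorem.** There are open neighbourhoods $X_1,X\subseteq M$ of $x_0$, $\mathcal V\subseteq\mathcal V_1\subseteq\mathbb R^h$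 of $0$ and $U\subseteq J$ of $j^\infty f(x_0)$ such that $\mathbf\Phi_b(p)$ is defined for all $b\in\mathcal V_1$ and all $p$ in $U$ or in $\{j^\infty f(x):x\in X_1\}$, and the following holds. 1. There is a smooth map $a=(a^1,\dots,a^h):U\to\mathcal V$, depending on finitely many coordinates, such that for all $p\in U$ and $b\in\mathcal V_1$ the equations $$u^{i_k}_{\sigma^k}(\mathbf\Phi_b(p))=\partial^{\sigma^k}f^{i_k}\big(x(\mathbf\Phi_b(p))\big),\qquad k=1,\dots,h,$$ hold if and only if $b=a(p)$. 2. Let $\mathcal K=U\cap\bigcup_{b\in\mathcal V_1}\mathbf\Phi_b(\{j^\infty f(x):x\in X_1\})$. Then $\mathcal K=\{p\in U:\mathbf\Phi_{a(p)}(p)\in\mathcal H\}$, and $(x^1,\dots,x^m,a^1,\dots,a^h)$ is a smooth coordinate system on $\mathcal K$ with range $X\times\mathcal V$. Moreover $D_i(a^j)|_{\mathcal K}=0$ for all $i,j$. 3. There are smooth functions $\phi^l_i:\mathcal V\to\mathbb R$ such that, in these coordinates, each $V_{G_i}$ is tangent to $\mathcal K$ and $$V_{G_i}|_{\mathcal K}=\sum_l\phi^l_i(a^1,\dots,a^h)\,\partial_{a^l};$$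 in particular the coefficients do not depend on $x$. 4. For all $i,l$: $\ \phi^l_i(a^1,\dots,a^h)=-\delta^l_i$ when $a^1=\dots=a^{i-1}=0$. 5. For all $i,k,l$: $$\partial_{a^k}(\phi^l_i)=-\sum_p\lambda^p_{k,i}\,\phi^l_p-\sum_{r\neq k}\phi^r_i\,\partial_{a^r}(\phi^l_k)\qquad\text{when }a^1=\dots=a^{k-1}=0.$$ If $k\le i$ and the span of $G_k,\dots,G_h$ is closed under the bracket in the sense that $\lambda^s_{p,q}=0$ whenever $p,q\ge k>s$ (no condition for $k=1$), then the last sum may be restricted to $r>k$. -/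

import Mathlib

open scoped ContDiff

namespace InfJet

/-- Index set of the standard coordinates of the infinite jet space of maps from `ℝ^m` to `ℝ^n`:
`Sum.inl i` stands for `x^i`, and `Sum.inr (j, σ)` stands for `u^j_σ` (with `u^j = u^j_0`). -/
abbrev Coord (m n : ℕ) : Type := Fin m ⊕ (Fin n × (Fin m → ℕ))

/-- The model space `ℝ^∞` of the infinite jet space, with the product topology. -/
abbrev Jet (m n : ℕ) : Type := Coord m n → ℝ

/-- The base point `x(p)` of a jet. -/
def xpt {m n : ℕ} (p : Jet m n) : Fin m → ℝ := fun i => p (Sum.inl i)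

/-- The value `u(p)` of a jet. -/
def upt {m n : ℕ} (p : Jet m n) : Fin n → ℝ := fun j => p (Sum.inr (j, 0))

/-- The infinite jet space `J^∞(M, N)` of maps from `M ⊆ ℝ^m` to `N ⊆ ℝ^n`. -/
def jetSpace {m n : ℕ} (M : Set (Fin m → ℝ)) (N : Set (Fin n → ℝ)) : Set (Jet m n) :=
  {p | xpt p ∈ M ∧ upt p ∈ N}

/-- Smooth functions of finitely many of the coordinates `x^i, u^j_σ` on an open set `U`.
For `U = J^∞(M, N)` this is the algebra `𝔉 = ⋃ₖ 𝔉ₖ`. -/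
def IsSmoothOn {m n : ℕ} (U : Set (Jet m n)) (F : Jet m n → ℝ) : Prop :=
  ∃ (S : Finset (Coord m n)) (g : (S → ℝ) → ℝ),
    ContDiffOn ℝ ∞ g ((fun p : Jet m n => (fun c : S => p c)) '' U) ∧
    ∀ p ∈ U, F p = g (fun c : S => p c)

/-- The same for functions that depend on an additional real parameter, smoothly in all variables
together. -/
def IsSmoothParamOn {m n : ℕ} (E : Set (ℝ × Jet m n)) (F : ℝ → Jet m n → ℝ) : Prop :=
  ∃ (S : Finset (Coord m n)) (g : ℝ × (S → ℝ) → ℝ),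
    ContDiffOn ℝ ∞ g ((fun z : ℝ × Jet m n => (z.1, fun c : S => z.2 c)) '' E) ∧
    ∀ z ∈ E, F z.1 z.2 = g (z.1, fun c : S => z.2 c)

/-- Partial derivative of a function on the jet space with respect to one coordinate. -/
noncomputable def coordDeriv {m n : ℕ} (c : Coord m n) (F : Jet m n → ℝ) (p : Jet m n) : ℝ :=
  deriv (fun t => F (Function.update p c t)) (p c)

/-- A vector field, given by its components in the standard coordinates. -/
abbrev VField (m n : ℕ) : Type := Coord m n → Jet m n → ℝ

/-- The action `V(F)` of a vector field on a function. For functions of finitely many coordinates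
only finitely many terms differ from zero. -/
noncomputable def act {m n : ℕ} (V : VField m n) (F : Jet m n → ℝ) (p : Jet m n) : ℝ :=
  ∑ᶠ c, V c p * coordDeriv c F p

/-- The total derivative `D_i = ∂_{x^i} + ∑ u^k_{σ + 1_i} ∂_{u^k_σ}`. -/
def totalD {m n : ℕ} (i : Fin m) : VField m n
  | Sum.inl l, _ => if l = i then 1 else 0
  | Sum.inr (k, σ), p => p (Sum.inr (k, σ + Pi.single i 1))

/-- The iterated total derivative `D^σ = D_1^{σ_1} ⋯ D_m^{σ_m}`. -/
noncomputable def totalDPow {m n : ℕ} (σ : Fin m → ℕ) (F : Jet m n → ℝ) : Jet m n → ℝ :=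
  (List.finRange m).foldr (fun i H => (act (totalD i))^[σ i] H) F

/-- The evolution vector field `V_F = ∑ D^σ(F^j) ∂_{u^j_σ}`. -/
noncomputable def evol {m n : ℕ} (F : Fin n → Jet m n → ℝ) : VField m n
  | Sum.inl _, _ => 0
  | Sum.inr (j, σ), p => totalDPow σ (F j) p

/-- The bracket `[F, G]`, that is, the generator `H` of `V_H = [V_F, V_G]`: its components are the
`∂_{u^j}`-components of the commutator. -/
noncomputable def bracket {m n : ℕ} (F G : Fin n → Jet m n → ℝ) : Fin n → Jet m n → ℝ :=
  fun j p => act (evol F) (G j) p - act (evol G) (F j) p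

/-- The field `V_F - ∑ η^l D_l`. -/
noncomputable def charField {m n : ℕ} (F : Fin n → Jet m n → ℝ) (η : Fin m → Jet m n → ℝ) :
    VField m n :=
  fun c p => evol F c p - ∑ l, η l p * totalD l c p

/-- `Φ`, defined on the open set `E` of pairs `(a, p)`, is a local flow of the vector field `V` on
`Ω`, with components that are smooth functions of `a` and of finitely many coordinates. -/
structure IsLocalFlow {m n : ℕ} (Ω : Set (Jet m n)) (V : VField m n) (E : Set (ℝ × Jet m n))
    (Φ : ℝ → Jet m n → Jet m n) : Prop where
  isOpen : IsOpen E
  zero_mem : ∀ p ∈ Ω, ((0 : ℝ), p) ∈ E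
  interval : ∀ p, {a : ℝ | (a, p) ∈ E}.OrdConnected
  source : ∀ a p, (a, p) ∈ E → p ∈ Ω
  target : ∀ a p, (a, p) ∈ E → Φ a p ∈ Ω
  smooth : ∀ c, IsSmoothParamOn E (fun a p => Φ a p c)
  zero : ∀ p ∈ Ω, Φ 0 p = p
  deriv : ∀ a p, (a, p) ∈ E → ∀ c, HasDerivAt (fun s => Φ s p c) (V c (Φ a p)) a

/-- All functions on `Ω` obtained by composing a smooth function of several variables with
finitely many elements of `A`. -/
def smoothSpan {m n : ℕ} (Ω : Set (Jet m n)) (A : Set (Jet m n → ℝ)) : Set (Jet m n → ℝ) :=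
  {F | ∃ (r : ℕ) (g : Fin r → Jet m n → ℝ) (W : Set (Fin r → ℝ)) (ψ : (Fin r → ℝ) → ℝ),
    (∀ s, g s ∈ A) ∧ IsOpen W ∧ (∀ p ∈ Ω, (fun s => g s p) ∈ W) ∧ ContDiffOn ℝ ∞ ψ W ∧
    ∀ p ∈ Ω, F p = ψ (fun s => g s p)}

/-- The filtration `𝔊₀ ⊆ 𝔊₁ ⊆ ⋯` that starts from the algebra generated by `A`: the algebra
`𝔊ₖ₊₁` is generated by `𝔊ₖ` and all `D_i(𝔊ₖ)`. -/
noncomputable def filtration {m n : ℕ} (Ω : Set (Jet m n)) (A : Set (Jet m n → ℝ)) :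
    ℕ → Set (Jet m n → ℝ)
  | 0 => smoothSpan Ω A
  | k + 1 => smoothSpan Ω
      (filtration Ω A k ∪ {F | ∃ i : Fin m, ∃ H ∈ filtration Ω A k, F = act (totalD i) H})

/-- The vector fields `V i` have a common filtration: one that starts from a finitely generated
algebra, exhausts `𝔉`, and has all its steps preserved by all `V i`. -/
def HasCommonFiltration {m n h : ℕ} (Ω : Set (Jet m n)) (V : Fin h → VField m n) : Prop :=
  ∃ A : Set (Jet m n → ℝ), A.Finite ∧ (∀ g ∈ A, IsSmoothOn Ω g) ∧
    (∀ F, IsSmoothOn Ω F → ∃ k, F ∈ filtration Ω A k) ∧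
    ∀ i k, ∀ F ∈ filtration Ω A k, act (V i) F ∈ filtration Ω A k

/-- The ordinary partial derivative `∂_i`. -/
noncomputable def pd {m : ℕ} (i : Fin m) (g : (Fin m → ℝ) → ℝ) (x : Fin m → ℝ) : ℝ :=
  fderiv ℝ g x (Pi.single i 1)

/-- The iterated partial derivative `∂^σ`. -/
noncomputable def pdPow {m : ℕ} (σ : Fin m → ℕ) (g : (Fin m → ℝ) → ℝ) : (Fin m → ℝ) → ℝ :=
  (List.finRange m).foldr (fun i H => (pd i)^[σ i] H) g

/-- The infinite jet `D^∞(f)(x)` of a map `f` at the point `x`. -/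
noncomputable def prolong {m n : ℕ} (f : (Fin m → ℝ) → (Fin n → ℝ)) (x : Fin m → ℝ) : Jet m n
  | Sum.inl i => x i
  | Sum.inr (j, σ) => pdPow σ (fun y => f y j) x

/-- Composition of the flows with indices in a list; the head of the list is applied first. -/
def flowList {m n h : ℕ} (Φ : Fin h → ℝ → Jet m n → Jet m n) (b : Fin h → ℝ) :
    List (Fin h) → Jet m n → Jet m n
  | [], p => p
  | k :: ks, p => flowList Φ b ks (Φ k (b k) p)

/-- All flows in the composition `flowList` are evaluated inside their domains. -/
def flowListDefined {m n h : ℕ} (E : Fin h → Set (ℝ × Jet m n))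
    (Φ : Fin h → ℝ → Jet m n → Jet m n) (b : Fin h → ℝ) : List (Fin h) → Jet m n → Prop
  | [], _ => True
  | k :: ks, p => (b k, p) ∈ E k ∧ flowListDefined E Φ b ks (Φ k (b k) p)

/-- The composed flow `𝚽_b(p) = Φ^h_{b^h}(⋯ (Φ^1_{b^1}(p)) ⋯)`. -/
def compFlow {m n h : ℕ} (Φ : Fin h → ℝ → Jet m n → Jet m n) (b : Fin h → ℝ) (p : Jet m n) :
    Jet m n :=
  flowList Φ b (List.finRange h) p

/-- `𝚽_b(p)` is defined. -/
def compFlowDefined {m n h : ℕ} (E : Fin h → Set (ℝ × Jet m n))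
    (Φ : Fin h → ℝ → Jet m n → Jet m n) (b : Fin h → ℝ) (p : Jet m n) : Prop :=
  flowListDefined E Φ b (List.finRange h) p

/-- The set `⋃_{b ∈ B} 𝚽_b(ℋ)`, where `ℋ` consists of the jets of `f` at the points of `X`. -/
def flowOut {m n h : ℕ} (Φ : Fin h → ℝ → Jet m n → Jet m n)
    (f : (Fin m → ℝ) → (Fin n → ℝ)) (X : Set (Fin m → ℝ)) (B : Set (Fin h → ℝ)) :
    Set (Jet m n) :=
  {p | ∃ b ∈ B, ∃ x ∈ X, p = compFlow Φ b (prolong f x)}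

/-- The functions `(x, a)` are a smooth coordinate system on the set `K`, with range `X × B`; the
map `θ : X × B → K` is the inverse of the coordinate map. -/
structure IsCoordSystem {m n h : ℕ} (K : Set (Jet m n)) (a : Jet m n → Fin h → ℝ)
    (X : Set (Fin m → ℝ)) (B : Set (Fin h → ℝ))
    (θ : (Fin m → ℝ) → (Fin h → ℝ) → Jet m n) : Prop where
  smooth : ∀ c, ContDiffOn ℝ ∞ (fun z : (Fin m → ℝ) × (Fin h → ℝ) => θ z.1 z.2 c) (X ×ˢ B)
  mem : ∀ y ∈ X, ∀ b ∈ B, θ y b ∈ K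
  x_eq : ∀ y ∈ X, ∀ b ∈ B, xpt (θ y b) = y
  a_eq : ∀ y ∈ X, ∀ b ∈ B, a (θ y b) = b
  x_mem : ∀ p ∈ K, xpt p ∈ X
  a_mem : ∀ p ∈ K, a p ∈ B
  inv : ∀ p ∈ K, θ (xpt p) (a p) = p

end InfJet

/-!
The infinite jet space is not a Banach manifold, so neither the inverse function theorem nor the
uniqueness theorem for ordinary differential equations applies to it directly. Both are replaced by
arguments in finitely many coordinates.

*Flows.* The common filtration provides, for finitely many given functions, finitely many
generators `g` such that `V̄_j(g_s)` is a smooth function of the `g_s` for every characteristic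
field `V̄_j`. By Grönwall's inequality, integral curves of `V̄_j` are therefore unique
(`integralCurve_unique`), and the flows are inverted by reversing time
(`IsFlowSystem.eventually_flow_neg`). The commutators of `V̄_j` with the frame `D_1, …, D_m,
V_{G_1}, …, V_{G_h}` are combinations of the frame fields (`act_charField_frame_sub`), so the same
argument applied to the variational equation shows that the flow of `V̄_j` preserves the span of
the frame (`inSpan_transport`), and also the smaller span of all `D_l` and some of the `V_{G_r}`,
provided that it is stable under commutation with `V̄_j`. The velocity of a composition of flows is
therefore a combination of the frame fields (`inSpan_flowList`).

*The swept manifold.* By the nondegeneracy condition, the coordinates `x^l` and `u^{i_k}_{σ^k}`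
form a chart on which the frame is linearly independent (`isFrameChart`), and two families of
integral manifolds of the frame agree where these coordinates agree
(`IsFrameChart.eq_of_chart_eq`). Hence the points `𝚽_b(j^∞ f(y))` fill, locally, the same set as
the points `Φ^1_{-b^1}(⋯ Φ^h_{-b^h}(j^∞ f(y)))`, which are the points that some `𝚽_b` takes to the
jet of `f` (`eventually_backFlow_mem`, `eventually_compFlow_mem`). The second description is the
one in terms of the functions `a`: since the components in question depend on finitely many
coordinates, the equations for `b = a(p)` are solved by the finite-dimensional inverse function
theorem (`exists_times`). Taking the base point of `Φ^1_{-b^1}(⋯ Φ^h_{-b^h}(j^∞ f(y)))` as a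
parameter instead of `y` yields the inverse `θ` of the coordinates `(x, a)`.

*The coefficients.* The derivatives of `θ` by `x` are the fields `D_l`, whence `D_l(a) = 0` on the
swept manifold. The derivatives by `a` are combinations of the `V_{G_r}` with an invertible matrix,
so the `V_{G_i}` are tangent, with the coefficients `φ^l_i = V_{G_i}(a^l)`. These do not depend on
`x`, because the `V_{G_i}` commute with the `D_l`. Where `a^1 = ⋯ = a^{i-1} = 0`, an increase of
`a^i` amounts to following the flow of `-V̄_i`, which differs from `-V_{G_i}` by total derivatives
only; this gives the values of `φ_i`. Finally, the recursive system is the relation `[V_{G_k},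
V_{G_i}] = ∑ λ^p_{k,i} V_{G_p}`, written in the coordinates `(x, a)`. If the last generators span a
subalgebra, then the span of the `D_l` and of the last `V_{G_r}` is preserved by the flows
involved, so that the matrix of the coefficients is block triangular.
-/

namespace InfJet

open Filter Topology Set Asymptotics

variable {m n h : ℕ}

/-! ### Calculus on the jet space -/

/-- The restriction of a jet to finitely many of its coordinates. -/
abbrev res (S : Finset (Coord m n)) (p : Jet m n) : S → ℝ := fun c => p c

/-- The derivative of `F` at `p` in the direction of the tangent vector `ξ`, so that
`act V F p = dirDeriv F p (V p)`. -/
noncomputable def dirDeriv (F : Jet m n → ℝ) (p ξ : Jet m n) : ℝ :=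
  ∑ᶠ c, ξ c * coordDeriv c F p

theorem act_eq_dirDeriv (V : VField m n) (F : Jet m n → ℝ) (p : Jet m n) :
    act V F p = dirDeriv F p (fun c => V c p) := rfl

open Classical in
/-- The jet with prescribed values of the coordinates in `S` and the same values of the other
coordinates as `p`. -/
noncomputable def setCoords (S : Finset (Coord m n)) (p : Jet m n) (v : S → ℝ) : Jet m n :=
  fun c => if hc : c ∈ S then v ⟨c, hc⟩ else p c

theorem setCoords_apply {S : Finset (Coord m n)} (p : Jet m n) (v : S → ℝ) {c : Coord m n}
    (hc : c ∈ S) : setCoords S p v c = v ⟨c, hc⟩ := by simp [setCoords, hc]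

theorem setCoords_res (S : Finset (Coord m n)) (p : Jet m n) : setCoords S p (res S p) = p := by
  funext c
  by_cases hc : c ∈ S <;> simp [setCoords, hc, res]

theorem res_setCoords (S : Finset (Coord m n)) (p : Jet m n) (v : S → ℝ) :
    res S (setCoords S p v) = v :=
  funext fun c => setCoords_apply p v c.2

theorem contDiff_setCoords (S : Finset (Coord m n)) (p : Jet m n) (c : Coord m n) :
    ContDiff ℝ ∞ (fun v => setCoords S p v c) := by
  by_cases hc : c ∈ S
  · simpa [setCoords, hc] using contDiff_apply ℝ ℝ (⟨c, hc⟩ : S)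
  · simpa [setCoords, hc] using! contDiff_const

theorem continuous_setCoords (S : Finset (Coord m n)) (p : Jet m n) :
    Continuous (setCoords S p) :=
  continuous_pi fun c => (contDiff_setCoords S p c).continuous

theorem isOpen_res_image {U : Set (Jet m n)} (hU : IsOpen U) (S : Finset (Coord m n)) :
    IsOpen (res S '' U) := by
  rw [isOpen_iff_mem_nhds]
  rintro _ ⟨p, hp, rfl⟩
  filter_upwards [(hU.preimage (continuous_setCoords S p)).mem_nhds
    (by simpa only [mem_preimage, setCoords_res] using hp)] with v hv
  exact ⟨_, hv, res_setCoords S p v⟩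

theorem continuous_res (S : Finset (Coord m n)) : Continuous (res S) :=
  continuous_pi fun c => continuous_apply (c : Coord m n)

theorem IsSmoothOn.exists_rep {U : Set (Jet m n)} (hU : IsOpen U) {F : Jet m n → ℝ}
    (hF : IsSmoothOn U F) : ∃ (S : Finset (Coord m n)) (g : (S → ℝ) → ℝ),
      (∀ p ∈ U, ContDiffAt ℝ ∞ g (res S p)) ∧ ∀ p ∈ U, F p = g (res S p) := by
  obtain ⟨S, g, hg, hFg⟩ := hF
  refine ⟨S, g, fun p hp => ?_, hFg⟩
  exact (hg _ ⟨p, hp, rfl⟩).contDiffAt ((isOpen_res_image hU S).mem_nhds ⟨p, hp, rfl⟩)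

section Rep

variable {U : Set (Jet m n)} (hU : IsOpen U) {F : Jet m n → ℝ} {S : Finset (Coord m n)}
  {g : (S → ℝ) → ℝ} (hg : ∀ p ∈ U, ContDiffAt ℝ ∞ g (res S p)) (hF : ∀ p ∈ U, F p = g (res S p))
  {P : Type*} [NormedAddCommGroup P] [NormedSpace ℝ P]

include hU hg hF

theorem rep_hasFDerivAt_comp {γ : P → Jet m n} {z : P} {γ' : Coord m n → P →L[ℝ] ℝ}
    (hγ : ∀ c, HasFDerivAt (fun w => γ w c) (γ' c) z) (hz : γ z ∈ U) :
    HasFDerivAt (fun w => F (γ w)) ((fderiv ℝ g (res S (γ z))).comp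
      (ContinuousLinearMap.pi fun c : S => γ' c)) z := by
  have h1 : HasFDerivAt (fun w => res S (γ w)) (ContinuousLinearMap.pi fun c : S => γ' c) z :=
    hasFDerivAt_pi.2 fun c => hγ c
  have h2 : HasFDerivAt g (fderiv ℝ g (res S (γ z))) (res S (γ z)) :=
    ((hg _ hz).differentiableAt (by simp)).hasFDerivAt
  refine (h2.comp z h1).congr_of_eventuallyEq ?_
  have h3 : ContinuousAt γ z := continuousAt_pi.2 fun c => (hγ c).continuousAt
  filter_upwards [h3.preimage_mem_nhds (hU.mem_nhds hz)] with w hw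
  exact hF _ hw

theorem rep_coordDeriv {p : Jet m n} (hp : p ∈ U) (c : Coord m n) :
    coordDeriv c F p = fderiv ℝ g (res S p) (res S (Pi.single c 1)) := by
  have h1 : ∀ c' : Coord m n, HasFDerivAt (fun t : ℝ => Function.update p c t c')
      ((Pi.single (M := fun _ => ℝ) c 1 c' : ℝ) • ContinuousLinearMap.id ℝ ℝ) (p c) := by
    intro c'
    by_cases hc : c' = c
    · subst hc
      simpa using! hasFDerivAt_id (p c')
    · simpa [hc, Function.update_of_ne hc, Pi.single_eq_of_ne hc] using
        hasFDerivAt_const (p c') (p c)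
  have h2 := rep_hasFDerivAt_comp hU hg hF (γ := fun t : ℝ => Function.update p c t) (z := p c) h1
    (by simpa using hp)
  have h3 := h2.hasDerivAt.deriv
  rw [coordDeriv, h3, Function.update_eq_self, ContinuousLinearMap.comp_apply]
  congr 1
  funext c'
  simp [res]

theorem rep_dirDeriv {p : Jet m n} (hp : p ∈ U) (ξ : Jet m n) :
    dirDeriv F p ξ = fderiv ℝ g (res S p) (res S ξ) := by
  classical
  have h0 : ∀ c, coordDeriv c F p = fderiv ℝ g (res S p) (res S (Pi.single c 1)) :=
    rep_coordDeriv hU hg hF hp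
  rw [dirDeriv, finsum_eq_sum_of_support_subset (s := S)]
  · have h1 : res S ξ = ∑ c ∈ S, ξ c • res S (Pi.single c 1) := by
      funext c'
      simp [Finset.sum_apply, Pi.single_apply]
    rw [h1, map_sum]
    exact Finset.sum_congr rfl fun c _ => by rw [map_smul, h0, smul_eq_mul]
  · intro c hc
    by_contra hcS
    apply hc
    have : res S (Pi.single (M := fun _ => ℝ) c 1) = 0 := by
      funext c'
      have : (c' : Coord m n) ≠ c := fun h => hcS (h ▸ c'.2)
      simp [this]
    simp only [h0, this, map_zero, mul_zero]

end Rep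

section Closure

variable {U : Set (Jet m n)}

theorem IsSmoothOn.mono {U' : Set (Jet m n)} {F : Jet m n → ℝ} (hF : IsSmoothOn U F)
    (h : U' ⊆ U) : IsSmoothOn U' F := by
  obtain ⟨S, g, hg, hFg⟩ := hF
  exact ⟨S, g, hg.mono (image_mono h), fun p hp => hFg p (h hp)⟩

theorem IsSmoothOn.congr {F F' : Jet m n → ℝ} (hF : IsSmoothOn U F)
    (h : ∀ p ∈ U, F' p = F p) : IsSmoothOn U F' := by
  obtain ⟨S, g, hg, hFg⟩ := hF
  exact ⟨S, g, hg, fun p hp => (h p hp).trans (hFg p hp)⟩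

theorem isSmoothOn_coord (c : Coord m n) : IsSmoothOn U (fun p => p c) :=
  ⟨{c}, fun v => v ⟨c, Finset.mem_singleton_self c⟩, (contDiff_apply ℝ ℝ _).contDiffOn,
    fun _ _ => rfl⟩

theorem isSmoothOn_const (r : ℝ) : IsSmoothOn U (fun _ : Jet m n => r) :=
  ⟨∅, fun _ => r, contDiffOn_const, fun _ _ => rfl⟩

/-- A smooth function of finitely many smooth functions is smooth. -/
theorem IsSmoothOn.comp {ι : Type*} [Fintype ι] {F : ι → Jet m n → ℝ}
    (hF : ∀ i, IsSmoothOn U (F i)) {W : Set (ι → ℝ)} {ψ : (ι → ℝ) → ℝ} (hψ : ContDiffOn ℝ ∞ ψ W)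
    (hW : ∀ p ∈ U, (fun i => F i p) ∈ W) : IsSmoothOn U (fun p => ψ (fun i => F i p)) := by
  classical
  choose S g hg hFg using hF
  let T : Finset (Coord m n) := Finset.univ.biUnion S
  have hT : ∀ i, ∀ c ∈ S i, c ∈ T := fun i c hc => Finset.mem_biUnion.2 ⟨i, Finset.mem_univ i, hc⟩
  let ρ : ∀ i, (T → ℝ) → (S i → ℝ) := fun i v c => v ⟨c, hT i c c.2⟩
  refine ⟨T, fun v => ψ (fun i => g i (ρ i v)), ?_, fun p hp => ?_⟩
  · refine hψ.comp (t := W) (contDiffOn_pi.2 fun i => ?_) ?_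
    · refine (hg i).comp (contDiffOn_pi.2 fun c => (contDiff_apply ℝ ℝ _).contDiffOn) ?_
      rintro _ ⟨p, hp, rfl⟩
      exact ⟨p, hp, rfl⟩
    · rintro _ ⟨p, hp, rfl⟩
      have : (fun i => F i p) = fun i => g i (ρ i (res T p)) := funext fun i => hFg i p hp
      simpa [this] using hW p hp
  · exact congrArg ψ (funext fun i => hFg i p hp)

theorem IsSmoothOn.sum {ι : Type*} {s : Finset ι} {F : ι → Jet m n → ℝ}
    (hF : ∀ i ∈ s, IsSmoothOn U (F i)) : IsSmoothOn U (fun p => ∑ i ∈ s, F i p) := by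
  have h := IsSmoothOn.comp (ι := s) (F := fun i => F i) (fun i => hF i i.2) (W := univ)
    (ψ := fun v => ∑ i, v i) (ContDiff.sum fun i _ => contDiff_apply ℝ ℝ i).contDiffOn
    (fun _ _ => mem_univ _)
  exact h.congr fun p _ => (Finset.sum_coe_sort s (fun i => F i p)).symm

theorem IsSmoothOn.mul {F F' : Jet m n → ℝ} (hF : IsSmoothOn U F) (hF' : IsSmoothOn U F') :
    IsSmoothOn U (fun p => F p * F' p) :=
  IsSmoothOn.comp (ι := Fin 2) (F := ![F, F']) (fun i => by fin_cases i <;> assumption)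
    (W := univ) (ψ := fun v => v 0 * v 1)
    ((contDiff_apply ℝ ℝ 0).mul (contDiff_apply ℝ ℝ 1)).contDiffOn (fun _ _ => mem_univ _)

theorem IsSmoothOn.add {F F' : Jet m n → ℝ} (hF : IsSmoothOn U F) (hF' : IsSmoothOn U F') :
    IsSmoothOn U (fun p => F p + F' p) :=
  IsSmoothOn.comp (ι := Fin 2) (F := ![F, F']) (fun i => by fin_cases i <;> assumption)
    (W := univ) (ψ := fun v => v 0 + v 1)
    ((contDiff_apply ℝ ℝ 0).add (contDiff_apply ℝ ℝ 1)).contDiffOn (fun _ _ => mem_univ _)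

theorem IsSmoothOn.const_mul {F : Jet m n → ℝ} (r : ℝ) (hF : IsSmoothOn U F) :
    IsSmoothOn U (fun p => r * F p) := (isSmoothOn_const r).mul hF

theorem IsSmoothOn.sub {F F' : Jet m n → ℝ} (hF : IsSmoothOn U F) (hF' : IsSmoothOn U F') :
    IsSmoothOn U (fun p => F p - F' p) :=
  (hF.add (hF'.const_mul (-1))).congr fun p _ => by ring

variable (hU : IsOpen U)
include hU

theorem IsSmoothOn.coordDeriv {F : Jet m n → ℝ} (hF : IsSmoothOn U F) (c : Coord m n) :
    IsSmoothOn U (InfJet.coordDeriv c F) := by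
  classical
  obtain ⟨S, g, hg, hFg⟩ := hF.exists_rep hU
  refine ⟨S, fun v => fderiv ℝ g v (res S (Pi.single c 1)), ?_, fun p hp =>
    rep_coordDeriv hU hg hFg hp c⟩
  rintro _ ⟨p, hp, rfl⟩
  exact (((hg p hp).fderiv_right (m := ∞) (by simp)).clm_apply contDiffAt_const).contDiffWithinAt

/-- Only finitely many partial derivatives of a smooth function differ from zero. -/
theorem IsSmoothOn.exists_finset {F : Jet m n → ℝ} (hF : IsSmoothOn U F) :
    ∃ S : Finset (Coord m n), ∀ p ∈ U, ∀ ξ, dirDeriv F p ξ =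
      ∑ c ∈ S, ξ c * InfJet.coordDeriv c F p := by
  classical
  obtain ⟨S, g, hg, hFg⟩ := hF.exists_rep hU
  refine ⟨S, fun p hp ξ => ?_⟩
  rw [rep_dirDeriv hU hg hFg hp]
  have h1 : res S ξ = ∑ c ∈ S, ξ c • res S (Pi.single c 1) := by
    funext c'
    simp [Finset.sum_apply, Pi.single_apply]
  rw [h1, map_sum]
  exact Finset.sum_congr rfl fun c _ => by
    rw [map_smul, rep_coordDeriv hU hg hFg hp, smul_eq_mul]

theorem IsSmoothOn.act {V : VField m n} (hV : ∀ c, IsSmoothOn U (V c)) {F : Jet m n → ℝ}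
    (hF : IsSmoothOn U F) : IsSmoothOn U (InfJet.act V F) := by
  obtain ⟨S, hS⟩ := hF.exists_finset hU
  refine (IsSmoothOn.sum (s := S) fun c _ => (hV c).mul (hF.coordDeriv hU c)).congr fun p hp => ?_
  exact hS p hp _

section Chain

variable {P : Type*} [NormedAddCommGroup P] [NormedSpace ℝ P]

theorem IsSmoothOn.hasFDerivAt_comp {F : Jet m n → ℝ} (hF : IsSmoothOn U F) {γ : P → Jet m n}
    {z : P} {γ' : Coord m n → P →L[ℝ] ℝ} (hγ : ∀ c, HasFDerivAt (fun w => γ w c) (γ' c) z)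
    (hz : γ z ∈ U) : ∃ L : P →L[ℝ] ℝ, HasFDerivAt (fun w => F (γ w)) L z ∧
      ∀ v, L v = dirDeriv F (γ z) (fun c => γ' c v) := by
  obtain ⟨S, g, hg, hFg⟩ := hF.exists_rep hU
  exact ⟨_, rep_hasFDerivAt_comp hU hg hFg hγ hz,
    fun v => (rep_dirDeriv hU hg hFg hz (fun c => γ' c v)).symm⟩

theorem IsSmoothOn.hasDerivAt_comp {F : Jet m n → ℝ} (hF : IsSmoothOn U F) {γ : ℝ → Jet m n}
    {t : ℝ} {ξ : Jet m n} (hγ : ∀ c, HasDerivAt (fun s => γ s c) (ξ c) t)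
    (ht : γ t ∈ U) : HasDerivAt (fun s => F (γ s)) (dirDeriv F (γ t) ξ) t := by
  obtain ⟨L, hL, hL'⟩ := hF.hasFDerivAt_comp hU (fun c => (hγ c).hasFDerivAt) ht
  have := hL.hasDerivAt
  rw [hL'] at this
  simpa using this

theorem IsSmoothOn.contDiffAt_comp {F : Jet m n → ℝ} (hF : IsSmoothOn U F) {γ : P → Jet m n}
    {z : P} (hγ : ∀ c, ContDiffAt ℝ ∞ (fun w => γ w c) z) (hz : γ z ∈ U) :
    ContDiffAt ℝ ∞ (fun w => F (γ w)) z := by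
  obtain ⟨S, g, hg, hFg⟩ := hF.exists_rep hU
  have h1 : ContDiffAt ℝ ∞ (fun w => res S (γ w)) z := contDiffAt_pi.2 fun c => hγ c
  refine (ContDiffAt.comp z (hg _ hz) h1).congr_of_eventuallyEq ?_
  have h3 : ContinuousAt γ z := continuousAt_pi.2 fun c => (hγ c).continuousAt
  filter_upwards [h3.preimage_mem_nhds (hU.mem_nhds hz)] with w hw
  exact hFg _ hw

theorem IsSmoothOn.fderiv_comp {F : Jet m n → ℝ} (hF : IsSmoothOn U F) {γ : P → Jet m n}
    {z : P} (hγ : ∀ c, ContDiffAt ℝ ∞ (fun w => γ w c) z) (hz : γ z ∈ U) (v : P) :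
    fderiv ℝ (fun w => F (γ w)) z v =
      dirDeriv F (γ z) (fun c => fderiv ℝ (fun w => γ w c) z v) := by
  obtain ⟨L, hL, hL'⟩ := hF.hasFDerivAt_comp hU
    (fun c => ((hγ c).differentiableAt (by simp)).hasFDerivAt) hz
  rw [hL.fderiv, hL']

end Chain

theorem IsSmoothOn.continuousOn {F : Jet m n → ℝ} (hF : IsSmoothOn U F) : ContinuousOn F U := by
  obtain ⟨S, g, hg, hFg⟩ := hF.exists_rep hU
  refine ContinuousOn.congr (f := fun p => g (res S p)) (fun p hp => ?_) hFg
  exact ((hg p hp).continuousAt.comp (continuous_res S).continuousAt).continuousWithinAt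

/-- A directional derivative is a derivative along a straight line. -/
theorem IsSmoothOn.hasDerivAt_line {F : Jet m n → ℝ} (hF : IsSmoothOn U F) {p : Jet m n}
    (hp : p ∈ U) (ξ : Jet m n) :
    HasDerivAt (fun s : ℝ => F (p + s • ξ)) (dirDeriv F p ξ) 0 := by
  have := hF.hasDerivAt_comp hU (γ := fun s : ℝ => p + s • ξ) (t := 0) (ξ := ξ) (fun c => by
    simpa using ((hasDerivAt_id (0 : ℝ)).mul_const (ξ c)).const_add (p c)) (by simpa using hp)
  simpa using this

end Closure

theorem dirDeriv_single (F : Jet m n → ℝ) (q : Jet m n)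
    (c : Coord m n) : dirDeriv F q (Pi.single c 1) = coordDeriv c F q := by
  rw [dirDeriv, finsum_eq_single _ c (fun d hd => by simp [Pi.single_eq_of_ne hd])]
  simp

section Rules

variable {U : Set (Jet m n)} (hU : IsOpen U) {p : Jet m n} (hp : p ∈ U)
include hU hp

theorem dirDeriv_congr {F F' : Jet m n → ℝ} (h : ∀ q ∈ U, F q = F' q) (ξ : Jet m n) :
    dirDeriv F p ξ = dirDeriv F' p ξ := by
  refine finsum_congr fun c => ?_
  congr 1
  refine EventuallyEq.deriv_eq ?_
  have h1 : ContinuousAt (fun t => Function.update p c t) (p c) :=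
    (continuous_const.update c continuous_id).continuousAt
  filter_upwards [h1.preimage_mem_nhds (hU.mem_nhds (by simpa using hp))] with t ht
  exact h _ ht

theorem act_congr {F F' : Jet m n → ℝ} (h : ∀ q ∈ U, F q = F' q) (V : VField m n) :
    act V F p = act V F' p := dirDeriv_congr hU hp h _

theorem dirDeriv_sum_right {F : Jet m n → ℝ} (hF : IsSmoothOn U F) {ι : Type*} (s : Finset ι)
    (α : ι → ℝ) (ξ : ι → Jet m n) :
    dirDeriv F p (fun c => ∑ i ∈ s, α i * ξ i c) = ∑ i ∈ s, α i * dirDeriv F p (ξ i) := by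
  obtain ⟨S, hS⟩ := hF.exists_finset hU
  simp only [hS p hp, Finset.sum_mul, Finset.mul_sum]
  rw [Finset.sum_comm]
  exact Finset.sum_congr rfl fun i _ => Finset.sum_congr rfl fun c _ => by ring

theorem dirDeriv_sub_right {F : Jet m n → ℝ} (hF : IsSmoothOn U F) (ξ ξ' : Jet m n) :
    dirDeriv F p (fun c => ξ c - ξ' c) = dirDeriv F p ξ - dirDeriv F p ξ' := by
  obtain ⟨S, hS⟩ := hF.exists_finset hU
  simp only [hS p hp, sub_mul, Finset.sum_sub_distrib]

theorem dirDeriv_smul_right {F : Jet m n → ℝ} (hF : IsSmoothOn U F) (r : ℝ) (ξ : Jet m n) :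
    dirDeriv F p (fun c => r * ξ c) = r * dirDeriv F p ξ := by
  obtain ⟨S, hS⟩ := hF.exists_finset hU
  simp only [hS p hp, mul_assoc, Finset.mul_sum]

theorem dirDeriv_zero_right {F : Jet m n → ℝ} (hF : IsSmoothOn U F) :
    dirDeriv F p (fun _ => 0) = 0 := by
  obtain ⟨S, hS⟩ := hF.exists_finset hU
  simp [hS p hp]

theorem dirDeriv_coord (c : Coord m n) (ξ : Jet m n) : dirDeriv (fun q => q c) p ξ = ξ c := by
  have h1 := (isSmoothOn_coord (U := U) c).hasDerivAt_line hU hp ξ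
  have h2 : HasDerivAt (fun s : ℝ => (p + s • ξ) c) (ξ c) 0 := by
    simpa using ((hasDerivAt_id (0 : ℝ)).mul_const (ξ c)).const_add (p c)
  exact h1.unique h2

theorem dirDeriv_const (r : ℝ) (ξ : Jet m n) : dirDeriv (fun _ => r) p ξ = 0 :=
  ((isSmoothOn_const (U := U) r).hasDerivAt_line hU hp ξ).unique (hasDerivAt_const _ _)

theorem dirDeriv_comp {ι : Type*} [Fintype ι] {F : ι → Jet m n → ℝ}
    (hF : ∀ i, IsSmoothOn U (F i)) {W : Set (ι → ℝ)} (hWo : IsOpen W) {ψ : (ι → ℝ) → ℝ}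
    (hψ : ContDiffOn ℝ ∞ ψ W) (hW : ∀ q ∈ U, (fun i => F i q) ∈ W) (ξ : Jet m n) :
    dirDeriv (fun q => ψ (fun i => F i q)) p ξ =
      fderiv ℝ ψ (fun i => F i p) (fun i => dirDeriv (F i) p ξ) := by
  have h1 := (IsSmoothOn.comp hF hψ hW).hasDerivAt_line hU hp ξ
  have h2 : HasDerivAt (fun s : ℝ => fun i => F i (p + s • ξ)) (fun i => dirDeriv (F i) p ξ) 0 :=
    hasDerivAt_pi.2 fun i => (hF i).hasDerivAt_line hU hp ξ
  have h3 : HasFDerivAt ψ (fderiv ℝ ψ (fun i => F i p)) (fun i => F i (p + (0 : ℝ) • ξ)) := by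
    simpa using (((hψ _ (hW p hp)).contDiffAt (hWo.mem_nhds (hW p hp))).differentiableAt
      (by simp)).hasFDerivAt
  exact h1.unique (h3.comp_hasDerivAt (0 : ℝ) h2)

theorem dirDeriv_mul {F F' : Jet m n → ℝ} (hF : IsSmoothOn U F) (hF' : IsSmoothOn U F')
    (ξ : Jet m n) :
    dirDeriv (fun q => F q * F' q) p ξ = dirDeriv F p ξ * F' p + F p * dirDeriv F' p ξ := by
  have h1 := (hF.mul hF').hasDerivAt_line hU hp ξ
  have h2 := (hF.hasDerivAt_line hU hp ξ).mul (hF'.hasDerivAt_line hU hp ξ)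
  simpa using h1.unique h2

theorem dirDeriv_sub {F F' : Jet m n → ℝ} (hF : IsSmoothOn U F) (hF' : IsSmoothOn U F')
    (ξ : Jet m n) :
    dirDeriv (fun q => F q - F' q) p ξ = dirDeriv F p ξ - dirDeriv F' p ξ :=
  ((hF.sub hF').hasDerivAt_line hU hp ξ).unique
    ((hF.hasDerivAt_line hU hp ξ).sub (hF'.hasDerivAt_line hU hp ξ))

theorem dirDeriv_sum {ι : Type*} (s : Finset ι) {F : ι → Jet m n → ℝ}
    (hF : ∀ i ∈ s, IsSmoothOn U (F i)) (ξ : Jet m n) :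
    dirDeriv (fun q => ∑ i ∈ s, F i q) p ξ = ∑ i ∈ s, dirDeriv (F i) p ξ :=
  ((IsSmoothOn.sum hF).hasDerivAt_line hU hp ξ).unique
    (HasDerivAt.fun_sum fun i hi => (hF i hi).hasDerivAt_line hU hp ξ)

theorem dirDeriv_const_mul {F : Jet m n → ℝ} (hF : IsSmoothOn U F) (r : ℝ) (ξ : Jet m n) :
    dirDeriv (fun q => r * F q) p ξ = r * dirDeriv F p ξ :=
  ((hF.const_mul r).hasDerivAt_line hU hp ξ).unique
    ((hF.hasDerivAt_line hU hp ξ).const_mul r)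

theorem coordDeriv_comm {F : Jet m n → ℝ} (hF : IsSmoothOn U F) (c c' : Coord m n) :
    coordDeriv c (coordDeriv c' F) p = coordDeriv c' (coordDeriv c F) p := by
  classical
  obtain ⟨S, g, hg, hFg⟩ := hF.exists_rep hU
  have key : ∀ c c' : Coord m n, coordDeriv c (coordDeriv c' F) p =
      fderiv ℝ (fderiv ℝ g) (res S p) (res S (Pi.single c 1)) (res S (Pi.single c' 1)) := by
    intro c c'
    have h1 : ∀ q ∈ U, ContDiffAt ℝ ∞ (fun v => fderiv ℝ g v (res S (Pi.single c' 1)))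
        (res S q) := fun q hq =>
      ((hg q hq).fderiv_right (m := ∞) (by simp)).clm_apply contDiffAt_const
    rw [rep_coordDeriv hU h1 (fun q hq => rep_coordDeriv hU hg hFg hq c') hp c]
    have h2 : DifferentiableAt ℝ (fderiv ℝ g) (res S p) :=
      ((hg p hp).fderiv_right (m := ∞) (by simp)).differentiableAt (by simp)
    rw [fderiv_clm_apply h2 (differentiableAt_const _)]
    simp
  rw [key, key]
  exact (hg p hp).isSymmSndFDerivAt (by simpa using ENat.LEInfty.out) _ _

theorem dirDeriv_coordDeriv {F : Jet m n → ℝ} (hF : IsSmoothOn U F) {S : Finset (Coord m n)}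
    (hS : ∀ q ∈ U, ∀ ξ, dirDeriv F q ξ = ∑ c ∈ S, ξ c * coordDeriv c F q) (c : Coord m n)
    (ξ : Jet m n) : dirDeriv (coordDeriv c F) p ξ =
      ∑ c' ∈ S, ξ c' * coordDeriv c' (coordDeriv c F) p := by
  classical
  refine finsum_eq_sum_of_support_subset _ fun c' hc' => ?_
  by_contra hcS
  have h4 : ∀ q ∈ U, coordDeriv c' F q = (fun _ => 0) q := by
    intro q hq
    rw [← dirDeriv_single, hS q hq]
    refine Finset.sum_eq_zero fun d hd => ?_
    have : d ≠ c' := fun h => hcS (h ▸ hd)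
    simp [Pi.single_eq_of_ne this]
  apply hc'
  simp only
  rw [coordDeriv_comm hU hp hF, ← dirDeriv_single (coordDeriv c' F),
    dirDeriv_congr hU hp h4, dirDeriv_const hU hp, mul_zero]

/-- The derivative of `V(F)`, expanded by the product rule with the second derivatives of `F`
interchanged. -/
theorem dirDeriv_act {V : VField m n} (hV : ∀ c, IsSmoothOn U (V c)) {F : Jet m n → ℝ}
    (hF : IsSmoothOn U F) {S : Finset (Coord m n)}
    (hS : ∀ q ∈ U, ∀ ξ, dirDeriv F q ξ = ∑ c ∈ S, ξ c * coordDeriv c F q) (ξ : Jet m n) :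
    dirDeriv (act V F) p ξ = dirDeriv F p (fun c => dirDeriv (V c) p ξ) +
      ∑ c ∈ S, ξ c * act V (coordDeriv c F) p := by
  have h1 : ∀ q ∈ U, act V F q = ∑ c ∈ S, V c q * coordDeriv c F q := fun q hq => hS q hq _
  rw [dirDeriv_congr hU hp h1, dirDeriv_sum hU hp S fun c _ => (hV c).mul (hF.coordDeriv hU c)]
  simp only [dirDeriv_mul hU hp (hV _) (hF.coordDeriv hU _), Finset.sum_add_distrib, hS p hp]
  congr 1
  simp only [act_eq_dirDeriv, dirDeriv_coordDeriv hU hp hF hS, Finset.mul_sum]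
  rw [Finset.sum_comm]
  refine Finset.sum_congr rfl fun c _ => Finset.sum_congr rfl fun c' _ => ?_
  rw [coordDeriv_comm hU hp hF]
  ring

theorem act_act_sub {V W : VField m n} (hV : ∀ c, IsSmoothOn U (V c))
    (hW : ∀ c, IsSmoothOn U (W c)) {F : Jet m n → ℝ} (hF : IsSmoothOn U F) :
    act V (act W F) p - act W (act V F) p =
      dirDeriv F p (fun c => act V (W c) p - act W (V c) p) := by
  obtain ⟨S, hS⟩ := hF.exists_finset hU
  have e5 : ∑ c ∈ S, V c p * act W (coordDeriv c F) p =
      ∑ c ∈ S, W c p * act V (coordDeriv c F) p := by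
    simp only [act_eq_dirDeriv, dirDeriv_coordDeriv hU hp hF hS, Finset.mul_sum]
    rw [Finset.sum_comm]
    refine Finset.sum_congr rfl fun c _ => Finset.sum_congr rfl fun c' _ => ?_
    rw [coordDeriv_comm hU hp hF]
    ring
  rw [dirDeriv_sub_right hU hp hF, act_eq_dirDeriv V (act W F), act_eq_dirDeriv W (act V F),
    dirDeriv_act hU hp hW hF hS, dirDeriv_act hU hp hV hF hS, e5]
  simp only [act_eq_dirDeriv]
  ring

end Rules

/-! ### Powers of commuting operators -/

section Powers

variable {X : Type*} {A : Set X} {C : (X → ℝ) → Prop} {T : Fin m → (X → ℝ) → X → ℝ}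
  {T' : (X → ℝ) → X → ℝ}

theorem iterate_property {T' : (X → ℝ) → X → ℝ} (hC : ∀ F, C F → C (T' F)) {F : X → ℝ} (hF : C F)
    (k : ℕ) : C (T'^[k] F) := by
  induction k with
  | zero => exact hF
  | succ k ih => rw [Function.iterate_succ_apply']; exact hC _ ih

theorem iterate_congr (hT' : ∀ F F', EqOn F F' A → EqOn (T' F) (T' F') A)
    {F F' : X → ℝ} (hF : EqOn F F' A) (k : ℕ) : EqOn (T'^[k] F) (T'^[k] F') A := by
  induction k with
  | zero => exact hF
  | succ k ih => rw [Function.iterate_succ_apply', Function.iterate_succ_apply']; exact hT' _ _ ih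

theorem foldr_property (hC : ∀ i F, C F → C (T i F)) (σ : Fin m → ℕ) {F : X → ℝ} (hF : C F)
    (L : List (Fin m)) : C (L.foldr (fun i H => (T i)^[σ i] H) F) := by
  induction L with
  | nil => exact hF
  | cons i L ih => exact iterate_property (hC i) ih _

theorem foldr_congr_on (hT : ∀ i F F', EqOn F F' A → EqOn (T i F) (T i F') A) (σ : Fin m → ℕ)
    {F F' : X → ℝ} (hF : EqOn F F' A) (L : List (Fin m)) :
    EqOn (L.foldr (fun i H => (T i)^[σ i] H) F) (L.foldr (fun i H => (T i)^[σ i] H) F') A := by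
  induction L with
  | nil => exact hF
  | cons i L ih => exact iterate_congr (hT i) ih _

theorem iterate_comm {T₁ : (X → ℝ) → X → ℝ} (hC₁ : ∀ F, C F → C (T₁ F))
    (hT₁ : ∀ F F', EqOn F F' A → EqOn (T₁ F) (T₁ F') A)
    (hcomm : ∀ F, C F → EqOn (T' (T₁ F)) (T₁ (T' F)) A) {F : X → ℝ} (hF : C F) (k : ℕ) :
    EqOn (T' (T₁^[k] F)) (T₁^[k] (T' F)) A := by
  induction k with
  | zero => exact fun _ _ => rfl
  | succ k ih =>
    rw [Function.iterate_succ_apply', Function.iterate_succ_apply']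
    exact (hcomm _ (iterate_property hC₁ hF k)).trans (hT₁ _ _ ih)

theorem foldr_comm (hC : ∀ i F, C F → C (T i F))
    (hT : ∀ i F F', EqOn F F' A → EqOn (T i F) (T i F') A)
    (hcomm : ∀ i F, C F → EqOn (T' (T i F)) (T i (T' F)) A) (σ : Fin m → ℕ) {F : X → ℝ}
    (hF : C F) (L : List (Fin m)) :
    EqOn (T' (L.foldr (fun i H => (T i)^[σ i] H) F))
      (L.foldr (fun i H => (T i)^[σ i] H) (T' F)) A := by
  induction L with
  | nil => exact fun _ _ => rfl
  | cons i L ih =>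
    exact (iterate_comm (hC i) (hT i) (hcomm i) (foldr_property hC σ hF L) _).trans
      (iterate_congr (hT i) ih _)

/-- Raising one exponent by one amounts to applying the corresponding operator once more, provided
that the operators commute. -/
theorem foldr_add_single (hC : ∀ i F, C F → C (T i F))
    (hT : ∀ i F F', EqOn F F' A → EqOn (T i F) (T i F') A)
    (hcomm : ∀ i j F, C F → EqOn (T j (T i F)) (T i (T j F)) A) (σ : Fin m → ℕ) (j : Fin m)
    {F : X → ℝ} (hF : C F) (L : List (Fin m)) (hL : L.Nodup) (hj : j ∈ L) :
    EqOn (L.foldr (fun i H => (T i)^[(σ + Pi.single j 1 : Fin m → ℕ) i] H) F)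
      (T j (L.foldr (fun i H => (T i)^[σ i] H) F)) A := by
  induction L with
  | nil => simp at hj
  | cons i L ih =>
    rw [List.nodup_cons] at hL
    by_cases hij : i = j
    · subst hij
      have h1 : L.foldr (fun k H => (T k)^[(σ + Pi.single i 1 : Fin m → ℕ) k] H) F =
          L.foldr (fun k H => (T k)^[σ k] H) F := by
        refine List.foldr_ext _ _ _ fun k hk H => ?_
        have : k ≠ i := fun h => hL.1 (h ▸ hk)
        simp [this]
      simp only [List.foldr_cons, h1]
      simp only [Pi.add_apply, Pi.single_eq_same, Function.iterate_succ_apply']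
      exact fun _ _ => rfl
    · have hjL : j ∈ L := by
        rcases List.mem_cons.1 hj with h | h
        · exact absurd h.symm hij
        · exact h
      simp only [List.foldr_cons, Pi.add_apply, Pi.single_eq_of_ne hij, add_zero]
      exact (iterate_congr (hT i) (ih hL.2 hjL) _).trans
        (iterate_comm (hC i) (hT i) (hcomm i j) (foldr_property hC σ hF L) _).symm

end Powers

/-! ### Total derivatives and evolution fields -/

section Total

variable {U : Set (Jet m n)} (hU : IsOpen U)

theorem isSmoothOn_totalD (i : Fin m) (c : Coord m n) : IsSmoothOn U (totalD i c) := by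
  rcases c with l | ⟨k, σ⟩
  · exact isSmoothOn_const _
  · exact isSmoothOn_coord _

include hU

theorem IsSmoothOn.act_totalD (i : Fin m) {F : Jet m n → ℝ} (hF : IsSmoothOn U F) :
    IsSmoothOn U (InfJet.act (totalD i) F) := hF.act hU (isSmoothOn_totalD i)

theorem act_totalD_comm (i j : Fin m) {F : Jet m n → ℝ} (hF : IsSmoothOn U F) :
    EqOn (act (totalD i) (act (totalD j) F)) (act (totalD j) (act (totalD i) F)) U := by
  intro p hp
  refine sub_eq_zero.1 ?_
  rw [act_act_sub hU hp (isSmoothOn_totalD i) (isSmoothOn_totalD j) hF]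
  have h0 : (fun c => act (totalD i) (totalD j c) p - act (totalD j) (totalD i c) p) =
      fun _ : Coord m n => (0 : ℝ) := by
    funext c
    rcases c with l | ⟨k, σ⟩
    · have (a b : Fin m) : act (totalD (n := n) a) (totalD b (Sum.inl l)) p = 0 :=
        dirDeriv_const hU hp _ _
      simp [this]
    · have (a b : Fin m) : act (totalD (n := n) a) (totalD b (Sum.inr (k, σ))) p =
          p (Sum.inr (k, σ + Pi.single b 1 + Pi.single a 1)) :=
        dirDeriv_coord hU hp _ _
      rw [this, this, add_right_comm, sub_self]
  rw [h0, dirDeriv_zero_right hU hp hF]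

theorem IsSmoothOn.totalDPow (σ : Fin m → ℕ) {F : Jet m n → ℝ} (hF : IsSmoothOn U F) :
    IsSmoothOn U (InfJet.totalDPow σ F) :=
  foldr_property (C := IsSmoothOn U) (fun i _ h => h.act_totalD hU i) σ hF _

theorem totalDPow_congr (σ : Fin m → ℕ) {F F' : Jet m n → ℝ} (h : EqOn F F' U) :
    EqOn (totalDPow σ F) (totalDPow σ F') U :=
  foldr_congr_on (fun i _ _ h _ hp => act_congr hU hp h (totalD i)) σ h _

theorem totalDPow_add_single (σ : Fin m → ℕ) (j : Fin m) {F : Jet m n → ℝ}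
    (hF : IsSmoothOn U F) :
    EqOn (totalDPow (σ + Pi.single j 1) F) (act (totalD j) (totalDPow σ F)) U :=
  foldr_add_single (C := IsSmoothOn U) (fun i _ h => h.act_totalD hU i)
    (fun i _ _ h _ hp => act_congr hU hp h (totalD i))
    (fun i j _ hF => act_totalD_comm hU j i hF) σ j hF _ (List.nodup_finRange m)
    (List.mem_finRange j)

theorem totalDPow_sum {ι : Type*} [Fintype ι] (r : ι → ℝ) (σ : Fin m → ℕ) {F : ι → Jet m n → ℝ}
    (hF : ∀ k, IsSmoothOn U (F k)) :
    EqOn (totalDPow σ (fun p => ∑ k, r k * F k p)) (fun p => ∑ k, r k * totalDPow σ (F k) p) U := by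
  have step : ∀ (i : Fin m) (F : ι → Jet m n → ℝ), (∀ k, IsSmoothOn U (F k)) →
      EqOn (act (totalD i) (fun p => ∑ k, r k * F k p))
        (fun p => ∑ k, r k * act (totalD i) (F k) p) U := by
    intro i F hF p hp
    simp only [act_eq_dirDeriv]
    rw [dirDeriv_sum hU hp _ fun k _ => (hF k).const_mul (r k)]
    exact Finset.sum_congr rfl fun k _ => dirDeriv_const_mul hU hp (hF k) _ _
  have step' : ∀ (i : Fin m) (N : ℕ) (F : ι → Jet m n → ℝ), (∀ k, IsSmoothOn U (F k)) →
      EqOn ((act (totalD i))^[N] (fun p => ∑ k, r k * F k p))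
        (fun p => ∑ k, r k * (act (totalD i))^[N] (F k) p) U := by
    intro i N F hF
    induction N with
    | zero => exact fun _ _ => rfl
    | succ N ih =>
      simp only [Function.iterate_succ_apply']
      have h1 : EqOn (act (totalD i) _) (act (totalD i) _) U := fun p hp =>
        act_congr hU hp ih (totalD i)
      exact h1.trans (step i _ fun k =>
        iterate_property (C := IsSmoothOn U) (fun _ h => h.act_totalD hU i) (hF k) N)
  rw [totalDPow]
  unfold totalDPow
  induction List.finRange m with
  | nil => exact fun _ _ => rfl
  | cons i L ih =>
    exact (iterate_congr (A := U) (fun _ _ h _ hp => act_congr hU hp h (totalD i)) ih _).trans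
      (step' i _ _ fun k => foldr_property (C := IsSmoothOn U) (fun i _ h => h.act_totalD hU i) σ
        (hF k) L)

theorem isSmoothOn_evol {G : Fin n → Jet m n → ℝ} (hG : ∀ j, IsSmoothOn U (G j))
    (c : Coord m n) : IsSmoothOn U (evol G c) := by
  rcases c with l | ⟨k, σ⟩
  · exact isSmoothOn_const _
  · exact (hG k).totalDPow hU σ

/-- Evolution fields commute with total derivatives. -/
theorem act_evol_totalD_comm {G : Fin n → Jet m n → ℝ} (hG : ∀ j, IsSmoothOn U (G j)) (i : Fin m)
    {F : Jet m n → ℝ} (hF : IsSmoothOn U F) :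
    EqOn (act (evol G) (act (totalD i) F)) (act (totalD i) (act (evol G) F)) U := by
  intro p hp
  refine sub_eq_zero.1 ?_
  rw [act_act_sub hU hp (isSmoothOn_evol hU hG) (isSmoothOn_totalD i) hF]
  have h0 : (fun c => act (evol G) (totalD i c) p - act (totalD i) (evol G c) p) =
      fun _ : Coord m n => (0 : ℝ) := by
    funext c
    rcases c with l | ⟨k, σ⟩
    · have h1 : act (evol G) (totalD i (Sum.inl l)) p = 0 := dirDeriv_const hU hp _ _
      have h2 : act (totalD i) (evol G (Sum.inl l)) p = 0 := dirDeriv_const hU hp _ _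
      simp [h1, h2]
    · have h1 : act (evol G) (totalD i (Sum.inr (k, σ))) p =
          totalDPow (σ + Pi.single i 1) (G k) p := dirDeriv_coord hU hp _ _
      rw [h1, totalDPow_add_single hU σ i (hG k) hp, sub_eq_zero]
      rfl
  rw [h0, dirDeriv_zero_right hU hp hF]

theorem act_evol_totalDPow {G : Fin n → Jet m n → ℝ} (hG : ∀ j, IsSmoothOn U (G j))
    (σ : Fin m → ℕ) {F : Jet m n → ℝ} (hF : IsSmoothOn U F) :
    EqOn (act (evol G) (totalDPow σ F)) (totalDPow σ (act (evol G) F)) U :=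
  foldr_comm (C := IsSmoothOn U) (fun i _ h => h.act_totalD hU i)
    (fun i _ _ h _ hp => act_congr hU hp h (totalD i))
    (fun i _ hF => act_evol_totalD_comm hU hG i hF) σ hF _

/-- If the generators `G` span a Lie algebra with structure constants `lam`, then so do the
evolution fields. -/
theorem act_evol_evol_sub {G : Fin h → Fin n → Jet m n → ℝ} (hG : ∀ i j, IsSmoothOn U (G i j))
    {lam : Fin h → Fin h → Fin h → ℝ}
    (hlam : ∀ i j s, ∀ p ∈ U, bracket (G i) (G j) s p = ∑ k, lam i j k * G k s p)
    (i j : Fin h) {F : Jet m n → ℝ} (hF : IsSmoothOn U F) {p : Jet m n} (hp : p ∈ U) :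
    act (evol (G i)) (act (evol (G j)) F) p - act (evol (G j)) (act (evol (G i)) F) p =
      ∑ k, lam i j k * act (evol (G k)) F p := by
  rw [act_act_sub hU hp (isSmoothOn_evol hU (hG i)) (isSmoothOn_evol hU (hG j)) hF]
  simp only [act_eq_dirDeriv _ F]
  rw [← dirDeriv_sum_right hU hp hF]
  congr 1
  funext c
  rcases c with l | ⟨s, σ⟩
  · have (a b : Fin h) : act (evol (G a)) (evol (G b) (Sum.inl l)) p = 0 :=
      dirDeriv_const hU hp _ _
    simp [this, evol]
  · have h1 : ∀ a b : Fin h, IsSmoothOn U (act (evol (G a)) (G b s)) := fun a b =>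
      (hG b s).act hU (isSmoothOn_evol hU (hG a))
    have h2 : ∀ a b : Fin h, act (evol (G a)) (evol (G b) (Sum.inr (s, σ))) p =
        totalDPow σ (act (evol (G a)) (G b s)) p := fun a b =>
      act_evol_totalDPow hU (hG a) σ (hG b s) hp
    rw [h2, h2]
    have h3 := totalDPow_sum hU (fun b : Bool => if b then (1 : ℝ) else -1) σ
      (F := fun b => if b then act (evol (G i)) (G j s) else act (evol (G j)) (G i s))
      (fun b => by cases b <;> simp [h1]) hp
    simp only [Fintype.sum_bool, if_true, Bool.false_eq_true, if_false, one_mul, neg_mul,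
      ← sub_eq_add_neg] at h3
    rw [← h3]
    have h4 : EqOn (fun p => act (evol (G i)) (G j s) p - act (evol (G j)) (G i s) p)
        (fun p => ∑ k, lam i j k * G k s p) U := fun q hq => hlam i j s q hq
    rw [totalDPow_congr hU σ h4 hp, totalDPow_sum hU _ σ (fun k => hG k s) hp]
    rfl

omit hU in
/-- The fields `D_1, …, D_m, V_{G_1}, …, V_{G_h}`. -/
noncomputable def frame (G : Fin h → Fin n → Jet m n → ℝ) : Fin m ⊕ Fin h → VField m n :=
  Sum.elim totalD (fun r => evol (G r))

theorem isSmoothOn_frame {G : Fin h → Fin n → Jet m n → ℝ} (hG : ∀ i j, IsSmoothOn U (G i j))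
    (k : Fin m ⊕ Fin h) (c : Coord m n) : IsSmoothOn U (frame G k c) := by
  rcases k with l | r
  · exact isSmoothOn_totalD l c
  · exact isSmoothOn_evol hU (hG r) c

theorem isSmoothOn_charField {F : Fin n → Jet m n → ℝ} (hF : ∀ j, IsSmoothOn U (F j))
    {η : Fin m → Jet m n → ℝ} (hη : ∀ l, IsSmoothOn U (η l)) (c : Coord m n) :
    IsSmoothOn U (charField F η c) :=
  (isSmoothOn_evol hU hF c).sub (IsSmoothOn.sum fun l _ => (hη l).mul (isSmoothOn_totalD l c))

theorem act_charField (G : Fin n → Jet m n → ℝ) (η : Fin m → Jet m n → ℝ) {F : Jet m n → ℝ}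
    (hF : IsSmoothOn U F) {p : Jet m n} (hp : p ∈ U) :
    act (charField G η) F p = act (evol G) F p - ∑ l, η l p * act (totalD l) F p := by
  simp only [act_eq_dirDeriv, charField]
  rw [dirDeriv_sub_right hU hp hF, dirDeriv_sum_right hU hp hF]

/-- The coefficients of the commutators of the characteristic field of `G_j` with the frame. -/
noncomputable def bracketCoeff (G : Fin h → Fin n → Jet m n → ℝ) (lam : Fin h → Fin h → Fin h → ℝ)
    (η : Fin h → Fin m → Jet m n → ℝ) (j : Fin h) (k : Fin m ⊕ Fin h) :
    Fin m ⊕ Fin h → Jet m n → ℝ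
  | Sum.inl l => act (frame G k) (η j l)
  | Sum.inr s => fun _ => Sum.elim (fun _ => 0) (fun r => lam j r s) k

theorem act_charField_frame_sub {G : Fin h → Fin n → Jet m n → ℝ}
    (hG : ∀ i j, IsSmoothOn U (G i j)) {lam : Fin h → Fin h → Fin h → ℝ}
    (hlam : ∀ i j s, ∀ p ∈ U, bracket (G i) (G j) s p = ∑ k, lam i j k * G k s p)
    {η : Fin h → Fin m → Jet m n → ℝ} (hη : ∀ i l, IsSmoothOn U (η i l))
    (j : Fin h) (k : Fin m ⊕ Fin h) {F : Jet m n → ℝ} (hF : IsSmoothOn U F) {p : Jet m n}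
    (hp : p ∈ U) :
    act (charField (G j) (η j)) (act (frame G k) F) p -
      act (frame G k) (act (charField (G j) (η j)) F) p =
      ∑ l, bracketCoeff G lam η j k l p * act (frame G l) F p := by
  have hW := isSmoothOn_frame hU hG
  have hV := fun j => isSmoothOn_evol hU (hG j)
  have hD : ∀ l, IsSmoothOn U (act (totalD l) F) := fun l => hF.act_totalD hU l
  rw [act_charField hU _ _ (hF.act hU (hW k)) hp]
  have h1 : act (frame G k) (act (charField (G j) (η j)) F) p =
      act (frame G k) (act (evol (G j)) F) p - ∑ l, (act (frame G k) (η j l) p *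
        act (totalD l) F p + η j l p * act (frame G k) (act (totalD l) F) p) := by
    rw [act_congr hU hp (fun q hq => act_charField hU (G j) (η j) hF hq)]
    simp only [act_eq_dirDeriv (frame G k)]
    rw [dirDeriv_sub hU hp (hF.act hU (hV j)) (IsSmoothOn.sum fun l _ => (hη j l).mul (hD l)),
      dirDeriv_sum hU hp _ fun l _ => (hη j l).mul (hD l)]
    simp only [dirDeriv_mul hU hp (hη j _) (hD _)]
  have h2 : ∀ l, act (frame G k) (act (totalD l) F) p = act (totalD l) (act (frame G k) F) p := by
    intro l
    rcases k with k | r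
    · exact act_totalD_comm hU k l hF hp
    · exact act_evol_totalD_comm hU (hG r) l hF hp
  have h3 : act (evol (G j)) (act (frame G k) F) p - act (frame G k) (act (evol (G j)) F) p =
      ∑ s, Sum.elim (fun _ => 0) (fun r => lam j r s) k * act (evol (G s)) F p := by
    rcases k with k | r
    · simpa [sub_eq_zero] using! act_evol_totalD_comm hU (hG j) k hF hp
    · exact act_evol_evol_sub hU hG hlam j r hF hp
  rw [h1, Fintype.sum_sum_type]
  simp only [h2, Finset.sum_add_distrib, bracketCoeff]
  have h4 : ∀ s, act (frame G (Sum.inr s)) F p = act (evol (G s)) F p := fun _ => rfl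
  have h5 : ∀ l, act (frame G (Sum.inl l)) F p = act (totalD l) F p := fun _ => rfl
  simp only [h4, h5]
  linarith [h3]

end Total

/-! ### Prolongations -/

section Prolong

variable {M : Set (Fin m → ℝ)} (hM : IsOpen M)
include hM

theorem contDiffOn_pd (i : Fin m) {g : (Fin m → ℝ) → ℝ} (hg : ContDiffOn ℝ ∞ g M) :
    ContDiffOn ℝ ∞ (pd i g) M :=
  (hg.fderiv_of_isOpen hM (by simp)).clm_apply contDiffOn_const

theorem pd_congr (i : Fin m) {g g' : (Fin m → ℝ) → ℝ} (h : EqOn g g' M) :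
    EqOn (pd i g) (pd i g') M := fun x hx => by
  have : g =ᶠ[𝓝 x] g' := by filter_upwards [hM.mem_nhds hx] with y hy using h hy
  simp only [pd, this.fderiv_eq]

theorem pd_comm (i j : Fin m) {g : (Fin m → ℝ) → ℝ} (hg : ContDiffOn ℝ ∞ g M) :
    EqOn (pd i (pd j g)) (pd j (pd i g)) M := by
  intro x hx
  have key : ∀ i j : Fin m, pd i (pd j g) x =
      fderiv ℝ (fderiv ℝ g) x (Pi.single i 1) (Pi.single j 1) := by
    intro i j
    have h2 : DifferentiableAt ℝ (fderiv ℝ g) x :=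
      (((hg.fderiv_of_isOpen hM (m := ∞) (by simp)) x hx).contDiffAt
        (hM.mem_nhds hx)).differentiableAt (by simp)
    unfold pd
    rw [fderiv_clm_apply h2 (differentiableAt_const _)]
    simp
  rw [key, key]
  exact ((hg x hx).contDiffAt (hM.mem_nhds hx)).isSymmSndFDerivAt
    (by simpa using ENat.LEInfty.out) _ _

theorem contDiffOn_pdPow (σ : Fin m → ℕ) {g : (Fin m → ℝ) → ℝ} (hg : ContDiffOn ℝ ∞ g M) :
    ContDiffOn ℝ ∞ (pdPow σ g) M :=
  foldr_property (C := fun g => ContDiffOn ℝ ∞ g M) (fun i _ h => contDiffOn_pd hM i h) σ hg _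

theorem pdPow_add_single (σ : Fin m → ℕ) (j : Fin m) {g : (Fin m → ℝ) → ℝ}
    (hg : ContDiffOn ℝ ∞ g M) : EqOn (pdPow (σ + Pi.single j 1) g) (pd j (pdPow σ g)) M :=
  foldr_add_single (C := fun g => ContDiffOn ℝ ∞ g M) (fun i _ h => contDiffOn_pd hM i h)
    (fun i _ _ h => pd_congr hM i h) (fun i j _ hg => pd_comm hM j i hg) σ j hg _
    (List.nodup_finRange m) (List.mem_finRange j)

theorem contDiffAt_prolong {f : (Fin m → ℝ) → Fin n → ℝ} (hf : ContDiffOn ℝ ∞ f M)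
    {x : Fin m → ℝ} (hx : x ∈ M) (c : Coord m n) : ContDiffAt ℝ ∞ (fun y => prolong f y c) x := by
  rcases c with i | ⟨j, σ⟩
  · exact contDiffAt_pi.1 contDiffAt_id i
  · exact (contDiffOn_pdPow hM σ (contDiffOn_pi.1 hf j) x hx).contDiffAt (hM.mem_nhds hx)

/-- Prolongations are integral manifolds of the total derivatives. -/
theorem fderiv_prolong {f : (Fin m → ℝ) → Fin n → ℝ} (hf : ContDiffOn ℝ ∞ f M)
    {x : Fin m → ℝ} (hx : x ∈ M) (v : Fin m → ℝ) (c : Coord m n) :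
    fderiv ℝ (fun y => prolong f y c) x v = ∑ l, v l * totalD l c (prolong f x) := by
  have hv : v = ∑ l, v l • Pi.single (M := fun _ => ℝ) l 1 := by
    funext i
    simp [Finset.sum_apply, Pi.single_apply]
  rcases c with i | ⟨j, σ⟩
  · have : HasFDerivAt (fun y : Fin m → ℝ => prolong f y (Sum.inl i))
        (ContinuousLinearMap.proj (R := ℝ) (φ := fun _ => ℝ) i) x := hasFDerivAt_apply i x
    rw [this.fderiv]
    simp [totalD]
  · conv_lhs => rw [hv, map_sum]
    refine Finset.sum_congr rfl fun l _ => ?_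
    rw [map_smul, smul_eq_mul]
    congr 1
    exact (pdPow_add_single hM σ l (contDiffOn_pi.1 hf j) hx).symm

end Prolong

theorem isOpen_jetSpace {M : Set (Fin m → ℝ)} {N : Set (Fin n → ℝ)} (hM : IsOpen M)
    (hN : IsOpen N) : IsOpen (jetSpace M N) :=
  (hM.preimage (continuous_pi fun i => continuous_apply (Sum.inl i : Coord m n))).inter
    (hN.preimage (continuous_pi fun j => continuous_apply (Sum.inr (j, 0) : Coord m n)))

theorem upt_prolong (f : (Fin m → ℝ) → Fin n → ℝ) (x : Fin m → ℝ) : upt (prolong f x) = f x := by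
  funext j
  have : ∀ L : List (Fin m), L.foldr (fun i H => (pd i)^[(0 : Fin m → ℕ) i] H)
      (fun y => f y j) = fun y => f y j := by
    intro L
    induction L <;> simp
  exact congrFun (this _) x

theorem prolong_mem {M : Set (Fin m → ℝ)} {N : Set (Fin n → ℝ)} {f : (Fin m → ℝ) → Fin n → ℝ}
    (hfN : MapsTo f M N) {x : Fin m → ℝ} (hx : x ∈ M) : prolong f x ∈ jetSpace M N :=
  ⟨hx, by rw [upt_prolong]; exact hfN hx⟩

/-! ### Generators of the filtration -/

section Filtration

variable {Ω : Set (Jet m n)}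

/-- On `Ω`, the function `F` is a smooth function of the functions `g s`. -/
def FactorsOn (Ω : Set (Jet m n)) {ι : Type} [Fintype ι] (g : ι → Jet m n → ℝ)
    (F : Jet m n → ℝ) : Prop :=
  ∃ (W : Set (ι → ℝ)) (ψ : (ι → ℝ) → ℝ), IsOpen W ∧ (∀ p ∈ Ω, (fun s => g s p) ∈ W) ∧
    ContDiffOn ℝ ∞ ψ W ∧ ∀ p ∈ Ω, F p = ψ (fun s => g s p)

variable {ι : Type} [Fintype ι] {g : ι → Jet m n → ℝ}

theorem factorsOn_self (s : ι) : FactorsOn Ω g (g s) :=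
  ⟨univ, fun v => v s, isOpen_univ, fun _ _ => mem_univ _, (contDiff_apply ℝ ℝ s).contDiffOn,
    fun _ _ => rfl⟩

theorem FactorsOn.trans {κ : Type} [Fintype κ] {g' : κ → Jet m n → ℝ} {F : Jet m n → ℝ}
    (hF : FactorsOn Ω g F) (hg : ∀ s, FactorsOn Ω g' (g s)) : FactorsOn Ω g' F := by
  obtain ⟨W, ψ, hW, hgW, hψ, hFψ⟩ := hF
  choose W' ψ' hW' hgW' hψ' hgψ' using hg
  have hcont : ContDiffOn ℝ ∞ (fun v s => ψ' s v) (⋂ s, W' s) :=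
    contDiffOn_pi.2 fun s => (hψ' s).mono (iInter_subset _ s)
  refine ⟨(⋂ s, W' s) ∩ (fun v s => ψ' s v) ⁻¹' W, fun v => ψ (fun s => ψ' s v), ?_, ?_, ?_, ?_⟩
  · exact hcont.continuousOn.isOpen_inter_preimage (isOpen_iInter_of_finite hW') hW
  · intro p hp
    refine ⟨mem_iInter.2 fun s => hgW' s p hp, ?_⟩
    have : (fun s => ψ' s (fun s => g' s p)) = fun s => g s p :=
      funext fun s => (hgψ' s p hp).symm
    simpa [this] using hgW p hp
  · exact hψ.comp (hcont.mono inter_subset_left) fun v hv => hv.2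
  · intro p hp
    rw [hFψ p hp]
    exact congrArg ψ (funext fun s => hgψ' s p hp)

theorem FactorsOn.of_mem_smoothSpan {A : Set (Jet m n → ℝ)} (hA : ∀ F ∈ A, FactorsOn Ω g F)
    {F : Jet m n → ℝ} (hF : F ∈ smoothSpan Ω A) : FactorsOn Ω g F := by
  obtain ⟨r, g₁, W, ψ, hg₁, hW, hgW, hψ, hFψ⟩ := hF
  exact FactorsOn.trans (g := g₁) ⟨W, ψ, hW, hgW, hψ, hFψ⟩ fun s => hA _ (hg₁ s)

theorem subset_smoothSpan (A : Set (Jet m n → ℝ)) : A ⊆ smoothSpan Ω A := fun F hF =>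
  ⟨1, fun _ => F, univ, fun v => v 0, fun _ => hF, isOpen_univ, fun _ _ => mem_univ _,
    (contDiff_apply ℝ ℝ 0).contDiffOn, fun _ _ => rfl⟩

theorem filtration_mono (A : Set (Jet m n → ℝ)) : Monotone (filtration Ω A) :=
  monotone_nat_of_le_succ fun _ => subset_union_left.trans (subset_smoothSpan _)

/-- Every step of the filtration has finitely many generators. -/
theorem exists_filtration_generators (hΩ : IsOpen Ω) {A : Set (Jet m n → ℝ)} (hA : A.Finite)
    (hAs : ∀ g ∈ A, IsSmoothOn Ω g) (k : ℕ) :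
    ∃ (ι : Type) (_ : Fintype ι) (g : ι → Jet m n → ℝ),
      (∀ s, IsSmoothOn Ω (g s) ∧ g s ∈ filtration Ω A k) ∧
      ∀ F ∈ filtration Ω A k, FactorsOn Ω g F := by
  induction k with
  | zero =>
    obtain ⟨r, g, hg⟩ : ∃ (r : ℕ) (g : Fin r → Jet m n → ℝ), range g = A := by
      obtain ⟨r, g, -, hg⟩ := hA.fin_param
      exact ⟨r, g, hg⟩
    refine ⟨Fin r, inferInstance, g, fun s => ?_, fun F hF => ?_⟩
    · have h1 : g s ∈ A := hg ▸ mem_range_self s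
      exact ⟨hAs _ h1, subset_smoothSpan _ h1⟩
    · refine FactorsOn.of_mem_smoothSpan (fun F hF => ?_) hF
      rw [← hg] at hF
      obtain ⟨s, rfl⟩ := hF
      exact factorsOn_self s
  | succ k ih =>
    obtain ⟨ι, _, g, hg, hgen⟩ := ih
    refine ⟨ι ⊕ (Fin m × ι), inferInstance,
      Sum.elim g (fun z => act (totalD z.1) (g z.2)), ?_, fun F hF => ?_⟩
    · rintro (s | ⟨i, s⟩)
      · exact ⟨(hg s).1, subset_smoothSpan _ (Or.inl (hg s).2)⟩
      · exact ⟨(hg s).1.act_totalD hΩ i, subset_smoothSpan _ (Or.inr ⟨i, g s, (hg s).2, rfl⟩)⟩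
    · refine FactorsOn.of_mem_smoothSpan ?_ hF
      rintro F (hF | ⟨i, H, hH, rfl⟩)
      · exact (hgen F hF).trans fun s => factorsOn_self (Sum.inl s)
      · obtain ⟨W, ψ, hW, hgW, hψ, hHψ⟩ := hgen H hH
        refine ⟨(fun v s => v (Sum.inl s)) ⁻¹' W,
          fun v => fderiv ℝ ψ (fun s => v (Sum.inl s)) (fun s => v (Sum.inr (i, s))),
          ?_, ?_, ?_, ?_⟩
        · exact hW.preimage (continuous_pi fun s => continuous_apply _)
        · intro p hp
          exact hgW p hp
        · have h1 : ContDiff ℝ ∞ (fun (v : ι ⊕ (Fin m × ι) → ℝ) (s : ι) => v (Sum.inl s)) :=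
            contDiff_pi.2 fun s => contDiff_apply ℝ ℝ _
          have h2 : ContDiff ℝ ∞ (fun (v : ι ⊕ (Fin m × ι) → ℝ) (s : ι) => v (Sum.inr (i, s))) :=
            contDiff_pi.2 fun s => contDiff_apply ℝ ℝ _
          exact ((hψ.fderiv_of_isOpen (m := ∞) hW (by simp)).comp h1.contDiffOn
            fun v hv => hv).clm_apply h2.contDiffOn
        · intro p hp
          rw [act_congr hΩ hp hHψ]
          exact dirDeriv_comp hΩ hp (fun s => (hg s).1) hW hψ hgW _

/-- Finitely many smooth functions, and their derivatives along the fields `V i`, depend on finitely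
many functions `g s` for which the equations `V i (g s)` close up. -/
theorem HasCommonFiltration.exists_generators (hΩ : IsOpen Ω) {V : Fin h → VField m n}
    (hV : HasCommonFiltration Ω V) {κ : Type*} [Finite κ] {F : κ → Jet m n → ℝ}
    (hF : ∀ k, IsSmoothOn Ω (F k)) :
    ∃ (ι : Type) (_ : Fintype ι) (g : ι → Jet m n → ℝ), (∀ s, IsSmoothOn Ω (g s)) ∧
      (∀ i s, FactorsOn Ω g (act (V i) (g s))) ∧ (∀ k, FactorsOn Ω g (F k)) ∧
      ∀ i k, FactorsOn Ω g (act (V i) (F k)) := by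
  obtain ⟨A, hA, hAs, hex, hinv⟩ := hV
  choose d hd using fun k => hex _ (hF k)
  obtain ⟨D, hD⟩ := (finite_range d).bddAbove
  have hFD : ∀ k, F k ∈ filtration Ω A D := fun k =>
    filtration_mono A (hD (mem_range_self k)) (hd k)
  obtain ⟨ι, _, g, hg, hgen⟩ := exists_filtration_generators hΩ hA hAs D
  exact ⟨ι, _, g, fun s => (hg s).1, fun i s => hgen _ (hinv i D _ (hg s).2),
    fun k => hgen _ (hFD k), fun i k => hgen _ (hinv i D _ (hFD k))⟩

end Filtration

/-! ### Uniqueness of integral curves -/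

/-- Grönwall's inequality for homogeneous linear differential inequalities. -/
theorem eq_zero_of_deriv_isBigO {E : Type*} [NormedAddCommGroup E] [NormedSpace ℝ E]
    {y y' : ℝ → E} (hy : ∀ s ∈ Icc (0 : ℝ) 1, HasDerivAt y (y' s) s) (h0 : y 0 = 0)
    (hO : y' =O[𝓟 (Icc (0 : ℝ) 1)] y) : ∀ s ∈ Icc (0 : ℝ) 1, y s = 0 := by
  obtain ⟨K, hK⟩ := isBigO_principal.1 hO
  exact eq_zero_of_abs_deriv_le_mul_abs_self_of_eq_zero_right (K := K)
    (fun s hs => (hy s hs).continuousAt.continuousWithinAt)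
    (fun s hs => (hy s (Ico_subset_Icc_self hs)).hasDerivWithinAt) h0
    fun s hs => hK s (Ico_subset_Icc_self hs)

theorem ContDiffOn.exists_lipschitzOnWith_of_isCompact {E F : Type*} [NormedAddCommGroup E]
    [NormedSpace ℝ E] [NormedAddCommGroup F] [NormedSpace ℝ F] {ψ : E → F} {W K : Set E}
    (hψ : ContDiffOn ℝ ∞ ψ W) (hW : IsOpen W) (hK : IsCompact K) (hKW : K ⊆ W) :
    ∃ C, LipschitzOnWith C ψ K := by
  refine LocallyLipschitzOn.exists_lipschitzOnWith_of_compact hK fun x hx => ?_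
  obtain ⟨C, t, ht, hC⟩ := (((hψ x (hKW hx)).contDiffAt (hW.mem_nhds (hKW hx))).of_le
    (by simp : (1 : WithTop ℕ∞) ≤ ∞)).exists_lipschitzOnWith
  exact ⟨C, t, mem_nhdsWithin_of_mem_nhds ht, hC⟩

section Curves

variable {Ω : Set (Jet m n)} (hΩ : IsOpen Ω) {V : Fin h → VField m n}
  (hV : HasCommonFiltration Ω V)
include hΩ hV

/-- Integral curves are unique, since the fields induce smooth vector fields on the
finite-dimensional spaces of values of the generators. -/
theorem integralCurve_unique (i : Fin h) (t : ℝ) {q₁ q₂ : ℝ → Jet m n}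
    (hq₁ : ∀ s ∈ Icc (0 : ℝ) 1, q₁ s ∈ Ω) (hq₂ : ∀ s ∈ Icc (0 : ℝ) 1, q₂ s ∈ Ω)
    (hd₁ : ∀ s ∈ Icc (0 : ℝ) 1, ∀ c, HasDerivAt (fun s => q₁ s c) (t * V i c (q₁ s)) s)
    (hd₂ : ∀ s ∈ Icc (0 : ℝ) 1, ∀ c, HasDerivAt (fun s => q₂ s c) (t * V i c (q₂ s)) s)
    (h0 : q₁ 0 = q₂ 0) : q₁ 1 = q₂ 1 := by
  funext c
  obtain ⟨ι, _, g, hg, hVg, hc, -⟩ := hV.exists_generators hΩ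
    (F := fun _ : Unit => fun p : Jet m n => p c) (fun _ => isSmoothOn_coord c)
  choose W ψ hW hgW hψ hVψ using hVg i
  obtain ⟨_, χ, -, -, -, hχ⟩ := hc ()
  have hcont : ContDiffOn ℝ ∞ (fun v s => ψ s v) (⋂ s, W s) :=
    contDiffOn_pi.2 fun s => (hψ s).mono (iInter_subset _ s)
  have hd : ∀ q : ℝ → Jet m n, (∀ s ∈ Icc (0 : ℝ) 1, q s ∈ Ω) →
      (∀ s ∈ Icc (0 : ℝ) 1, ∀ c, HasDerivAt (fun s => q s c) (t * V i c (q s)) s) →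
      ∀ s ∈ Icc (0 : ℝ) 1, HasDerivAt (fun s j => g j (q s))
        (t • fun j => ψ j (fun j => g j (q s))) s := by
    intro q hq hd s hs
    refine hasDerivAt_pi.2 fun j => ?_
    have h1 := (hg j).hasDerivAt_comp hΩ (hd s hs) (hq s hs)
    rw [dirDeriv_smul_right hΩ (hq s hs) (hg j)] at h1
    rw [Pi.smul_apply, smul_eq_mul, ← hVψ j _ (hq s hs)]
    exact h1
  have hy₁ := hd q₁ hq₁ hd₁
  have hy₂ := hd q₂ hq₂ hd₂
  have hK : ∀ q : ℝ → Jet m n, (∀ s ∈ Icc (0 : ℝ) 1, q s ∈ Ω) →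
      (∀ s ∈ Icc (0 : ℝ) 1, HasDerivAt (fun s j => g j (q s))
        (t • fun j => ψ j (fun j => g j (q s))) s) →
      IsCompact ((fun s j => g j (q s)) '' Icc (0 : ℝ) 1) ∧
        (fun s j => g j (q s)) '' Icc (0 : ℝ) 1 ⊆ ⋂ j, W j := by
    intro q hq hy
    refine ⟨isCompact_Icc.image_of_continuousOn fun s hs =>
      (hy s hs).continuousAt.continuousWithinAt, ?_⟩
    rintro _ ⟨s, hs, rfl⟩
    exact mem_iInter.2 fun j => hgW j _ (hq s hs)
  obtain ⟨C, hC⟩ := ContDiffOn.exists_lipschitzOnWith_of_isCompact hcont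
    (isOpen_iInter_of_finite hW) ((hK q₁ hq₁ hy₁).1.union (hK q₂ hq₂ hy₂).1)
    (union_subset (hK q₁ hq₁ hy₁).2 (hK q₂ hq₂ hy₂).2)
  have hzero := eq_zero_of_deriv_isBigO (fun s hs => (hy₁ s hs).sub (hy₂ s hs))
    (by simp [h0]) (by
      refine isBigO_principal.2 ⟨‖t‖ * C, fun s hs => ?_⟩
      rw [← smul_sub, norm_smul, mul_assoc]
      gcongr
      have := hC.dist_le_mul _ (Or.inl (mem_image_of_mem _ hs)) _ (Or.inr (mem_image_of_mem _ hs))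
      rw [dist_eq_norm, dist_eq_norm] at this
      exact this) 1 (by simp)
  exact (hχ _ (hq₁ 1 (by simp))).trans
    ((congrArg χ (sub_eq_zero.1 hzero)).trans (hχ _ (hq₂ 1 (by simp))).symm)

omit hV in
/-- Along an integral curve, a variation differentiates functions compatibly with the action of the
field. -/
theorem hasDerivAt_dirDeriv {X : VField m n} (hX : ∀ c, IsSmoothOn Ω (X c)) {t s : ℝ}
    {q ξ : ℝ → Jet m n} (hq : q s ∈ Ω)
    (hdq : ∀ c, HasDerivAt (fun s => q s c) (t * X c (q s)) s)
    (hdξ : ∀ c, HasDerivAt (fun s => ξ s c) (t * dirDeriv (X c) (q s) (ξ s)) s)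
    {F : Jet m n → ℝ} (hF : IsSmoothOn Ω F) :
    HasDerivAt (fun s => dirDeriv F (q s) (ξ s)) (t * dirDeriv (act X F) (q s) (ξ s)) s := by
  obtain ⟨S, hS⟩ := hF.exists_finset hΩ
  have hqc : ContinuousAt q s := continuousAt_pi.2 fun c => (hdq c).continuousAt
  have h1 : (fun s => dirDeriv F (q s) (ξ s)) =ᶠ[𝓝 s]
      fun s => ∑ c ∈ S, ξ s c * coordDeriv c F (q s) := by
    filter_upwards [hqc.preimage_mem_nhds (hΩ.mem_nhds hq)] with r hr using hS _ hr _
  have h2 : HasDerivAt (fun s => ∑ c ∈ S, ξ s c * coordDeriv c F (q s))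
      (∑ c ∈ S, (t * dirDeriv (X c) (q s) (ξ s) * coordDeriv c F (q s) +
        ξ s c * (t * act X (coordDeriv c F) (q s)))) s := by
    refine HasDerivAt.fun_sum fun c _ => (hdξ c).mul ?_
    have h3 := (hF.coordDeriv hΩ c).hasDerivAt_comp hΩ hdq hq
    rwa [dirDeriv_smul_right hΩ hq (hF.coordDeriv hΩ c)] at h3
  refine (h2.congr_of_eventuallyEq h1).congr_deriv ?_
  rw [dirDeriv_act hΩ hq hX hF hS, hS _ hq, Finset.sum_add_distrib, mul_add, Finset.mul_sum,
    Finset.mul_sum]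
  congr 1 <;> exact Finset.sum_congr rfl fun c _ => by ring

end Curves

/-! ### Transport of the distribution along the flows -/

/-- The tangent vector `ξ` at `p` is a linear combination of those fields of the frame
`D_1, …, D_m, V_{G_1}, …, V_{G_h}` whose index belongs to `R`. -/
def InSpan (G : Fin h → Fin n → Jet m n → ℝ) (R : Set (Fin m ⊕ Fin h)) (p ξ : Jet m n) : Prop :=
  ∃ α : Fin m ⊕ Fin h → ℝ, (∀ k ∉ R, α k = 0) ∧ ∀ c, ξ c = ∑ k, α k * frame G k c p

section Transport

variable {Ω : Set (Jet m n)} (hΩ : IsOpen Ω) {G : Fin h → Fin n → Jet m n → ℝ}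
  (hG : ∀ i j, IsSmoothOn Ω (G i j)) {lam : Fin h → Fin h → Fin h → ℝ}
  (hlam : ∀ i j s, ∀ p ∈ Ω, bracket (G i) (G j) s p = ∑ k, lam i j k * G k s p)
  {η : Fin h → Fin m → Jet m n → ℝ} (hη : ∀ i l, IsSmoothOn Ω (η i l))
  (hfilt : HasCommonFiltration Ω (fun i => charField (G i) (η i)))
include hΩ hG hlam hη hfilt

/-- Let `ξ` be a variation of an integral curve `q` of the characteristic field of `G_j`. If the
fields with index in `R` are stable under commutation with this field, up to linear combinations,
then `ξ` stays in their span. Here `crd` are coordinates in which the frame has an inverse matrix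
`N`. They determine the coefficients of the part of `ξ` in the span, and the remainder `ζ` satisfies
a homogeneous linear differential equation, which closes up on the generators of the filtration. -/
theorem inSpan_transport {Ω₀ : Set (Jet m n)} (hΩ₀ : IsOpen Ω₀) (hΩ₀Ω : Ω₀ ⊆ Ω)
    (crd : Fin m ⊕ Fin h → Coord m n) {N : Fin m ⊕ Fin h → Fin m ⊕ Fin h → Jet m n → ℝ}
    (hN : ∀ l r, IsSmoothOn Ω₀ (N l r))
    (hNW : ∀ p ∈ Ω₀, ∀ l k, ∑ r, N l r p * frame G k (crd r) p = if k = l then 1 else 0)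
    {R : Set (Fin m ⊕ Fin h)} (j : Fin h)
    (hR : ∀ k ∈ R, ∀ l ∉ R, ∀ p ∈ Ω, bracketCoeff G lam η j k l p = 0)
    {t : ℝ} {q ξ : ℝ → Jet m n} {O : Set ℝ} (hO : IsOpen O) (hIcc : Icc (0 : ℝ) 1 ⊆ O)
    (hq : ∀ s ∈ O, q s ∈ Ω₀)
    (hdq : ∀ s ∈ O, ∀ c, HasDerivAt (fun s => q s c)
      (t * charField (G j) (η j) c (q s)) s)
    (hdξ : ∀ s ∈ O, ∀ c, HasDerivAt (fun s => ξ s c)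
      (t * dirDeriv (charField (G j) (η j) c) (q s) (ξ s)) s)
    (h0 : InSpan G R (q 0) (ξ 0)) {s : ℝ} (hs : s ∈ Icc (0 : ℝ) 1) :
    InSpan G R (q s) (ξ s) := by
  classical
  set X : VField m n := charField (G j) (η j) with hXdef
  have hX : ∀ c, IsSmoothOn Ω (X c) := isSmoothOn_charField hΩ (hG j) (hη j)
  have hW := isSmoothOn_frame hΩ hG
  have hqΩ : ∀ s ∈ O, q s ∈ Ω := fun s hs => hΩ₀Ω (hq s hs)
  let B := bracketCoeff G lam η j
  -- derivative of a function along the curve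
  have hdF : ∀ {U : Set (Jet m n)}, IsOpen U → ∀ {F}, IsSmoothOn U F → ∀ s ∈ O, q s ∈ U →
      HasDerivAt (fun s => F (q s)) (t * act X F (q s)) s := by
    intro U hU F hF s hs hqs
    have := hF.hasDerivAt_comp hU (hdq s hs) hqs
    rwa [dirDeriv_smul_right hU hqs hF] at this
  let α : ℝ → Fin m ⊕ Fin h → ℝ := fun s l =>
    if l ∈ R then ∑ r, N l r (q s) * ξ s (crd r) else 0
  let α' : ℝ → Fin m ⊕ Fin h → ℝ := fun s l =>
    if l ∈ R then ∑ r, (t * act X (N l r) (q s) * ξ s (crd r) +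
      N l r (q s) * (t * dirDeriv (X (crd r)) (q s) (ξ s))) else 0
  have hα : ∀ s ∈ O, ∀ l, HasDerivAt (fun s => α s l) (α' s l) s := by
    intro s hs l
    by_cases hl : l ∈ R
    · simp only [α, α', hl, if_true]
      exact HasDerivAt.fun_sum fun r _ => (hdF hΩ₀ (hN l r) s hs (hq s hs)).mul (hdξ s hs (crd r))
    · simp only [α, α', hl, if_false]
      exact hasDerivAt_const _ _
  -- the action of the remainder `ζ` on functions
  let Z : ℝ → (Jet m n → ℝ) → ℝ := fun s F =>
    dirDeriv F (q s) (ξ s) - ∑ k, α s k * act (frame G k) F (q s)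
  let β : ℝ → Fin m ⊕ Fin h → ℝ := fun s l => α' s l + t * ∑ k, α s k * B k l (q s)
  have hZ : ∀ s ∈ O, ∀ F, IsSmoothOn Ω F → HasDerivAt (fun s => Z s F)
      (t * Z s (act X F) - ∑ l, β s l * act (frame G l) F (q s)) s := by
    intro s hs F hF
    have e1 := hasDerivAt_dirDeriv hΩ hX (hqΩ s hs) (hdq s hs) (hdξ s hs) hF
    have e2 : HasDerivAt (fun s => ∑ k, α s k * act (frame G k) F (q s))
        (∑ k, (α' s k * act (frame G k) F (q s) +
          α s k * (t * act X (act (frame G k) F) (q s)))) s :=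
      HasDerivAt.fun_sum fun k _ => (hα s hs k).mul
        (hdF hΩ (hF.act hΩ (hW k)) s hs (hqΩ s hs))
    refine (e1.sub e2).congr_deriv ?_
    have e3 : ∀ k, act X (act (frame G k) F) (q s) = act (frame G k) (act X F) (q s) +
        ∑ l, B k l (q s) * act (frame G l) F (q s) := fun k => by
      rw [← act_charField_frame_sub hΩ hG hlam hη j k hF (hqΩ s hs)]
      ring
    have e4 : ∑ k, α s k * (t * ∑ l, B k l (q s) * act (frame G l) F (q s)) =
        ∑ l, (t * ∑ k, α s k * B k l (q s)) * act (frame G l) F (q s) := by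
      simp only [Finset.mul_sum, Finset.sum_mul]
      rw [Finset.sum_comm]
      exact Finset.sum_congr rfl fun _ _ => Finset.sum_congr rfl fun _ _ => by ring
    have e5 : ∑ k, α s k * (t * act (frame G k) (act X F) (q s)) =
        t * ∑ k, α s k * act (frame G k) (act X F) (q s) := by
      rw [Finset.mul_sum]
      exact Finset.sum_congr rfl fun _ _ => by ring
    simp only [Z, β, e3, mul_add, add_mul, Finset.sum_add_distrib, e4, e5]
    ring
  have hZcoord : ∀ s ∈ O, ∀ c, Z s (fun p => p c) = ξ s c - ∑ k, α s k * frame G k c (q s) := by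
    intro s hs c
    simp only [Z, act_eq_dirDeriv, dirDeriv_coord hΩ (hqΩ s hs)]
  have hNZ : ∀ s ∈ O, ∀ l ∈ R, ∑ r, N l r (q s) * Z s (fun p => p (crd r)) = 0 := by
    intro s hs l hl
    simp only [hZcoord s hs, mul_sub, Finset.sum_sub_distrib, Finset.mul_sum]
    rw [Finset.sum_comm]
    have : ∀ k, ∑ r, N l r (q s) * (α s k * frame G k (crd r) (q s)) =
        α s k * if k = l then 1 else 0 := by
      intro k
      rw [← hNW _ (hq s hs), Finset.mul_sum]
      exact Finset.sum_congr rfl fun _ _ => by ring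
    simp only [this]
    simp [α, hl]
  -- differentiating this relation expresses `β` by `ζ`
  have hβ : ∀ s ∈ O, ∀ l ∈ R, β s l = ∑ r, (t * act X (N l r) (q s) * Z s (fun p => p (crd r)) +
      N l r (q s) * (t * Z s (act X (fun p => p (crd r))))) := by
    intro s hs l hl
    have e1 : HasDerivAt (fun s => ∑ r, N l r (q s) * Z s (fun p => p (crd r)))
        (∑ r, (t * act X (N l r) (q s) * Z s (fun p => p (crd r)) + N l r (q s) *
          (t * Z s (act X (fun p => p (crd r))) -
            ∑ k, β s k * act (frame G k) (fun p => p (crd r)) (q s)))) s :=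
      HasDerivAt.fun_sum fun r _ => (hdF hΩ₀ (hN l r) s hs (hq s hs)).mul
        (hZ s hs _ (isSmoothOn_coord _))
    have e2 : HasDerivAt (fun s => ∑ r, N l r (q s) * Z s (fun p => p (crd r))) 0 s := by
      refine (hasDerivAt_const s (0 : ℝ)).congr_of_eventuallyEq ?_
      filter_upwards [hO.mem_nhds hs] with r hr using hNZ r hr l hl
    have e3 := e1.unique e2
    have e4 : ∑ r, N l r (q s) * ∑ k, β s k * act (frame G k) (fun p => p (crd r)) (q s) =
        β s l := by
      simp only [Finset.mul_sum, act_eq_dirDeriv, dirDeriv_coord hΩ (hqΩ s hs)]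
      rw [Finset.sum_comm]
      have : ∀ k, ∑ r, N l r (q s) * (β s k * frame G k (crd r) (q s)) =
          β s k * if k = l then 1 else 0 := by
        intro k
        rw [← hNW _ (hq s hs), Finset.mul_sum]
        exact Finset.sum_congr rfl fun _ _ => by ring
      simp only [this]
      simp
    simp only [mul_sub, ← add_sub_assoc] at e3
    rw [Finset.sum_sub_distrib, e4] at e3
    exact (sub_eq_zero.1 e3).symm
  have hβ0 : ∀ s ∈ O, ∀ l ∉ R, β s l = 0 := by
    intro s hs l hl
    have : ∀ k, α s k * B k l (q s) = 0 := by
      intro k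
      by_cases hk : k ∈ R
      · simp [B, hR k hk l hl _ (hqΩ s hs)]
      · simp [α, hk]
    simp [β, α', hl, this]
  -- reduction to the generators of the filtration
  suffices H : ∀ c, Z s (fun p => p c) = 0 by
    refine ⟨α s, fun k hk => by simp [α, hk], fun c => ?_⟩
    have := H c
    rwa [hZcoord s (hIcc hs), sub_eq_zero] at this
  intro c
  obtain ⟨ι, _, g, hg, hXg, hcg, hXc⟩ := hfilt.exists_generators hΩ
    (F := fun k : Option (Fin m ⊕ Fin h) => fun p : Jet m n => p (k.elim c crd))
    (fun _ => isSmoothOn_coord _)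
  let y : ℝ → ι → ℝ := fun s i => Z s (g i)
  have hqc : ContinuousOn q O := fun s hs =>
    (continuousAt_pi.2 fun c => (hdq s hs c).continuousAt).continuousWithinAt
  have hbdd : ∀ {U : Set (Jet m n)}, IsOpen U → ∀ {F}, IsSmoothOn U F → (∀ s ∈ O, q s ∈ U) →
      (fun s => F (q s)) =O[𝓟 (Icc (0 : ℝ) 1)] (fun _ => (1 : ℝ)) := fun hU _ hF hqU =>
    (((hF.continuousOn hU).comp hqc hqU).mono hIcc).isBigO_principal isCompact_Icc
      (c := (1 : ℝ)) (by simp)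
  have hfac : ∀ F, FactorsOn Ω g F → (∀ s ∈ O, ∃ L : (ι → ℝ) →L[ℝ] ℝ, Z s F = L (y s)) ∧
      (fun s => Z s F) =O[𝓟 (Icc (0 : ℝ) 1)] y := by
    rintro F ⟨W, ψ, hWo, hgW, hψ, hFψ⟩
    have e0 : ∀ s ∈ O, Z s F = fderiv ℝ ψ (fun i => g i (q s)) (y s) := by
      intro s hs
      have e1 : ∀ χ, dirDeriv F (q s) χ =
          fderiv ℝ ψ (fun i => g i (q s)) (fun i => dirDeriv (g i) (q s) χ) := fun χ => by
        rw [dirDeriv_congr hΩ (hqΩ s hs) hFψ, dirDeriv_comp hΩ (hqΩ s hs) hg hWo hψ hgW]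
      have e2 : y s = (fun i => dirDeriv (g i) (q s) (ξ s)) -
          ∑ k, α s k • (fun i => dirDeriv (g i) (q s) (fun c => frame G k c (q s))) := by
        funext i
        simp [y, Z, act_eq_dirDeriv]
      simp only [e2, map_sub, map_sum, map_smul, smul_eq_mul, Z, act_eq_dirDeriv, e1]
    refine ⟨fun s hs => ⟨_, e0 s hs⟩, ?_⟩
    have e3 : ContinuousOn (fun s => fderiv ℝ ψ (fun i => g i (q s))) (Icc 0 1) := by
      have : ContinuousOn (fun s i => g i (q s)) O :=
        continuousOn_pi.2 fun i => ((hg i).continuousOn hΩ).comp hqc hqΩ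
      exact ((hψ.fderiv_of_isOpen (m := ∞) hWo (by simp)).continuousOn.comp this
        fun s hs => hgW _ (hqΩ s hs)).mono hIcc
    obtain ⟨C, hC⟩ := isCompact_Icc.exists_bound_of_continuousOn e3
    refine isBigO_principal.2 ⟨C, fun s hs => ?_⟩
    rw [e0 s (hIcc hs)]
    exact (ContinuousLinearMap.le_opNorm _ _).trans
      (mul_le_mul_of_nonneg_right (hC s hs) (norm_nonneg _))
  have hmul : ∀ {b d : ℝ → ℝ}, b =O[𝓟 (Icc (0 : ℝ) 1)] (fun _ => (1 : ℝ)) →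
      d =O[𝓟 (Icc (0 : ℝ) 1)] y → (fun s => b s * d s) =O[𝓟 (Icc (0 : ℝ) 1)] y := by
    intro b d hb hd
    have := hb.mul hd.norm_right
    simp only [one_mul] at this
    exact this.of_norm_right
  have hmulc : ∀ (r : ℝ) {d : ℝ → ℝ}, d =O[𝓟 (Icc (0 : ℝ) 1)] y →
      (fun s => r * d s) =O[𝓟 (Icc (0 : ℝ) 1)] y := fun r _ hd => hd.const_mul_left r
  have hβO : ∀ l, (fun s => β s l) =O[𝓟 (Icc (0 : ℝ) 1)] y := by
    intro l
    by_cases hl : l ∈ R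
    · have e1 : (fun s => ∑ r, (t * act X (N l r) (q s) * Z s (fun p => p (crd r)) +
          N l r (q s) * (t * Z s (act X (fun p => p (crd r)))))) =O[𝓟 (Icc (0 : ℝ) 1)] y := by
        refine IsBigO.fun_sum fun r _ => IsBigO.add (hmul ?_ (hfac _ (hcg (some r))).2)
          (hmul (hbdd hΩ₀ (hN l r) hq) (hmulc t (hfac _ (hXc j (some r))).2))
        exact (hbdd hΩ₀ ((hN l r).act hΩ₀ fun c => (hX c).mono hΩ₀Ω) hq).const_mul_left t
      refine e1.congr' ?_ EventuallyEq.rfl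
      exact eventually_principal.2 fun s hs => (hβ s (hIcc hs) l hl).symm
    · refine (isBigO_zero y _).congr' ?_ EventuallyEq.rfl
      exact eventually_principal.2 fun s hs => (hβ0 s (hIcc hs) l hl).symm
  have hy0 : y 0 = 0 := by
    obtain ⟨a, haR, ha⟩ := h0
    have h0O : (0 : ℝ) ∈ O := hIcc (by simp)
    have e1 : α 0 = a := by
      funext l
      by_cases hl : l ∈ R
      · simp only [α, hl, if_true, ha, Finset.mul_sum]
        rw [Finset.sum_comm]
        have : ∀ k, ∑ r, N l r (q 0) * (a k * frame G k (crd r) (q 0)) =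
            a k * if k = l then 1 else 0 := by
          intro k
          rw [← hNW _ (hq 0 h0O), Finset.mul_sum]
          exact Finset.sum_congr rfl fun _ _ => by ring
        simp only [this]
        simp
      · simp [α, hl, haR l hl]
    funext i
    have e2 : ξ 0 = fun c => ∑ k, a k * frame G k c (q 0) := funext ha
    simp only [y, Z, e1, Pi.zero_apply]
    rw [e2, dirDeriv_sum_right hΩ (hqΩ 0 h0O) (hg i)]
    exact sub_self _
  have hy := eq_zero_of_deriv_isBigO (y := y)
    (y' := fun s i => t * Z s (act X (g i)) - ∑ l, β s l * act (frame G l) (g i) (q s))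
    (fun s hs => hasDerivAt_pi.2 fun i => hZ s (hIcc hs) _ (hg i)) hy0 (by
      refine isBigO_pi.2 fun i => IsBigO.sub (hmulc t (hfac _ (hXg j i)).2)
        (IsBigO.fun_sum fun l _ => ?_)
      simp only [mul_comm (β _ l)]
      exact hmul (hbdd hΩ ((hg i).act hΩ (hW l)) hqΩ) (hβO l)) s hs
  obtain ⟨L, hL⟩ := (hfac _ (hcg none)).1 s (hIcc hs)
  rw [hy, map_zero] at hL
  exact hL

end Transport

/-! ### Flows of the characteristic fields -/

/-- The standing assumptions on the generators, their characteristic fields and the flows. -/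
structure IsFlowSystem (Ω : Set (Jet m n)) (G : Fin h → Fin n → Jet m n → ℝ)
    (lam : Fin h → Fin h → Fin h → ℝ) (η : Fin h → Fin m → Jet m n → ℝ)
    (E : Fin h → Set (ℝ × Jet m n)) (Φ : Fin h → ℝ → Jet m n → Jet m n) : Prop where
  isOpen : IsOpen Ω
  smooth_gen : ∀ i j, IsSmoothOn Ω (G i j)
  bracket_eq : ∀ i j s, ∀ p ∈ Ω, bracket (G i) (G j) s p = ∑ k, lam i j k * G k s p
  smooth_coeff : ∀ i l, IsSmoothOn Ω (η i l)
  flow : ∀ i, IsLocalFlow Ω (charField (G i) (η i)) (E i) (Φ i)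
  filt : HasCommonFiltration Ω (fun i => charField (G i) (η i))

/-- On the open set `Ω₀`, the components of the frame in the coordinates `crd` form a matrix with
the smooth left inverse `N`. -/
structure IsFrameChart (Ω : Set (Jet m n)) (G : Fin h → Fin n → Jet m n → ℝ)
    (Ω₀ : Set (Jet m n)) (crd : Fin m ⊕ Fin h → Coord m n)
    (N : Fin m ⊕ Fin h → Fin m ⊕ Fin h → Jet m n → ℝ) : Prop where
  isOpen : IsOpen Ω₀
  subset : Ω₀ ⊆ Ω
  smooth : ∀ l r, IsSmoothOn Ω₀ (N l r)
  inverse : ∀ p ∈ Ω₀, ∀ l k, ∑ r, N l r p * frame G k (crd r) p = if k = l then 1 else 0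

section LocalFlow

variable {Ω : Set (Jet m n)} {X : VField m n} {E : Set (ℝ × Jet m n)}
  {Φ : ℝ → Jet m n → Jet m n} (hΦ : IsLocalFlow Ω X E Φ)

theorem isOpen_param_image {E : Set (ℝ × Jet m n)} (hE : IsOpen E) (S : Finset (Coord m n)) :
    IsOpen ((fun z : ℝ × Jet m n => (z.1, res S z.2)) '' E) := by
  rw [isOpen_iff_mem_nhds]
  rintro _ ⟨⟨t, p⟩, hp, rfl⟩
  have hs : Continuous fun v : ℝ × (S → ℝ) => (v.1, setCoords S p v.2) :=
    continuous_fst.prodMk ((continuous_setCoords S p).comp continuous_snd)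
  filter_upwards [(hE.preimage hs).mem_nhds
    (by simpa only [mem_preimage, setCoords_res] using hp)] with v hv
  exact ⟨_, hv, Prod.ext rfl (res_setCoords S p v.2)⟩

include hΦ

theorem IsLocalFlow.exists_rep (c : Coord m n) :
    ∃ (S : Finset (Coord m n)) (g : ℝ × (S → ℝ) → ℝ),
      (∀ t p, (t, p) ∈ E → ContDiffAt ℝ ∞ g (t, res S p)) ∧
      ∀ t p, (t, p) ∈ E → Φ t p c = g (t, res S p) := by
  obtain ⟨S, g, hg, hΦg⟩ := hΦ.smooth c
  refine ⟨S, g, fun t p hp => ?_, fun t p hp => hΦg (t, p) hp⟩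
  exact (hg _ ⟨(t, p), hp, rfl⟩).contDiffAt
    ((isOpen_param_image hΦ.isOpen S).mem_nhds ⟨(t, p), hp, rfl⟩)

theorem IsLocalFlow.continuousAt {t : ℝ} {p : Jet m n} (hp : (t, p) ∈ E) :
    ContinuousAt (fun z : ℝ × Jet m n => Φ z.1 z.2) (t, p) := by
  refine continuousAt_pi.2 fun c => ?_
  obtain ⟨S, g, hg, hΦg⟩ := hΦ.exists_rep c
  have h1 : ContinuousAt (fun z : ℝ × Jet m n => g (z.1, res S z.2)) (t, p) :=
    ContinuousAt.comp (f := fun z : ℝ × Jet m n => (z.1, res S z.2)) (x := (t, p))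
      (hg t p hp).continuousAt
      (continuous_fst.prodMk ((continuous_res S).comp continuous_snd)).continuousAt
  refine h1.congr ?_
  filter_upwards [hΦ.isOpen.mem_nhds hp] with z hz using (hΦg z.1 z.2 hz).symm

theorem IsLocalFlow.contDiffAt {P : Type*} [NormedAddCommGroup P] [NormedSpace ℝ P] {τ : P → ℝ}
    {γ : P → Jet m n} {z : P} (hτ : ContDiffAt ℝ ∞ τ z)
    (hγ : ∀ c, ContDiffAt ℝ ∞ (fun w => γ w c) z) (hz : (τ z, γ z) ∈ E) (c : Coord m n) :
    ContDiffAt ℝ ∞ (fun w => Φ (τ w) (γ w) c) z := by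
  obtain ⟨S, g, hg, hΦg⟩ := hΦ.exists_rep c
  have h1 : ContDiffAt ℝ ∞ (fun w => (τ w, res S (γ w))) z :=
    hτ.prodMk (contDiffAt_pi.2 fun c => hγ c)
  have h2 : ContDiffAt ℝ ∞ (fun w => g (τ w, res S (γ w))) z := ContDiffAt.comp z (hg _ _ hz) h1
  refine h2.congr_of_eventuallyEq ?_
  have h3 : ContinuousAt (fun w => (τ w, γ w)) z :=
    hτ.continuousAt.prodMk (continuousAt_pi.2 fun c => (hγ c).continuousAt)
  filter_upwards [h3.preimage_mem_nhds (hΦ.isOpen.mem_nhds hz)] with w hw using hΦg _ _ hw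

/-- Near time zero, flow lines stay inside a given open set. -/
theorem IsLocalFlow.eventually_segment {Ω₀ : Set (Jet m n)} (hΩ₀ : IsOpen Ω₀) (hΩ₀Ω : Ω₀ ⊆ Ω)
    {p₀ : Jet m n} (hp₀ : p₀ ∈ Ω₀) :
    ∀ᶠ z : ℝ × Jet m n in 𝓝 (0, p₀), ∀ s ∈ Icc (0 : ℝ) 1,
      (s * z.1, z.2) ∈ E ∧ Φ (s * z.1) z.2 ∈ Ω₀ := by
  have h0 : ((0 : ℝ), p₀) ∈ E := hΦ.zero_mem _ (hΩ₀Ω hp₀)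
  have h1 : ∀ᶠ z : ℝ × Jet m n in 𝓝 (0, p₀), z ∈ E ∧ Φ z.1 z.2 ∈ Ω₀ := by
    refine (eventually_mem_set.2 (hΦ.isOpen.mem_nhds h0)).and ?_
    exact (hΦ.continuousAt h0).preimage_mem_nhds
      (hΩ₀.mem_nhds (by simpa [hΦ.zero _ (hΩ₀Ω hp₀)] using hp₀))
  rw [nhds_prod_eq, eventually_prod_iff] at h1
  obtain ⟨P, hP, Q, hQ, hPQ⟩ := h1
  obtain ⟨δ, hδ, hδP⟩ := Metric.eventually_nhds_iff.1 hP
  rw [nhds_prod_eq]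
  refine eventually_prod_iff.2 ⟨fun t => dist t 0 < δ, Metric.ball_mem_nhds _ hδ, Q, hQ, ?_⟩
  intro t ht p hp s hs
  refine hPQ (hδP ?_) hp
  rw [dist_zero_right] at ht ⊢
  rw [norm_mul]
  refine lt_of_le_of_lt (mul_le_of_le_one_left (norm_nonneg t) ?_) ht
  rw [Real.norm_of_nonneg hs.1]
  exact hs.2

end LocalFlow

/-- The flow lines that make up the composition `flowList` are defined and stay in `Ω₀`. -/
def flowListStays (Ω₀ : Set (Jet m n)) (E : Fin h → Set (ℝ × Jet m n))
    (Φ : Fin h → ℝ → Jet m n → Jet m n) (b : Fin h → ℝ) : List (Fin h) → Jet m n → Prop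
  | [], _ => True
  | k :: ks, p => (∀ s ∈ Icc (0 : ℝ) 1, (s * b k, p) ∈ E k ∧ Φ k (s * b k) p ∈ Ω₀) ∧
      flowListStays Ω₀ E Φ b ks (Φ k (b k) p)

section System

variable {Ω : Set (Jet m n)} {G : Fin h → Fin n → Jet m n → ℝ} {lam : Fin h → Fin h → Fin h → ℝ}
  {η : Fin h → Fin m → Jet m n → ℝ} {E : Fin h → Set (ℝ × Jet m n)}
  {Φ : Fin h → ℝ → Jet m n → Jet m n} {Ω₀ : Set (Jet m n)}

theorem flowListStays.defined {b : Fin h → ℝ} {L : List (Fin h)} {p : Jet m n}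
    (H : flowListStays Ω₀ E Φ b L p) : flowListDefined E Φ b L p := by
  induction L generalizing p with
  | nil => trivial
  | cons k ks ih => exact ⟨by simpa using (H.1 1 (by simp)).1, ih H.2⟩

theorem flowList_append (b : Fin h → ℝ) (L L' : List (Fin h)) (p : Jet m n) :
    flowList Φ b (L ++ L') p = flowList Φ b L' (flowList Φ b L p) := by
  induction L generalizing p with
  | nil => rfl
  | cons k ks ih => exact ih _

variable (H : IsFlowSystem Ω G lam η E Φ)
include H

theorem IsFlowSystem.flowList_of_zero {b : Fin h → ℝ} {L : List (Fin h)} {p : Jet m n}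
    (hp : p ∈ Ω) (hL : ∀ k ∈ L, b k = 0) : flowList Φ b L p = p := by
  induction L with
  | nil => rfl
  | cons k ks ih =>
    rw [flowList, hL k (by simp), (H.flow k).zero p hp]
    exact ih fun k hk => hL k (by simp [hk])

/-- The components of a composition of flows depend on finitely many coordinates. -/
theorem IsFlowSystem.exists_flowList_dependence (L : List (Fin h)) (c : Coord m n) :
    ∃ S : Finset (Coord m n), ∀ (b : Fin h → ℝ) (p p' : Jet m n), flowListDefined E Φ b L p →
      flowListDefined E Φ b L p' → (∀ c ∈ S, p c = p' c) →
      flowList Φ b L p c = flowList Φ b L p' c := by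
  classical
  induction L generalizing c with
  | nil => exact ⟨{c}, fun b p p' _ _ h => h c (by simp)⟩
  | cons k ks ih =>
    obtain ⟨S, hS⟩ := ih c
    choose T g hg hT using (H.flow k).exists_rep
    refine ⟨S.biUnion T, fun b p p' hp hp' h => ?_⟩
    refine hS b _ _ hp.2 hp'.2 fun c' hc' => ?_
    rw [hT c' _ _ hp.1, hT c' _ _ hp'.1]
    congr 2
    funext d
    exact h d (Finset.mem_biUnion.2 ⟨c', hc', d.2⟩)

theorem IsFlowSystem.contDiffAt_flowList {P : Type*} [NormedAddCommGroup P] [NormedSpace ℝ P]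
    {b : P → Fin h → ℝ} {γ : P → Jet m n} {z : P} (hb : ContDiffAt ℝ ∞ b z)
    (hγ : ∀ c, ContDiffAt ℝ ∞ (fun w => γ w c) z) {L : List (Fin h)}
    (hL : flowListDefined E Φ (b z) L (γ z)) (c : Coord m n) :
    ContDiffAt ℝ ∞ (fun w => flowList Φ (b w) L (γ w) c) z := by
  induction L generalizing γ with
  | nil => exact hγ c
  | cons k ks ih =>
    exact ih (γ := fun w => Φ k (b w k) (γ w))
      (fun c => (H.flow k).contDiffAt (contDiffAt_pi.1 hb k) hγ hL.1 c) hL.2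

theorem IsFlowSystem.tendsto_flow (k : Fin h) {p₀ : Jet m n} (hp₀ : p₀ ∈ Ω) :
    Tendsto (fun z : (Fin h → ℝ) × Jet m n => Φ k (z.1 k) z.2) (𝓝 (0, p₀)) (𝓝 p₀) := by
  have h1 := (H.flow k).continuousAt ((H.flow k).zero_mem p₀ hp₀)
  have h2 : Tendsto (fun z : (Fin h → ℝ) × Jet m n => (z.1 k, z.2)) (𝓝 (0, p₀))
      (𝓝 ((0 : ℝ), p₀)) :=
    (((continuous_apply k).comp continuous_fst).prodMk continuous_snd).tendsto
      ((0 : Fin h → ℝ), p₀)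
  have h3 := h1.tendsto.comp h2
  simpa [(H.flow k).zero p₀ hp₀] using! h3

theorem IsFlowSystem.tendsto_flowList (L : List (Fin h)) {p₀ : Jet m n} (hp₀ : p₀ ∈ Ω) :
    Tendsto (fun z : (Fin h → ℝ) × Jet m n => flowList Φ z.1 L z.2) (𝓝 (0, p₀)) (𝓝 p₀) := by
  induction L with
  | nil => exact continuous_snd.tendsto ((0 : Fin h → ℝ), p₀)
  | cons k ks ih =>
    have h1 : Tendsto (fun z : (Fin h → ℝ) × Jet m n => (z.1, Φ k (z.1 k) z.2)) (𝓝 (0, p₀))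
        (𝓝 (0, p₀)) :=
      (continuous_fst.tendsto ((0 : Fin h → ℝ), p₀)).prodMk_nhds (H.tendsto_flow k hp₀)
    exact ih.comp h1

theorem IsFlowSystem.eventually_stays (hΩ₀ : IsOpen Ω₀) (hΩ₀Ω : Ω₀ ⊆ Ω) (L : List (Fin h))
    {p₀ : Jet m n} (hp₀ : p₀ ∈ Ω₀) :
    ∀ᶠ z : (Fin h → ℝ) × Jet m n in 𝓝 (0, p₀), flowListStays Ω₀ E Φ z.1 L z.2 := by
  induction L with
  | nil => exact Eventually.of_forall fun _ => trivial
  | cons k ks ih =>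
    have h1 : Tendsto (fun z : (Fin h → ℝ) × Jet m n => (z.1, Φ k (z.1 k) z.2)) (𝓝 (0, p₀))
        (𝓝 (0, p₀)) :=
      (continuous_fst.tendsto ((0 : Fin h → ℝ), p₀)).prodMk_nhds (H.tendsto_flow k (hΩ₀Ω hp₀))
    have h2 : Tendsto (fun z : (Fin h → ℝ) × Jet m n => (z.1 k, z.2)) (𝓝 (0, p₀))
        (𝓝 ((0 : ℝ), p₀)) :=
      (((continuous_apply k).comp continuous_fst).prodMk continuous_snd).tendsto
        ((0 : Fin h → ℝ), p₀)
    exact (h2.eventually ((H.flow k).eventually_segment hΩ₀ hΩ₀Ω hp₀)).and (h1.eventually ih)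

/-- The local flows are inverted by reversing time. -/
theorem IsFlowSystem.eventually_flow_neg (k : Fin h) {p₀ : Jet m n} (hp₀ : p₀ ∈ Ω) :
    ∀ᶠ z : (Fin h → ℝ) × Jet m n in 𝓝 (0, p₀), Φ k (-z.1 k) (Φ k (z.1 k) z.2) = z.2 := by
  have hseg := (H.flow k).eventually_segment H.isOpen subset_rfl hp₀
  have h1 : Tendsto (fun z : (Fin h → ℝ) × Jet m n => (-z.1 k, Φ k (z.1 k) z.2)) (𝓝 (0, p₀))
      (𝓝 ((0 : ℝ), p₀)) := by
    refine Tendsto.prodMk_nhds ?_ (H.tendsto_flow k hp₀)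
    have : Continuous fun z : (Fin h → ℝ) × Jet m n => -z.1 k :=
      ((continuous_apply k).comp continuous_fst).neg
    simpa using! this.tendsto ((0 : Fin h → ℝ), p₀)
  have h2 : Tendsto (fun z : (Fin h → ℝ) × Jet m n => (z.1 k, z.2)) (𝓝 (0, p₀))
      (𝓝 ((0 : ℝ), p₀)) :=
    (((continuous_apply k).comp continuous_fst).prodMk continuous_snd).tendsto
      ((0 : Fin h → ℝ), p₀)
  have h3 : ∀ᶠ z : (Fin h → ℝ) × Jet m n in 𝓝 (0, p₀), z.2 ∈ Ω :=
    continuous_snd.continuousAt.preimage_mem_nhds (H.isOpen.mem_nhds hp₀)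
  filter_upwards [h1.eventually hseg, h2.eventually hseg, h3] with z hz1 hz2 hz3
  have hrev : ∀ s ∈ Icc (0 : ℝ) 1, 1 - s ∈ Icc (0 : ℝ) 1 := fun s hs =>
    ⟨by linarith [hs.2], by linarith [hs.1]⟩
  have hu := integralCurve_unique H.isOpen H.filt k (-z.1 k)
    (q₁ := fun s => Φ k (s * -z.1 k) (Φ k (z.1 k) z.2)) (q₂ := fun s => Φ k ((1 - s) * z.1 k) z.2)
    (fun s hs => (hz1 s hs).2) (fun s hs => (hz2 _ (hrev s hs)).2)
    (fun s hs c => by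
      have e1 : HasDerivAt (fun s : ℝ => s * -z.1 k) (-z.1 k) s := by
        simpa using (hasDerivAt_id s).mul_const (-z.1 k)
      have e2 := ((H.flow k).deriv _ _ (hz1 s hs).1 c).comp s e1
      exact e2.congr_deriv (mul_comm _ _))
    (fun s hs c => by
      have e1 : HasDerivAt (fun s : ℝ => (1 - s) * z.1 k) (-z.1 k) s := by
        simpa using! ((hasDerivAt_id s).const_sub 1).mul_const (z.1 k)
      have e2 := ((H.flow k).deriv _ _ (hz2 _ (hrev s hs)).1 c).comp s e1
      exact e2.congr_deriv (mul_comm _ _))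
    (by
      have : Φ k (z.1 k) z.2 ∈ Ω := by simpa using (hz2 1 (by simp)).2
      simp [(H.flow k).zero _ this])
  simpa [(H.flow k).zero _ hz3] using hu

theorem IsFlowSystem.eventually_flowList_neg (L : List (Fin h)) {p₀ : Jet m n} (hp₀ : p₀ ∈ Ω) :
    ∀ᶠ z : (Fin h → ℝ) × Jet m n in 𝓝 (0, p₀),
      flowList Φ (-z.1) L.reverse (flowList Φ z.1 L z.2) = z.2 := by
  induction L with
  | nil => exact Eventually.of_forall fun _ => rfl
  | cons k ks ih =>
    have h1 : Tendsto (fun z : (Fin h → ℝ) × Jet m n => (z.1, Φ k (z.1 k) z.2)) (𝓝 (0, p₀))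
        (𝓝 (0, p₀)) :=
      (continuous_fst.tendsto ((0 : Fin h → ℝ), p₀)).prodMk_nhds (H.tendsto_flow k hp₀)
    filter_upwards [h1.eventually ih, H.eventually_flow_neg k hp₀] with z hz1 hz2
    rw [List.reverse_cons, flowList_append, flowList, flowList, flowList, hz1]
    exact hz2

end System

/-! ### Derivatives of composed flows -/

section Derivative

variable {Ω : Set (Jet m n)} {G : Fin h → Fin n → Jet m n → ℝ} {lam : Fin h → Fin h → Fin h → ℝ}
  {η : Fin h → Fin m → Jet m n → ℝ} {E : Fin h → Set (ℝ × Jet m n)}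
  {Φ : Fin h → ℝ → Jet m n → Jet m n} {Ω₀ : Set (Jet m n)} {crd : Fin m ⊕ Fin h → Coord m n}
  {N : Fin m ⊕ Fin h → Fin m ⊕ Fin h → Jet m n → ℝ} {R : Set (Fin m ⊕ Fin h)}

theorem InSpan.add_smul {p ξ ξ' : Jet m n} (hξ : InSpan G R p ξ) (hξ' : InSpan G R p ξ') (r : ℝ) :
    InSpan G R p (fun c => r * ξ' c + ξ c) := by
  obtain ⟨α, hα, hξα⟩ := hξ
  obtain ⟨α', hα', hξα'⟩ := hξ'
  refine ⟨fun k => r * α' k + α k, fun k hk => by simp [hα k hk, hα' k hk], fun c => ?_⟩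
  simp only [hξα, hξα', add_mul, Finset.sum_add_distrib, Finset.mul_sum, mul_assoc]

theorem charField_inSpan (hR : ∀ l, Sum.inl l ∈ R) {j : Fin h} (hj : Sum.inr j ∈ R) (p : Jet m n) :
    InSpan G R p (fun c => charField (G j) (η j) c p) := by
  classical
  refine ⟨Sum.elim (fun l => -η j l p) (Pi.single j 1), ?_, fun c => ?_⟩
  · rintro (l | r) hk
    · exact absurd (hR l) hk
    · have : r ≠ j := fun h => hk (h ▸ hj)
      simp [this]
  · simp only [Fintype.sum_sum_type, Sum.elim_inl, Sum.elim_inr, Pi.single_apply, ite_mul, one_mul,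
      zero_mul, Finset.sum_ite_eq', Finset.mem_univ, if_true, frame, charField, neg_mul,
      Finset.sum_neg_distrib]
    ring

omit lam η E Φ in
/-- Let `A` be a family of integral curves of `X`, with time as its first parameter. The derivative
by the second parameter satisfies the linearized equation. -/
theorem hasDerivAt_variation (hΩ : IsOpen Ω) {X : VField m n} (hX : ∀ c, IsSmoothOn Ω (X c))
    {A : ℝ × ℝ → Jet m n} {t s : ℝ}
    (hA : ∀ c, ContDiffAt ℝ ∞ (fun x => A x c) (s * t, 0)) (hAΩ : A (s * t, 0) ∈ Ω)
    (hAX : ∀ c, ∀ᶠ x in 𝓝 (s * t, (0 : ℝ)), fderiv ℝ (fun x => A x c) x (1, 0) = X c (A x))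
    (c : Coord m n) :
    HasDerivAt (fun s => fderiv ℝ (fun x => A x c) (s * t, 0) (0, 1))
      (t * dirDeriv (X c) (A (s * t, 0)) (fun c => fderiv ℝ (fun x => A x c) (s * t, 0) (0, 1)))
      s := by
  have e1 : HasDerivAt (fun s : ℝ => s * t) t s := by
    simpa using (hasDerivAt_id s).mul_const t
  have e2 : DifferentiableAt ℝ (fderiv ℝ (fun x => A x c)) (s * t, 0) :=
    ((hA c).fderiv_right (m := ∞) (by simp)).differentiableAt (by simp)
  have e3 : HasDerivAt (fun s : ℝ => (s * t, (0 : ℝ))) (t, (0 : ℝ)) s :=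
    e1.prodMk (hasDerivAt_const _ _)
  have e4 : HasDerivAt (fun s => fderiv ℝ (fun x => A x c) (s * t, 0)) _ s :=
    e2.hasFDerivAt.comp_hasDerivAt s e3
  refine (e4.clm_apply (hasDerivAt_const s ((0 : ℝ), (1 : ℝ)))).congr_deriv ?_
  -- interchange the second derivatives
  have e5 : fderiv ℝ (fderiv ℝ (fun x => A x c)) (s * t, 0) (t, 0) (0, 1) =
      fderiv ℝ (fderiv ℝ (fun x => A x c)) (s * t, 0) (0, 1) (t, 0) :=
    (hA c).isSymmSndFDerivAt (by simpa using ENat.LEInfty.out) _ _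
  have e6 : ((t, 0) : ℝ × ℝ) = t • (1, 0) := by simp
  have e7 : fderiv ℝ (fderiv ℝ (fun x => A x c)) (s * t, 0) (0, 1) (1, 0) =
      fderiv ℝ (fun x => X c (A x)) (s * t, 0) (0, 1) := by
    have e8 : (fun x => fderiv ℝ (fun x => A x c) x (1, 0)) =ᶠ[𝓝 (s * t, (0 : ℝ))]
        fun x => X c (A x) := hAX c
    rw [← e8.fderiv_eq, fderiv_clm_apply e2 (differentiableAt_const _)]
    simp
  have e9 := (hX c).fderiv_comp hΩ hA hAΩ (0, 1)
  rw [map_zero, add_zero, e5, e6, map_smul, smul_eq_mul, e7, e9]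

section Family

variable {X : VField m n} {D : Set (ℝ × Jet m n)} {Ψ : ℝ → Jet m n → Jet m n}
  (hΨ : IsLocalFlow Ω X D Ψ) {P : Type*} [NormedAddCommGroup P] [NormedSpace ℝ P]
  {γ : P → Jet m n} {z : P} (hγ : ∀ c, ContDiffAt ℝ ∞ (fun w => γ w c) z) (v : P)
include hΨ hγ

omit hΨ in
theorem contDiffAt_line (r : ℝ) (c : Coord m n) :
    ContDiffAt ℝ ∞ (fun x : ℝ × ℝ => γ (z + x.2 • v) c) (r, 0) :=
  ContDiffAt.comp (g := fun w => γ w c) (r, (0 : ℝ)) (by simpa using hγ c)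
    (contDiffAt_const.add (contDiffAt_snd.smul contDiffAt_const))

theorem contDiffAt_flowFamily {r : ℝ} (hr : (r, γ z) ∈ D) (c : Coord m n) :
    ContDiffAt ℝ ∞ (fun x : ℝ × ℝ => Ψ x.1 (γ (z + x.2 • v)) c) (r, 0) :=
  hΨ.contDiffAt (τ := Prod.fst) (γ := fun x : ℝ × ℝ => γ (z + x.2 • v)) contDiffAt_fst
    (contDiffAt_line hγ v r) (by simpa using hr) c

theorem eventually_fderiv_flowFamily {r : ℝ} (hr : (r, γ z) ∈ D) (c : Coord m n) :
    ∀ᶠ x in 𝓝 (r, (0 : ℝ)), fderiv ℝ (fun x : ℝ × ℝ => Ψ x.1 (γ (z + x.2 • v)) c) x (1, 0) =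
      X c (Ψ x.1 (γ (z + x.2 • v))) := by
  have hcont : ContinuousAt (fun x : ℝ × ℝ => (x.1, γ (z + x.2 • v))) (r, 0) :=
    continuousAt_fst.prodMk (continuousAt_pi.2 fun c => (contDiffAt_line hγ v r c).continuousAt)
  have h1 : ∀ᶠ x : ℝ × ℝ in 𝓝 (r, 0), (x.1, γ (z + x.2 • v)) ∈ D :=
    hcont.preimage_mem_nhds (hΨ.isOpen.mem_nhds (by simpa using hr))
  have h2 := ((contDiffAt_flowFamily hΨ hγ v hr c).of_le
    (by simp : (1 : WithTop ℕ∞) ≤ ∞)).eventually (by simp)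
  filter_upwards [h1, h2] with x hx1 hx2
  have e1 : HasDerivAt (fun r => Ψ r (γ (z + x.2 • v)) c) (X c (Ψ x.1 (γ (z + x.2 • v)))) x.1 :=
    hΨ.deriv _ _ hx1 c
  have e2 : HasDerivAt (fun r : ℝ => (r, x.2)) ((1 : ℝ), (0 : ℝ)) x.1 :=
    (hasDerivAt_id x.1).prodMk (hasDerivAt_const _ _)
  have e3 := (hx2.differentiableAt one_ne_zero).hasFDerivAt.comp_hasDerivAt x.1 e2
  exact e3.unique e1

omit hΨ hγ in
theorem hasDerivAt_line : HasDerivAt (fun ε : ℝ => z + ε • v) v 0 := by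
  simpa using ((hasDerivAt_id (0 : ℝ)).smul_const v).const_add z

/-- At time zero, the velocity of a family of flow lines is that of the initial points. -/
theorem fderiv_flowFamily_zero (hΩ : IsOpen Ω) (hz : γ z ∈ Ω) (c : Coord m n) :
    fderiv ℝ (fun x : ℝ × ℝ => Ψ x.1 (γ (z + x.2 • v)) c) (0, 0) (0, 1) =
      fderiv ℝ (fun w => γ w c) z v := by
  have e2 : HasDerivAt (fun ε : ℝ => ((0 : ℝ), ε)) ((0 : ℝ), (1 : ℝ)) 0 :=
    (hasDerivAt_const _ _).prodMk (hasDerivAt_id _)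
  have e3 := ((contDiffAt_flowFamily hΨ hγ v (hΨ.zero_mem _ hz) c).differentiableAt
    (by simp)).hasFDerivAt.comp_hasDerivAt (0 : ℝ) e2
  have e4 : HasFDerivAt (fun w => γ w c) (fderiv ℝ (fun w => γ w c) z) (z + (0 : ℝ) • v) := by
    simpa using ((hγ c).differentiableAt (by simp)).hasFDerivAt
  have e5 := e4.comp_hasDerivAt (0 : ℝ) (hasDerivAt_line v)
  refine e3.unique (e5.congr_of_eventuallyEq ?_)
  have hcont : ContinuousAt (fun ε : ℝ => γ (z + ε • v)) 0 := continuousAt_pi.2 fun c =>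
    (ContDiffAt.comp (g := fun w => γ w c) (f := fun ε : ℝ => z + ε • v) (0 : ℝ)
      (by simpa using hγ c)
      (contDiffAt_const.add (contDiffAt_id.smul contDiffAt_const))).continuousAt
  filter_upwards [hcont.preimage_mem_nhds (hΩ.mem_nhds (by simpa using hz))] with ε hε
  simp only [Function.comp_apply]
  rw [hΨ.zero _ hε]

/-- The velocity of `Ψ_τ(γ)` consists of the velocity with the time frozen and a multiple of the
field. -/
theorem fderiv_flow {τ : P → ℝ} (hτ : ContDiffAt ℝ ∞ τ z) (hz : (τ z, γ z) ∈ D)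
    (c : Coord m n) : fderiv ℝ (fun w => Ψ (τ w) (γ w) c) z v =
      fderiv ℝ τ z v * X c (Ψ (τ z) (γ z)) +
        fderiv ℝ (fun x : ℝ × ℝ => Ψ x.1 (γ (z + x.2 • v)) c) (τ z, 0) (0, 1) := by
  have e1 : HasFDerivAt (fun w => Ψ (τ w) (γ w) c)
      (fderiv ℝ (fun w => Ψ (τ w) (γ w) c) z) (z + (0 : ℝ) • v) := by
    simpa using ((hΨ.contDiffAt hτ hγ hz c).differentiableAt (by simp)).hasFDerivAt
  have e2 := e1.comp_hasDerivAt (0 : ℝ) (hasDerivAt_line v)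
  have e3 : HasFDerivAt τ (fderiv ℝ τ z) (z + (0 : ℝ) • v) := by
    simpa using (hτ.differentiableAt (by simp)).hasFDerivAt
  have e4 : HasDerivAt (fun ε : ℝ => (τ (z + ε • v), ε)) (fderiv ℝ τ z v, (1 : ℝ)) 0 :=
    (e3.comp_hasDerivAt (0 : ℝ) (hasDerivAt_line v)).prodMk (hasDerivAt_id _)
  have e5 : HasFDerivAt (fun x : ℝ × ℝ => Ψ x.1 (γ (z + x.2 • v)) c)
      (fderiv ℝ (fun x : ℝ × ℝ => Ψ x.1 (γ (z + x.2 • v)) c) (τ z, 0))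
      (τ (z + (0 : ℝ) • v), 0) := by
    simpa using! ((contDiffAt_flowFamily hΨ hγ v hz c).differentiableAt (by simp)).hasFDerivAt
  have e6 := e5.comp_hasDerivAt_of_eq (0 : ℝ) e4 rfl
  have e7 : ((fderiv ℝ τ z v, 1) : ℝ × ℝ) = fderiv ℝ τ z v • (1, 0) + (0, 1) := by simp
  have e8 := e2.unique e6
  rw [e8, e7, map_add, map_smul, smul_eq_mul,
    (eventually_fderiv_flowFamily hΨ hγ v hz c).self_of_nhds]
  simp

end Family

variable (H : IsFlowSystem Ω G lam η E Φ) (HN : IsFrameChart Ω G Ω₀ crd N)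
include H HN

theorem inSpan_flow_frozen {P : Type*} [NormedAddCommGroup P] [NormedSpace ℝ P] {t : ℝ}
    {γ : P → Jet m n} {z : P} (hγ : ∀ c, ContDiffAt ℝ ∞ (fun w => γ w c) z) (j : Fin h)
    (hstay : ∀ s ∈ Icc (0 : ℝ) 1, (s * t, γ z) ∈ E j ∧ Φ j (s * t) (γ z) ∈ Ω₀) (v : P)
    (hv : InSpan G R (γ z) (fun c => fderiv ℝ (fun w => γ w c) z v))
    (hR : t = 0 ∨ ∀ k ∈ R, ∀ l ∉ R, ∀ p ∈ Ω, bracketCoeff G lam η j k l p = 0) :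
    InSpan G R (Φ j t (γ z)) (fun c =>
      fderiv ℝ (fun x : ℝ × ℝ => Φ j x.1 (γ (z + x.2 • v)) c) (t, 0) (0, 1)) := by
  have hΦ := H.flow j
  have hE1 : (t, γ z) ∈ E j := by simpa using (hstay 1 (by simp)).1
  have h0Ω : γ z ∈ Ω := hΦ.source _ _ hE1
  rcases hR with rfl | hR
  · simp only [fderiv_flowFamily_zero hΦ hγ v H.isOpen h0Ω]
    rwa [hΦ.zero _ h0Ω]
  let q : ℝ → Jet m n := fun s => Φ j (s * t) (γ z)
  let ξ : ℝ → Jet m n := fun s c =>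
    fderiv ℝ (fun x : ℝ × ℝ => Φ j x.1 (γ (z + x.2 • v)) c) (s * t, 0) (0, 1)
  have hOE : ∀ s, ContinuousAt (fun s => (s * t, γ z)) s :=
    fun s => ((continuous_id.mul continuous_const).prodMk continuous_const).continuousAt
  have hO : IsOpen {s | (s * t, γ z) ∈ E j ∧ q s ∈ Ω₀} := by
    rw [isOpen_iff_mem_nhds]
    rintro s ⟨hs1, hs2⟩
    have e1 := (hOE s).preimage_mem_nhds (hΦ.isOpen.mem_nhds hs1)
    have e2 : ContinuousAt q s :=
      ContinuousAt.comp (f := fun s => (s * t, γ z)) (hΦ.continuousAt hs1) (hOE s)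
    filter_upwards [e1, e2.preimage_mem_nhds (HN.isOpen.mem_nhds hs2)] with r hr1 hr2
    exact ⟨hr1, hr2⟩
  have e1 : ∀ s, HasDerivAt (fun s : ℝ => s * t) t s := fun s => by
    simpa using (hasDerivAt_id s).mul_const t
  have hdq : ∀ s ∈ {s | (s * t, γ z) ∈ E j ∧ q s ∈ Ω₀}, ∀ c, HasDerivAt (fun s => q s c)
      (t * charField (G j) (η j) c (q s)) s := by
    intro s hs c
    have e2 := (hΦ.deriv _ _ hs.1 c).comp s (e1 s)
    exact e2.congr_deriv (mul_comm _ _)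
  have hdξ : ∀ s ∈ {s | (s * t, γ z) ∈ E j ∧ q s ∈ Ω₀}, ∀ c, HasDerivAt (fun s => ξ s c)
      (t * dirDeriv (charField (G j) (η j) c) (q s) (ξ s)) s := by
    intro s hs c
    have e2 := hasDerivAt_variation H.isOpen
      (isSmoothOn_charField H.isOpen (H.smooth_gen j) (H.smooth_coeff j))
      (A := fun x : ℝ × ℝ => Φ j x.1 (γ (z + x.2 • v)))
      (contDiffAt_flowFamily hΦ hγ v hs.1) (by simpa using hΦ.target _ _ hs.1)
      (eventually_fderiv_flowFamily hΦ hγ v hs.1) c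
    have e3 : Φ j (s * t) (γ (z + (0 : ℝ) • v)) = q s := by simp [q]
    rw [e3] at e2
    exact e2
  have h0 : InSpan G R (q 0) (ξ 0) := by
    have e1 : ξ 0 = fun c => fderiv ℝ (fun w => γ w c) z v := by
      funext c
      simp only [ξ, zero_mul]
      exact fderiv_flowFamily_zero hΦ hγ v H.isOpen h0Ω c
    have e2 : q 0 = γ z := by simp [q, hΦ.zero _ h0Ω]
    rw [e1, e2]
    exact hv
  have := inSpan_transport H.isOpen H.smooth_gen H.bracket_eq H.smooth_coeff H.filt HN.isOpen
    HN.subset crd HN.smooth HN.inverse j hR hO (fun s hs => hstay s hs) (fun s hs => hs.2)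
    hdq hdξ h0 (s := 1) (by simp)
  simpa only [q, ξ, one_mul] using this

/-- A family of flow lines: if the velocity of `γ` in the direction `v` lies in the span of the
frame fields with index in `R`, then so does the velocity of `Φ_τ(γ)`. -/
theorem inSpan_flow (hRD : ∀ l, Sum.inl l ∈ R) {P : Type*} [NormedAddCommGroup P]
    [NormedSpace ℝ P] {τ : P → ℝ} {γ : P → Jet m n} {z : P} (hτ : ContDiffAt ℝ ∞ τ z)
    (hγ : ∀ c, ContDiffAt ℝ ∞ (fun w => γ w c) z) (j : Fin h)
    (hstay : ∀ s ∈ Icc (0 : ℝ) 1, (s * τ z, γ z) ∈ E j ∧ Φ j (s * τ z) (γ z) ∈ Ω₀) (v : P)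
    (hv : InSpan G R (γ z) (fun c => fderiv ℝ (fun w => γ w c) z v))
    (hR : τ z = 0 ∨ ∀ k ∈ R, ∀ l ∉ R, ∀ p ∈ Ω, bracketCoeff G lam η j k l p = 0)
    (hR' : fderiv ℝ τ z v = 0 ∨ Sum.inr j ∈ R) :
    InSpan G R (Φ j (τ z) (γ z)) (fun c => fderiv ℝ (fun w => Φ j (τ w) (γ w) c) z v) := by
  have hE1 : (τ z, γ z) ∈ E j := by simpa using (hstay 1 (by simp)).1
  have hfrozen := inSpan_flow_frozen H HN hγ j hstay v hv hR
  simp only [fderiv_flow (H.flow j) hγ v hτ hE1]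
  rcases hR' with h0 | hj
  · simpa only [h0, zero_mul, zero_add] using hfrozen
  · exact hfrozen.add_smul (charField_inSpan hRD hj _) _

/-- A family of compositions of flows moves in the span of the frame fields with index in `R`, if the
initial points do, every flow that is in use preserves this span, and every flow whose time varies
is generated by a field of the span. -/
theorem inSpan_flowList (hRD : ∀ l, Sum.inl l ∈ R) {P : Type*} [NormedAddCommGroup P]
    [NormedSpace ℝ P] {b : P → Fin h → ℝ} {γ : P → Jet m n} {z : P} (hb : ContDiffAt ℝ ∞ b z)
    (hγ : ∀ c, ContDiffAt ℝ ∞ (fun w => γ w c) z) {L : List (Fin h)}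
    (hstay : flowListStays Ω₀ E Φ (b z) L (γ z)) (v : P)
    (hv : InSpan G R (γ z) (fun c => fderiv ℝ (fun w => γ w c) z v))
    (hR : ∀ j ∈ L, b z j = 0 ∨ ∀ k ∈ R, ∀ l ∉ R, ∀ p ∈ Ω, bracketCoeff G lam η j k l p = 0)
    (hR' : ∀ j ∈ L, fderiv ℝ b z v j = 0 ∨ Sum.inr j ∈ R) :
    InSpan G R (flowList Φ (b z) L (γ z))
      (fun c => fderiv ℝ (fun w => flowList Φ (b w) L (γ w) c) z v) := by
  induction L generalizing γ with
  | nil => exact hv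
  | cons j L ih =>
    have hbj : ContDiffAt ℝ ∞ (fun w => b w j) z := contDiffAt_pi.1 hb j
    have hE : (b z j, γ z) ∈ E j := by simpa using (hstay.1 1 (by simp)).1
    have hfd : fderiv ℝ (fun w => b w j) z v = fderiv ℝ b z v j := by
      rw [fderiv_pi fun i => (contDiffAt_pi.1 hb i).differentiableAt (by simp)]
      rfl
    have hstep := inSpan_flow H HN hRD hbj hγ j hstay.1 v hv (hR j (by simp))
      (hfd ▸ hR' j (by simp))
    exact ih (γ := fun w => Φ j (b w j) (γ w))
      (fun c => (H.flow j).contDiffAt hbj hγ hE c) hstay.2 hstep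
      (fun k hk => hR k (by simp [hk])) (fun k hk => hR' k (by simp [hk]))

end Derivative

/-! ### Local inverses and frame charts -/

/-- The inverse function theorem, with smoothness on a neighbourhood. -/
theorem exists_local_inverse {A B : Type*} [NormedAddCommGroup A] [NormedSpace ℝ A]
    [FiniteDimensional ℝ A] [NormedAddCommGroup B] [NormedSpace ℝ B] [FiniteDimensional ℝ B]
    {Λ : A → B} {a : A} (hΛ : ∀ᶠ x in 𝓝 a, ContDiffAt ℝ ∞ Λ x)
    (hinj : ∀ v, fderiv ℝ Λ a v = 0 → v = 0)
    (hdim : Module.finrank ℝ A = Module.finrank ℝ B) :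
    ∃ Υ : B → A, Υ (Λ a) = a ∧ Tendsto Υ (𝓝 (Λ a)) (𝓝 a) ∧ (∀ᶠ x in 𝓝 a, Υ (Λ x) = x) ∧
      (∀ᶠ y in 𝓝 (Λ a), Λ (Υ y) = y) ∧ ∀ᶠ y in 𝓝 (Λ a), ContDiffAt ℝ ∞ Υ y := by
  have : CompleteSpace A := FiniteDimensional.complete ℝ A
  have : CompleteSpace B := FiniteDimensional.complete ℝ B
  let L : A ≃L[ℝ] B := (LinearEquiv.ofInjectiveOfFinrankEq (fderiv ℝ Λ a : A →ₗ[ℝ] B)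
    ((injective_iff_map_eq_zero _).2 hinj) hdim).toContinuousLinearEquiv
  have hL : (L : A →L[ℝ] B) = fderiv ℝ Λ a := by
    ext v
    rfl
  have hs : ContDiffAt ℝ ∞ Λ a := hΛ.self_of_nhds
  have hd : HasFDerivAt Λ (L : A →L[ℝ] B) a := by
    rw [hL]
    exact (hs.differentiableAt (by simp)).hasFDerivAt
  let e := hs.toOpenPartialHomeomorph Λ hd (by simp)
  have hcoe : ∀ x, e x = Λ x := fun _ => rfl
  have hsrc : a ∈ e.source := hs.mem_toOpenPartialHomeomorph_source hd (by simp)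
  have htgt : Λ a ∈ e.target := hs.image_mem_toOpenPartialHomeomorph_target hd (by simp)
  have hinv : e.symm (Λ a) = a := e.left_inv hsrc
  have htend : Tendsto e.symm (𝓝 (Λ a)) (𝓝 a) := by
    have := e.symm.continuousAt (x := Λ a) htgt
    rwa [ContinuousAt, hinv] at this
  refine ⟨e.symm, hinv, htend, ?_, ?_, ?_⟩
  · filter_upwards [e.open_source.mem_nhds hsrc] with x hx using e.left_inv hx
  · filter_upwards [e.open_target.mem_nhds htgt] with y hy using e.right_inv hy
  · have h1 : ∀ᶠ x in 𝓝 a, ∃ L' : A ≃L[ℝ] B, (L' : A →L[ℝ] B) = fderiv ℝ Λ x := by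
      have hc : ContinuousAt (fderiv ℝ Λ) a :=
        (hs.fderiv_right (m := ∞) (by simp)).continuousAt
      have := hc.preimage_mem_nhds (hL ▸ L.nhds)
      filter_upwards [this] with x hx using hx
    filter_upwards [htend.eventually (h1.and hΛ), e.open_target.mem_nhds htgt] with y hy hyt
    obtain ⟨⟨L', hL'⟩, hy2⟩ := hy
    refine e.contDiffAt_symm (f₀' := L') hyt ?_ hy2
    rw [hL']
    exact (hy2.differentiableAt (by simp)).hasFDerivAt

theorem contDiff_det {P ι : Type*} [NormedAddCommGroup P] [NormedSpace ℝ P] [Fintype ι]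
    [DecidableEq ι] {A : P → Matrix ι ι ℝ} (hA : ∀ i j, ContDiff ℝ ∞ (fun z => A z i j)) :
    ContDiff ℝ ∞ (fun z => (A z).det) := by
  simp only [Matrix.det_apply]
  exact ContDiff.sum fun τ _ => (contDiff_prod fun i _ => hA _ _).const_smul _

theorem contDiffOn_matrix_inv {P ι : Type*} [NormedAddCommGroup P] [NormedSpace ℝ P] [Fintype ι]
    [DecidableEq ι] {A : P → Matrix ι ι ℝ} (hA : ∀ i j, ContDiff ℝ ∞ (fun z => A z i j)) (i j : ι) :
    ContDiffOn ℝ ∞ (fun z => (A z)⁻¹ i j) {z | (A z).det ≠ 0} := by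
  have h1 : ContDiff ℝ ∞ (fun z => (A z).adjugate i j) := by
    simp only [Matrix.adjugate_apply]
    refine contDiff_det fun k l => ?_
    by_cases hk : k = j
    · subst hk
      simpa only [Matrix.updateRow_self] using contDiff_const
    · simpa only [Matrix.updateRow_ne hk] using hA k l
  simp only [Matrix.inv_def, Matrix.smul_apply, Ring.inverse_eq_inv', smul_eq_mul]
  exact ((contDiff_det hA).contDiffOn.inv fun z hz => hz).mul h1.contDiffOn

section Chart

variable {Ω : Set (Jet m n)} {G : Fin h → Fin n → Jet m n → ℝ} {lam : Fin h → Fin h → Fin h → ℝ}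
  {η : Fin h → Fin m → Jet m n → ℝ} {E : Fin h → Set (ℝ × Jet m n)}
  {Φ : Fin h → ℝ → Jet m n → Jet m n}

/-- The coordinates `x^1, …, x^m` and `u^{i_1}_{σ^1}, …, u^{i_h}_{σ^h}`. -/
def chartCoord (ind : Fin h → Fin n) (σ : Fin h → Fin m → ℕ) : Fin m ⊕ Fin h → Coord m n :=
  Sum.elim Sum.inl (fun k => Sum.inr (ind k, σ k))

/-- The matrix of the components of the frame in the coordinates `chartCoord ind σ`. -/
noncomputable def frameMatrix (G : Fin h → Fin n → Jet m n → ℝ) (ind : Fin h → Fin n)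
    (σ : Fin h → Fin m → ℕ) (p : Jet m n) : Matrix (Fin m ⊕ Fin h) (Fin m ⊕ Fin h) ℝ :=
  Matrix.of fun r k => frame G k (chartCoord ind σ r) p

theorem det_frameMatrix (G : Fin h → Fin n → Jet m n → ℝ) (ind : Fin h → Fin n)
    (σ : Fin h → Fin m → ℕ) (p : Jet m n) : (frameMatrix G ind σ p).det =
      (Matrix.of fun r s : Fin h => totalDPow (σ r) (G s (ind r)) p).det := by
  have : frameMatrix G ind σ p = Matrix.fromBlocks 1 0
      (Matrix.of fun (r : Fin h) (l : Fin m) => totalD l (Sum.inr (ind r, σ r)) p)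
      (Matrix.of fun r s : Fin h => totalDPow (σ r) (G s (ind r)) p) := by
    ext (i | r) (l | s)
    · simp [frameMatrix, chartCoord, frame, totalD, Matrix.one_apply]
    · simp [frameMatrix, chartCoord, frame, evol]
    · simp [frameMatrix, chartCoord, frame]
    · simp [frameMatrix, chartCoord, frame, evol]
  rw [this, Matrix.det_fromBlocks_zero₁₂, Matrix.det_one, one_mul]

theorem isFrameChart (hΩ : IsOpen Ω) (hG : ∀ i j, IsSmoothOn Ω (G i j)) (ind : Fin h → Fin n)
    (σ : Fin h → Fin m → ℕ) :
    IsFrameChart Ω G {p | p ∈ Ω ∧ (frameMatrix G ind σ p).det ≠ 0} (chartCoord ind σ)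
      (fun l r p => (frameMatrix G ind σ p)⁻¹ l r) := by
  have hW : ∀ z : (Fin m ⊕ Fin h) × (Fin m ⊕ Fin h),
      IsSmoothOn Ω (fun p => frameMatrix G ind σ p z.1 z.2) := fun z =>
    isSmoothOn_frame hΩ hG z.2 (chartCoord ind σ z.1)
  have hA : ∀ i j : Fin m ⊕ Fin h, ContDiff ℝ ∞
      (fun v : (Fin m ⊕ Fin h) × (Fin m ⊕ Fin h) → ℝ =>
        (Matrix.of fun r k => v (r, k) : Matrix (Fin m ⊕ Fin h) (Fin m ⊕ Fin h) ℝ) i j) :=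
    fun i j => contDiff_apply ℝ ℝ (i, j)
  refine ⟨?_, fun p hp => hp.1, fun l r => ?_, fun p hp l k => ?_⟩
  · have : IsSmoothOn Ω (fun p => (frameMatrix G ind σ p).det) :=
      IsSmoothOn.comp hW (contDiff_det hA).contDiffOn (fun _ _ => mem_univ _)
    exact (this.continuousOn hΩ).isOpen_inter_preimage hΩ isOpen_ne
  · exact IsSmoothOn.comp (fun z => (hW z).mono fun p hp => hp.1) (contDiffOn_matrix_inv hA l r)
      (fun p hp => hp.2)
  · have h1 := Matrix.nonsing_inv_mul (frameMatrix G ind σ p) (isUnit_iff_ne_zero.2 hp.2)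
    have h2 := congrFun (congrFun h1 l) k
    rw [Matrix.mul_apply, Matrix.one_apply] at h2
    simp only [eq_comm (a := k)]
    exact h2

variable {Ω₀ : Set (Jet m n)} {crd : Fin m ⊕ Fin h → Coord m n}
  {N : Fin m ⊕ Fin h → Fin m ⊕ Fin h → Jet m n → ℝ} (HN : IsFrameChart Ω G Ω₀ crd N)
include HN

theorem IsFrameChart.coeff_eq_zero {p : Jet m n} (hp : p ∈ Ω₀) {a : Fin m ⊕ Fin h → ℝ}
    (ha : ∀ r, ∑ k, a k * frame G k (crd r) p = 0) (l : Fin m ⊕ Fin h) : a l = 0 := by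
  have h1 : ∑ r, N l r p * ∑ k, a k * frame G k (crd r) p = 0 := by simp [ha]
  simp only [Finset.mul_sum] at h1
  rw [Finset.sum_comm] at h1
  have h2 : ∀ k, ∑ r, N l r p * (a k * frame G k (crd r) p) = a k * if k = l then 1 else 0 := by
    intro k
    rw [← HN.inverse p hp, Finset.mul_sum]
    exact Finset.sum_congr rfl fun _ _ => by ring
  simpa [h2] using h1

theorem IsFrameChart.eq_zero {p : Jet m n} (hp : p ∈ Ω₀) {R : Set (Fin m ⊕ Fin h)}
    {ξ : Jet m n} (hξ : InSpan G R p ξ) (h0 : ∀ r, ξ (crd r) = 0) (c : Coord m n) : ξ c = 0 := by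
  obtain ⟨a, -, ha⟩ := hξ
  rw [ha c]
  exact Finset.sum_eq_zero fun k _ => by
    rw [HN.coeff_eq_zero hp (fun r => (ha (crd r)).symm.trans (h0 r)) k, zero_mul]

/-- A family `Γ` of integral manifolds of the frame, for which the chart coordinates, together with
the parameters `β`, form a local coordinate system: near `q₀`, the point `Γ q` is determined by its
chart coordinates. -/
theorem IsFrameChart.eq_of_chart_eq {A B : Type*} [NormedAddCommGroup A] [NormedSpace ℝ A]
    [FiniteDimensional ℝ A] [NormedAddCommGroup B] [NormedSpace ℝ B] [FiniteDimensional ℝ B]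
    {Γ : A × B → Jet m n} {q₀ : A × B}
    (hΓ : ∀ᶠ q in 𝓝 q₀, (∀ c, ContDiffAt ℝ ∞ (fun q => Γ q c) q) ∧ Γ q ∈ Ω₀ ∧
      ∀ v, InSpan G univ (Γ q) (fun c => fderiv ℝ (fun q => Γ q c) q v))
    (hinj : ∀ v, (∀ r, fderiv ℝ (fun q => Γ q (crd r)) q₀ v = 0) → v.2 = 0 → v = 0)
    (hdim : Module.finrank ℝ A = m + h) :
    ∃ Q ∈ 𝓝 q₀, ∀ q ∈ Q, ∀ q' ∈ Q, (∀ r, Γ q (crd r) = Γ q' (crd r)) → Γ q = Γ q' := by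
  let Λ : A × B → (Fin m ⊕ Fin h → ℝ) × B := fun q => (fun r => Γ q (crd r), q.2)
  have hΛ : ∀ᶠ q in 𝓝 q₀, ContDiffAt ℝ ∞ Λ q := by
    filter_upwards [hΓ] with q hq
    exact (contDiffAt_pi.2 fun r => hq.1 (crd r)).prodMk contDiffAt_snd
  have hΛd : ∀ q, (∀ c, ContDiffAt ℝ ∞ (fun q => Γ q c) q) → ∀ v, fderiv ℝ Λ q v =
      (fun r => fderiv ℝ (fun q => Γ q (crd r)) q v, v.2) := by
    intro q hq v
    have e1 : HasFDerivAt Λ ((ContinuousLinearMap.pi fun r =>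
        fderiv ℝ (fun q => Γ q (crd r)) q).prod (ContinuousLinearMap.snd ℝ A B)) q :=
      (hasFDerivAt_pi.2 fun r => ((hq (crd r)).differentiableAt (by simp)).hasFDerivAt).prodMk
        hasFDerivAt_snd
    rw [e1.fderiv]
    rfl
  obtain ⟨Υ, -, hΥt, hΥΛ, hΛΥ, hΥs⟩ := exists_local_inverse hΛ (fun v hv => by
    rw [hΛd _ hΓ.self_of_nhds.1] at hv
    exact hinj v (fun r => congrFun (congrArg Prod.fst hv) r) (congrArg Prod.snd hv))
    (by simp [hdim])
  have hgood := (hΥt.eventually hΓ).and (hΛΥ.eventually_nhds.and hΥs)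
  obtain ⟨ε, hε, hball⟩ := Metric.eventually_nhds_iff_ball.1 hgood
  have hΛc : ContinuousAt Λ q₀ := hΛ.self_of_nhds.continuousAt
  refine ⟨_, hΥΛ.and (hΛc.preimage_mem_nhds (Metric.ball_mem_nhds _ hε)), ?_⟩
  rintro q ⟨hq1, hq2⟩ q' ⟨hq1', hq2'⟩ hqq'
  -- `Γ ∘ Υ` does not depend on the parameters
  have hconst : ∀ (w : Fin m ⊕ Fin h → ℝ) (c : Coord m n), ∀ β ∈ Metric.ball q₀.2 ε,
      ∀ β' ∈ Metric.ball q₀.2 ε, (w, q₀.2) ∈ Metric.ball (Λ q₀) ε →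
      Γ (Υ (w, β)) c = Γ (Υ (w, β')) c := by
    intro w c β hβ β' hβ' hw
    have hmem : ∀ β ∈ Metric.ball q₀.2 ε, (w, β) ∈ Metric.ball (Λ q₀) ε := by
      intro β hβ
      rw [Metric.mem_ball, Prod.dist_eq, max_lt_iff] at hw ⊢
      exact ⟨hw.1, hβ⟩
    have hF : ∀ β ∈ Metric.ball q₀.2 ε, HasFDerivAt (fun β => Γ (Υ (w, β)) c)
        (0 : B →L[ℝ] ℝ) β := by
      intro β hβ
      obtain ⟨⟨h1, h2, h3⟩, h4, h5⟩ := hball _ (hmem β hβ)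
      have e1 : HasFDerivAt (fun β : B => (w, β))
          (ContinuousLinearMap.inr ℝ (Fin m ⊕ Fin h → ℝ) B) β :=
        hasFDerivAt_prodMk_right w β
      have e2 := (h5.differentiableAt (by simp)).hasFDerivAt.comp β e1
      have e3 : ∀ c, HasFDerivAt (fun β => Γ (Υ (w, β)) c)
          ((fderiv ℝ (fun q => Γ q c) (Υ (w, β))).comp
            ((fderiv ℝ Υ (w, β)).comp
              (ContinuousLinearMap.inr ℝ (Fin m ⊕ Fin h → ℝ) B))) β := fun c =>
        HasFDerivAt.comp (g := fun q => Γ q c) β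
          ((h1 c).differentiableAt (by simp)).hasFDerivAt e2
      have e4 : ((fderiv ℝ (fun q => Γ q c) (Υ (w, β))).comp
            ((fderiv ℝ Υ (w, β)).comp (ContinuousLinearMap.inr ℝ (Fin m ⊕ Fin h → ℝ) B))) = 0 := by
        ext v
        refine HN.eq_zero h2 (h3 (fderiv ℝ Υ (w, β) (0, v))) (fun r => ?_) c
        have e5 : (fun β => Γ (Υ (w, β)) (crd r)) =ᶠ[𝓝 β] fun _ => w r := by
          have e6 : Tendsto (fun β : B => (w, β)) (𝓝 β) (𝓝 (w, β)) :=
            (Continuous.prodMk_right w).tendsto β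
          filter_upwards [e6.eventually h4] with β' hβ'
          exact congrFun (congrArg Prod.fst hβ') r
        have e7 := (e3 (crd r)).unique ((hasFDerivAt_const (w r) β).congr_of_eventuallyEq e5)
        exact congrArg (fun L : B →L[ℝ] ℝ => L v) e7
      rw [← e4]
      exact e3 c
    exact Metric.isOpen_ball.is_const_of_fderiv_eq_zero (convex_ball _ _).isPreconnected
      (fun β hβ => (hF β hβ).differentiableAt.differentiableWithinAt)
      (fun β hβ => (hF β hβ).fderiv) hβ hβ'
  have hsplit : ∀ q, Λ q ∈ Metric.ball (Λ q₀) ε → q.2 ∈ Metric.ball q₀.2 ε ∧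
      ((Λ q).1, q₀.2) ∈ Metric.ball (Λ q₀) ε := by
    intro q hq
    rw [Metric.mem_ball, Prod.dist_eq, max_lt_iff] at hq
    refine ⟨hq.2, ?_⟩
    rw [Metric.mem_ball, Prod.dist_eq, max_lt_iff]
    exact ⟨hq.1, by simpa [Λ] using hε⟩
  have hw : (Λ q).1 = (Λ q').1 := funext hqq'
  funext c
  rw [← hq1, ← hq1']
  have := hconst (Λ q).1 c q.2 (hsplit q hq2).1 q'.2 (hsplit q' hq2').1 (hsplit q hq2).2
  rw [show Λ q' = ((Λ q).1, q'.2) from Prod.ext hw.symm rfl]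
  exact this

end Chart

/-! ### The manifold swept out by the flows -/

section Families

variable {M : Set (Fin m → ℝ)} {N : Set (Fin n → ℝ)} {f : (Fin m → ℝ) → Fin n → ℝ}
  {G : Fin h → Fin n → Jet m n → ℝ} {lam : Fin h → Fin h → Fin h → ℝ}
  {η : Fin h → Fin m → Jet m n → ℝ} {E : Fin h → Set (ℝ × Jet m n)}
  {Φ : Fin h → ℝ → Jet m n → Jet m n} {Ω₀ : Set (Jet m n)} {ind : Fin h → Fin n}
  {σ : Fin h → Fin m → ℕ} {T : Fin m ⊕ Fin h → Fin m ⊕ Fin h → Jet m n → ℝ} {x₀ : Fin m → ℝ}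

/-- The flows of the system are defined near the jet of the map `f` at `x₀`, and this jet belongs to
the domain of a frame chart with the coordinates `chartCoord ind σ`. -/
structure IsGenericPoint (M : Set (Fin m → ℝ)) (N : Set (Fin n → ℝ))
    (f : (Fin m → ℝ) → Fin n → ℝ) (G : Fin h → Fin n → Jet m n → ℝ)
    (lam : Fin h → Fin h → Fin h → ℝ) (η : Fin h → Fin m → Jet m n → ℝ)
    (E : Fin h → Set (ℝ × Jet m n)) (Φ : Fin h → ℝ → Jet m n → Jet m n) (Ω₀ : Set (Jet m n))
    (ind : Fin h → Fin n) (σ : Fin h → Fin m → ℕ)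
    (T : Fin m ⊕ Fin h → Fin m ⊕ Fin h → Jet m n → ℝ) (x₀ : Fin m → ℝ) : Prop where
  isOpen : IsOpen M
  smooth : ContDiffOn ℝ ∞ f M
  mapsTo : MapsTo f M N
  mem : x₀ ∈ M
  system : IsFlowSystem (jetSpace M N) G lam η E Φ
  chart : IsFrameChart (jetSpace M N) G Ω₀ (chartCoord ind σ) T
  jet_mem : prolong f x₀ ∈ Ω₀

/-- The composition of the inverse flows in the opposite order, applied to the jet of `f`: for
`z = (y, b)` this is `Φ^1_{-b^1}(⋯ Φ^h_{-b^h}(j^∞ f(y)) ⋯)`. -/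
noncomputable def backFlow (Φ : Fin h → ℝ → Jet m n → Jet m n) (f : (Fin m → ℝ) → Fin n → ℝ)
    (z : (Fin m → ℝ) × (Fin h → ℝ)) : Jet m n :=
  flowList Φ (-z.2) (List.finRange h).reverse (prolong f z.1)

theorem flowListStays.mem {b : Fin h → ℝ} {L : List (Fin h)} {p : Jet m n} (hp : p ∈ Ω₀)
    (hL : flowListStays Ω₀ E Φ b L p) : flowList Φ b L p ∈ Ω₀ := by
  induction L generalizing p with
  | nil => exact hp
  | cons k ks ih => exact ih (by simpa using (hL.1 1 (by simp)).2) hL.2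

/-- The derivative of a composition of flows at time zero. -/
theorem IsFlowSystem.fderiv_flowList_zero {Ω : Set (Jet m n)} (H : IsFlowSystem Ω G lam η E Φ)
    {P : Type*} [NormedAddCommGroup P] [NormedSpace ℝ P] {b : P → Fin h → ℝ} {γ : P → Jet m n}
    {z : P} (hb : ContDiffAt ℝ ∞ b z) (hγ : ∀ c, ContDiffAt ℝ ∞ (fun w => γ w c) z)
    (hz : b z = 0) (hγz : γ z ∈ Ω) (L : List (Fin h)) (c : Coord m n) (v : P) :
    fderiv ℝ (fun w => flowList Φ (b w) L (γ w) c) z v = fderiv ℝ (fun w => γ w c) z v +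
      (L.map fun j => fderiv ℝ b z v j * charField (G j) (η j) c (γ z)).sum := by
  induction L generalizing γ with
  | nil => simp [flowList]
  | cons j L ih =>
    have hbj : ContDiffAt ℝ ∞ (fun w => b w j) z := contDiffAt_pi.1 hb j
    have h0 : (b z j, γ z) ∈ E j := by simpa [hz] using (H.flow j).zero_mem _ hγz
    have hΦz : Φ j (b z j) (γ z) = γ z := by simp [hz, (H.flow j).zero _ hγz]
    have hfd : fderiv ℝ (fun w => b w j) z v = fderiv ℝ b z v j := by
      rw [fderiv_pi fun i => (contDiffAt_pi.1 hb i).differentiableAt (by simp)]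
      rfl
    have e1 := ih (γ := fun w => Φ j (b w j) (γ w))
      (fun c => (H.flow j).contDiffAt hbj hγ h0 c) (by rwa [hΦz])
    simp only [hΦz] at e1
    have e2 := fderiv_flow (H.flow j) hγ v hbj h0 c
    rw [hΦz, hfd, hz, Pi.zero_apply, fderiv_flowFamily_zero (H.flow j) hγ v H.isOpen hγz] at e2
    simp only [flowList, List.map_cons, List.sum_cons]
    rw [e1, e2]
    ring

section Base

variable {P : Type*} [NormedAddCommGroup P] [NormedSpace ℝ P] (π : P →L[ℝ] (Fin m → ℝ)) {z : P}
  (hM : IsOpen M) (hf : ContDiffOn ℝ ∞ f M) (hz : π z ∈ M)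
include hM hf hz

theorem contDiffAt_prolong_comp (c : Coord m n) :
    ContDiffAt ℝ ∞ (fun w => prolong f (π w) c) z :=
  ContDiffAt.comp (g := fun y => prolong f y c) z (contDiffAt_prolong hM hf hz c)
    π.contDiff.contDiffAt

theorem fderiv_prolong_comp (v : P) (c : Coord m n) :
    fderiv ℝ (fun w => prolong f (π w) c) z v = ∑ l, π v l * totalD l c (prolong f (π z)) := by
  rw [← fderiv_prolong hM hf hz]
  have := ((contDiffAt_prolong hM hf hz c).differentiableAt (by simp)).hasFDerivAt.comp z
    π.hasFDerivAt
  rw [HasFDerivAt.fderiv (f := fun w => prolong f (π w) c) this]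
  rfl

theorem inSpan_prolong_comp {R : Set (Fin m ⊕ Fin h)} (hR : ∀ l, Sum.inl l ∈ R) (v : P) :
    InSpan G R (prolong f (π z)) (fun c => fderiv ℝ (fun w => prolong f (π w) c) z v) := by
  refine ⟨Sum.elim (π v) 0, ?_, fun c => ?_⟩
  · rintro (l | r) hk
    · exact absurd (hR l) hk
    · rfl
  · simp only [fderiv_prolong_comp π hM hf hz]
    simp [frame]

end Base

/-- A map whose chart coordinates have an invertible derivative takes all nearby values of the
chart coordinates. -/
theorem exists_chart_eq {P ι : Type*} [NormedAddCommGroup P] [NormedSpace ℝ P]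
    [FiniteDimensional ℝ P] [Fintype ι] {crd : ι → Coord m n} {γ : P → Jet m n} {z₀ : P}
    (hγ : ∀ᶠ z in 𝓝 z₀, ∀ c, ContDiffAt ℝ ∞ (fun w => γ w c) z)
    (hinj : ∀ v, (∀ r, fderiv ℝ (fun w => γ w (crd r)) z₀ v = 0) → v = 0)
    (hdim : Module.finrank ℝ P = Fintype.card ι) {Z : Set P} (hZ : Z ∈ 𝓝 z₀) :
    ∀ᶠ w in 𝓝 (fun r => γ z₀ (crd r)), ∃ z ∈ Z, ∀ r, γ z (crd r) = w r := by
  have hΛ : ∀ᶠ z in 𝓝 z₀, ContDiffAt ℝ ∞ (fun z r => γ z (crd r)) z := by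
    filter_upwards [hγ] with z hz using contDiffAt_pi.2 fun r => hz (crd r)
  obtain ⟨Υ, -, hΥt, -, hΛΥ, -⟩ := exists_local_inverse hΛ (fun v hv => by
    refine hinj v fun r => ?_
    rw [fderiv_pi fun r => (hγ.self_of_nhds (crd r)).differentiableAt (by simp)] at hv
    exact congrFun hv r) (by simp [hdim])
  filter_upwards [hΥt.eventually hZ, hΛΥ] with w hw1 hw2
  exact ⟨Υ w, hw1, fun r => congrFun hw2 r⟩

variable (D : IsGenericPoint M N f G lam η E Φ Ω₀ ind σ T x₀)
include D

namespace IsGenericPoint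

theorem prolong_mem {y : Fin m → ℝ} (hy : y ∈ M) : prolong f y ∈ jetSpace M N :=
  InfJet.prolong_mem D.mapsTo hy

theorem tendsto_prolong : Tendsto (prolong f) (𝓝 x₀) (𝓝 (prolong f x₀)) :=
  tendsto_pi_nhds.2 fun c => (contDiffAt_prolong D.isOpen D.smooth D.mem c).continuousAt

theorem backFlow_zero {y : Fin m → ℝ} (hy : y ∈ M) : backFlow Φ f (y, 0) = prolong f y :=
  D.system.flowList_of_zero (D.prolong_mem hy) fun k _ => by simp

theorem compFlow_zero {p : Jet m n} (hp : p ∈ jetSpace M N) : compFlow Φ 0 p = p :=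
  D.system.flowList_of_zero hp fun k _ => by simp

theorem tendsto_neg_prolong : Tendsto
    (fun z : (Fin m → ℝ) × (Fin h → ℝ) => (-z.2, prolong f z.1)) (𝓝 (x₀, 0))
      (𝓝 (0, prolong f x₀)) := by
  refine Tendsto.prodMk_nhds ?_ (D.tendsto_prolong.comp (continuous_fst.tendsto (x₀, _)))
  have : Continuous fun z : (Fin m → ℝ) × (Fin h → ℝ) => -z.2 := continuous_snd.neg
  simpa using this.tendsto (x₀, (0 : Fin h → ℝ))

theorem tendsto_backFlow : Tendsto (backFlow Φ f) (𝓝 (x₀, 0)) (𝓝 (prolong f x₀)) :=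
  (D.system.tendsto_flowList _ (D.prolong_mem D.mem)).comp D.tendsto_neg_prolong

/-- For `z` near `(x₀, 0)` the flow lines in `backFlow Φ f z` stay in the domain of the chart. -/
theorem eventually_backFlow_stays : ∀ᶠ z : (Fin m → ℝ) × (Fin h → ℝ) in 𝓝 (x₀, 0), z.1 ∈ M ∧
    prolong f z.1 ∈ Ω₀ ∧ flowListStays Ω₀ E Φ (-z.2) (List.finRange h).reverse (prolong f z.1) := by
  have e1 : ∀ᶠ z : (Fin m → ℝ) × (Fin h → ℝ) in 𝓝 (x₀, 0), z.1 ∈ M :=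
    continuous_fst.continuousAt.preimage_mem_nhds (D.isOpen.mem_nhds D.mem)
  have e2 : ∀ᶠ z : (Fin m → ℝ) × (Fin h → ℝ) in 𝓝 (x₀, 0), prolong f z.1 ∈ Ω₀ :=
    (D.tendsto_prolong.comp (continuous_fst.tendsto (x₀, _))).eventually
      (D.chart.isOpen.mem_nhds D.jet_mem)
  filter_upwards [e1, e2, D.tendsto_neg_prolong.eventually (D.system.eventually_stays
    D.chart.isOpen D.chart.subset (List.finRange h).reverse D.jet_mem)] with z h1 h2 h3
  exact ⟨h1, h2, h3⟩

omit D in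
theorem contDiffAt_neg_snd {z : (Fin m → ℝ) × (Fin h → ℝ)} :
    ContDiffAt ℝ ∞ (fun z : (Fin m → ℝ) × (Fin h → ℝ) => -z.2) z := contDiffAt_snd.neg

omit D in
theorem fderiv_neg_snd (z v : (Fin m → ℝ) × (Fin h → ℝ)) :
    fderiv ℝ (fun z : (Fin m → ℝ) × (Fin h → ℝ) => -z.2) z v = -v.2 := by
  rw [fderiv_fun_neg, fderiv_snd]
  rfl

theorem contDiffAt_prolong_fst {z : (Fin m → ℝ) × (Fin h → ℝ)} (hz1 : z.1 ∈ M) (c : Coord m n) :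
    ContDiffAt ℝ ∞ (fun w : (Fin m → ℝ) × (Fin h → ℝ) => prolong f w.1 c) z :=
  contDiffAt_prolong_comp (ContinuousLinearMap.fst ℝ (Fin m → ℝ) (Fin h → ℝ)) (z := z) D.isOpen
    D.smooth hz1 c

theorem inSpan_prolong_fst {R : Set (Fin m ⊕ Fin h)} (hRD : ∀ l, Sum.inl l ∈ R)
    {z : (Fin m → ℝ) × (Fin h → ℝ)} (hz1 : z.1 ∈ M) (v : (Fin m → ℝ) × (Fin h → ℝ)) :
    InSpan G R (prolong f z.1) (fun c => fderiv ℝ (fun w : (Fin m → ℝ) × (Fin h → ℝ) =>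
      prolong f w.1 c) z v) :=
  inSpan_prolong_comp (ContinuousLinearMap.fst ℝ (Fin m → ℝ) (Fin h → ℝ)) (z := z) D.isOpen
    D.smooth hz1 hRD v

theorem contDiffAt_backFlow {z : (Fin m → ℝ) × (Fin h → ℝ)} (hz1 : z.1 ∈ M)
    (hz : flowListDefined E Φ (-z.2) (List.finRange h).reverse (prolong f z.1)) (c : Coord m n) :
    ContDiffAt ℝ ∞ (fun z => backFlow Φ f z c) z :=
  D.system.contDiffAt_flowList (γ := fun z => prolong f z.1) contDiffAt_neg_snd
    (D.contDiffAt_prolong_fst hz1) hz c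

theorem inSpan_backFlow {R : Set (Fin m ⊕ Fin h)} (hRD : ∀ l, Sum.inl l ∈ R)
    {z : (Fin m → ℝ) × (Fin h → ℝ)} (hz1 : z.1 ∈ M)
    (hz : flowListStays Ω₀ E Φ (-z.2) (List.finRange h).reverse (prolong f z.1))
    (v : (Fin m → ℝ) × (Fin h → ℝ))
    (hR : ∀ j, z.2 j = 0 ∨ ∀ k ∈ R, ∀ l ∉ R, ∀ p ∈ jetSpace M N,
      bracketCoeff G lam η j k l p = 0)
    (hR' : ∀ j, v.2 j = 0 ∨ Sum.inr j ∈ R) :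
    InSpan G R (backFlow Φ f z) (fun c => fderiv ℝ (fun z => backFlow Φ f z c) z v) := by
  refine inSpan_flowList D.system D.chart hRD (γ := fun z => prolong f z.1) contDiffAt_neg_snd
    (D.contDiffAt_prolong_fst hz1) hz v
    (D.inSpan_prolong_fst hRD hz1 v)
    (fun j _ => ?_) (fun j _ => ?_)
  · simpa using hR j
  · rw [fderiv_neg_snd]
    simpa using hR' j

omit D in
/-- The span of all frame fields is stable under commutation with the characteristic fields. -/
theorem _root_.InfJet.bracketCoeff_univ (j : Fin h) : ∀ k ∈ (univ : Set (Fin m ⊕ Fin h)),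
    ∀ l ∉ (univ : Set (Fin m ⊕ Fin h)), ∀ p ∈ jetSpace M N, bracketCoeff G lam η j k l p = 0 :=
  fun _ _ l hl => absurd (mem_univ l) hl

/-- At a point of the chart, the fields `D_l` and the characteristic fields are linearly
independent in the chart coordinates. -/
theorem coeff_eq_zero {p : Jet m n} (hp : p ∈ Ω₀) {a : Fin m → ℝ} {w : Fin h → ℝ}
    (haw : ∀ r, ∑ l, a l * totalD l (chartCoord ind σ r) p +
      ∑ s, w s * charField (G s) (η s) (chartCoord ind σ r) p = 0) : a = 0 ∧ w = 0 := by
  have key := D.chart.coeff_eq_zero hp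
    (a := Sum.elim (fun l => a l - ∑ s, w s * η s l p) w) (fun r => by
      rw [← haw r]
      simp only [Fintype.sum_sum_type, Sum.elim_inl, Sum.elim_inr, frame, charField, sub_mul,
        mul_sub, Finset.sum_sub_distrib, Finset.sum_mul, Finset.mul_sum]
      rw [Finset.sum_comm]
      simp only [mul_assoc]
      ring)
  have hw : w = 0 := funext fun s => key (Sum.inr s)
  refine ⟨funext fun l => ?_, hw⟩
  have := key (Sum.inl l)
  simpa [hw] using this

theorem fderiv_backFlow_zero (v : (Fin m → ℝ) × (Fin h → ℝ)) (c : Coord m n) :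
    fderiv ℝ (fun z => backFlow Φ f z c) (x₀, 0) v =
      ∑ l, v.1 l * totalD l c (prolong f x₀) +
        ∑ s, (-v.2) s * charField (G s) (η s) c (prolong f x₀) := by
  have e1 := D.system.fderiv_flowList_zero (z := (x₀, (0 : Fin h → ℝ)))
    (γ := fun z => prolong f z.1) contDiffAt_neg_snd
    (D.contDiffAt_prolong_fst D.mem) (by simp)
    (D.prolong_mem D.mem) (List.finRange h).reverse c v
  have e2 := fderiv_prolong_comp (ContinuousLinearMap.fst ℝ (Fin m → ℝ) (Fin h → ℝ))
    (z := (x₀, (0 : Fin h → ℝ))) D.isOpen D.smooth D.mem v c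
  simp only [ContinuousLinearMap.coe_fst'] at e2
  rw [e2, fderiv_neg_snd, ((List.reverse_perm _).map _).sum_eq, ← Fin.sum_univ_def] at e1
  exact e1

/-- The derivative at the base point of the flows applied to a family `γ`. -/
theorem fderiv_compFlow_zero {P : Type*} [NormedAddCommGroup P] [NormedSpace ℝ P]
    {b : P → Fin h → ℝ} {γ : P → Jet m n} {z : P} (hb : ContDiffAt ℝ ∞ b z)
    (hγ : ∀ c, ContDiffAt ℝ ∞ (fun w => γ w c) z) (hz : b z = 0) (hγz : γ z ∈ jetSpace M N)
    (v : P) (c : Coord m n) :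
    fderiv ℝ (fun w => compFlow Φ (b w) (γ w) c) z v = fderiv ℝ (fun w => γ w c) z v +
      ∑ s, fderiv ℝ b z v s * charField (G s) (η s) c (γ z) := by
  have e1 := D.system.fderiv_flowList_zero hb hγ hz hγz (List.finRange h) c v
  rw [← Fin.sum_univ_def] at e1
  exact e1

theorem eventually_contDiffAt_backFlow : ∀ᶠ z in 𝓝 (x₀, (0 : Fin h → ℝ)),
    ∀ c, ContDiffAt ℝ ∞ (fun z => backFlow Φ f z c) z := by
  filter_upwards [D.eventually_backFlow_stays] with z hz c
  exact D.contDiffAt_backFlow hz.1 hz.2.2.defined c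

theorem tendsto_chain : Tendsto (fun q : ((Fin m → ℝ) × (Fin h → ℝ)) × (Fin h → ℝ) =>
    (q.2, backFlow Φ f q.1)) (𝓝 ((x₀, 0), 0)) (𝓝 (0, prolong f x₀)) :=
  (continuous_snd.tendsto _).prodMk_nhds (D.tendsto_backFlow.comp (continuous_fst.tendsto _))

/-- The maps `(y, b) ↦ backFlow Φ f (y, b)` and `(y, b) ↦ 𝚽_b(j^∞ f(y))` locally have the same
image: both belong to the family `𝚽_β(backFlow Φ f (y, b))` of integral manifolds. -/
theorem exists_chain : ∃ Q ∈ 𝓝 (((x₀, 0), 0) : ((Fin m → ℝ) × (Fin h → ℝ)) × (Fin h → ℝ)),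
    ∀ q ∈ Q, ∀ q' ∈ Q, (∀ r, compFlow Φ q.2 (backFlow Φ f q.1) (chartCoord ind σ r) =
      compFlow Φ q'.2 (backFlow Φ f q'.1) (chartCoord ind σ r)) →
      compFlow Φ q.2 (backFlow Φ f q.1) = compFlow Φ q'.2 (backFlow Φ f q'.1) := by
  have hp₀ := D.prolong_mem D.mem
  have hback0 : backFlow Φ f (x₀, 0) = prolong f x₀ := D.backFlow_zero D.mem
  have hsm : ∀ {q : ((Fin m → ℝ) × (Fin h → ℝ)) × (Fin h → ℝ)},
      (∀ c, ContDiffAt ℝ ∞ (fun z => backFlow Φ f z c) q.1) →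
      ∀ c, ContDiffAt ℝ ∞ (fun q : ((Fin m → ℝ) × (Fin h → ℝ)) × (Fin h → ℝ) =>
        backFlow Φ f q.1 c) q := fun {q} hq c =>
    ContDiffAt.comp (g := fun z => backFlow Φ f z c) q (hq c) contDiffAt_fst
  have hfd : ∀ {q : ((Fin m → ℝ) × (Fin h → ℝ)) × (Fin h → ℝ)},
      (∀ c, ContDiffAt ℝ ∞ (fun z => backFlow Φ f z c) q.1) → ∀ v c,
      fderiv ℝ (fun q : ((Fin m → ℝ) × (Fin h → ℝ)) × (Fin h → ℝ) => backFlow Φ f q.1 c) q v =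
        fderiv ℝ (fun z => backFlow Φ f z c) q.1 v.1 := by
    intro q hq v c
    have e1 := HasFDerivAt.comp (g := fun z => backFlow Φ f z c) q
      ((hq c).differentiableAt (by simp)).hasFDerivAt (hasFDerivAt_fst (𝕜 := ℝ) (p := q))
    rw [HasFDerivAt.fderiv (f := fun q : ((Fin m → ℝ) × (Fin h → ℝ)) × (Fin h → ℝ) =>
      backFlow Φ f q.1 c) e1]
    rfl
  have h0 := D.eventually_contDiffAt_backFlow.self_of_nhds
  refine D.chart.eq_of_chart_eq
    (Γ := fun q : ((Fin m → ℝ) × (Fin h → ℝ)) × (Fin h → ℝ) =>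
      compFlow Φ q.2 (backFlow Φ f q.1)) ?_ ?_ (by simp)
  · have e1 := (continuous_fst.tendsto (((x₀, 0), 0) :
      ((Fin m → ℝ) × (Fin h → ℝ)) × (Fin h → ℝ))).eventually D.eventually_backFlow_stays
    have e2 := D.tendsto_chain.eventually (D.system.eventually_stays
      D.chart.isOpen D.chart.subset (List.finRange h) D.jet_mem)
    filter_upwards [e1, e2] with q hq1 hq2
    have hz := D.contDiffAt_backFlow hq1.1 hq1.2.2.defined
    have hbm : backFlow Φ f q.1 ∈ Ω₀ := hq1.2.2.mem hq1.2.1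
    refine ⟨fun c => D.system.contDiffAt_flowList (γ := fun q : ((Fin m → ℝ) × (Fin h → ℝ)) ×
      (Fin h → ℝ) => backFlow Φ f q.1) contDiffAt_snd (hsm hz) hq2.defined c, hq2.mem hbm,
      fun v => ?_⟩
    refine inSpan_flowList D.system D.chart (fun _ => mem_univ _)
      (γ := fun q : ((Fin m → ℝ) × (Fin h → ℝ)) × (Fin h → ℝ) => backFlow Φ f q.1)
      contDiffAt_snd (hsm hz) hq2 v ?_ (fun j _ => Or.inr (bracketCoeff_univ j))
      (fun j _ => Or.inr (mem_univ _))
    simp only [hfd hz]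
    exact D.inSpan_backFlow (fun _ => mem_univ _) hq1.1 hq1.2.2 v.1
      (fun j => Or.inr (bracketCoeff_univ j)) (fun j => Or.inr (mem_univ _))
  · intro v hv hv2
    have e1 : ∀ r, ∑ l, v.1.1 l * totalD l (chartCoord ind σ r) (prolong f x₀) +
        ∑ s, (-v.1.2) s * charField (G s) (η s) (chartCoord ind σ r) (prolong f x₀) = 0 := by
      intro r
      have e2 := hv r
      rw [D.fderiv_compFlow_zero (γ := fun q : ((Fin m → ℝ) × (Fin h → ℝ)) × (Fin h → ℝ) =>
        backFlow Φ f q.1) contDiffAt_snd (hsm h0) rfl (by simpa [hback0] using hp₀), hfd h0,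
        D.fderiv_backFlow_zero, fderiv_snd] at e2
      simpa [hv2] using e2
    obtain ⟨ha, hw⟩ := D.coeff_eq_zero D.jet_mem e1
    exact Prod.ext (Prod.ext ha (neg_eq_zero.1 hw)) hv2

theorem tendsto_snd_prolong : Tendsto
    (fun z : (Fin m → ℝ) × (Fin h → ℝ) => (z.2, prolong f z.1)) (𝓝 (x₀, 0))
      (𝓝 (0, prolong f x₀)) :=
  (continuous_snd.tendsto _).prodMk_nhds (D.tendsto_prolong.comp (continuous_fst.tendsto (x₀, _)))

theorem tendsto_compFlow_prolong : Tendsto (fun z : (Fin m → ℝ) × (Fin h → ℝ) =>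
    compFlow Φ z.2 (prolong f z.1)) (𝓝 (x₀, 0)) (𝓝 (prolong f x₀)) :=
  (D.system.tendsto_flowList _ (D.prolong_mem D.mem)).comp D.tendsto_snd_prolong

theorem eventually_contDiffAt_compFlow_prolong : ∀ᶠ z : (Fin m → ℝ) × (Fin h → ℝ) in 𝓝 (x₀, 0),
    ∀ c, ContDiffAt ℝ ∞ (fun z : (Fin m → ℝ) × (Fin h → ℝ) => compFlow Φ z.2 (prolong f z.1) c)
      z := by
  have e1 : ∀ᶠ z : (Fin m → ℝ) × (Fin h → ℝ) in 𝓝 (x₀, 0), z.1 ∈ M :=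
    continuous_fst.continuousAt.preimage_mem_nhds (D.isOpen.mem_nhds D.mem)
  filter_upwards [e1, D.tendsto_snd_prolong.eventually (D.system.eventually_stays
    D.chart.isOpen D.chart.subset (List.finRange h) D.jet_mem)] with z hz1 hz2 c
  exact D.system.contDiffAt_flowList (γ := fun z => prolong f z.1) contDiffAt_snd
    (D.contDiffAt_prolong_fst hz1) hz2.defined c

omit D in
theorem tendsto_chart {α : Type*} {l : Filter α} {γ : α → Jet m n}
    (hγ : Tendsto γ l (𝓝 (prolong f x₀))) : Tendsto (fun z r => γ z (chartCoord ind σ r)) l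
      (𝓝 fun r => prolong f x₀ (chartCoord ind σ r)) :=
  tendsto_pi_nhds.2 fun r => ((continuous_apply (chartCoord ind σ r)).tendsto _).comp hγ

omit D in
theorem finrank_eq_card :
    Module.finrank ℝ ((Fin m → ℝ) × (Fin h → ℝ)) = Fintype.card (Fin m ⊕ Fin h) := by
  simp

/-- Points reached by the inverse flows are reached by the flows themselves. -/
theorem eventually_backFlow_mem {Z : Set ((Fin m → ℝ) × (Fin h → ℝ))} (hZ : Z ∈ 𝓝 (x₀, 0)) :
    ∀ᶠ z in 𝓝 (x₀, (0 : Fin h → ℝ)), ∃ z' ∈ Z,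
      backFlow Φ f z = compFlow Φ z'.2 (prolong f z'.1) := by
  obtain ⟨Q, hQ, hQe⟩ := D.exists_chain
  have hc1 : Continuous fun z : (Fin m → ℝ) × (Fin h → ℝ) => ((z.1, (0 : Fin h → ℝ)), z.2) := by
    fun_prop
  have hc2 : Continuous fun z : (Fin m → ℝ) × (Fin h → ℝ) => (z, (0 : Fin h → ℝ)) := by
    fun_prop
  have e1 := hc1.continuousAt.preimage_mem_nhds (x := (x₀, 0)) hQ
  have e2 : ∀ᶠ z : (Fin m → ℝ) × (Fin h → ℝ) in 𝓝 (x₀, 0), z.1 ∈ M :=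
    continuous_fst.continuousAt.preimage_mem_nhds (D.isOpen.mem_nhds D.mem)
  have e3 := exists_chart_eq (crd := chartCoord ind σ) D.eventually_contDiffAt_compFlow_prolong
    (fun v hv => by
      obtain ⟨h1, h2⟩ := D.coeff_eq_zero D.jet_mem (a := v.1) (w := v.2) fun r => by
        rw [← hv r, D.fderiv_compFlow_zero (γ := fun z : (Fin m → ℝ) × (Fin h → ℝ) =>
          prolong f z.1) contDiffAt_snd (D.contDiffAt_prolong_fst D.mem) rfl
          (D.prolong_mem D.mem), fderiv_snd]
        have := fderiv_prolong_comp (ContinuousLinearMap.fst ℝ (Fin m → ℝ) (Fin h → ℝ))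
          (z := (x₀, (0 : Fin h → ℝ))) D.isOpen D.smooth D.mem v (chartCoord ind σ r)
        simp only [ContinuousLinearMap.coe_fst'] at this
        rw [this]
        rfl
      exact Prod.ext h1 h2) finrank_eq_card (inter_mem hZ (inter_mem e1 e2))
  have hz0 : compFlow Φ 0 (prolong f x₀) = prolong f x₀ := D.compFlow_zero (D.prolong_mem D.mem)
  simp only [hz0] at e3
  filter_upwards [(tendsto_chart D.tendsto_backFlow).eventually e3,
    hc2.continuousAt.preimage_mem_nhds (x := (x₀, 0)) hQ, D.eventually_backFlow_stays]
    with z ⟨z', ⟨hz', hz'Q, hz'M⟩, he⟩ hzQ hz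
  refine ⟨z', hz', ?_⟩
  have e4 := hQe _ hzQ _ hz'Q
  have hzm : backFlow Φ f z ∈ jetSpace M N := D.chart.subset (hz.2.2.mem hz.2.1)
  simp only [D.compFlow_zero hzm, D.backFlow_zero hz'M] at e4
  exact e4 fun r => (he r).symm

/-- Points reached by the flows are reached by the inverse flows. -/
theorem eventually_compFlow_mem {Z : Set ((Fin m → ℝ) × (Fin h → ℝ))} (hZ : Z ∈ 𝓝 (x₀, 0)) :
    ∀ᶠ z in 𝓝 (x₀, (0 : Fin h → ℝ)), ∃ z' ∈ Z,
      compFlow Φ z.2 (prolong f z.1) = backFlow Φ f z' := by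
  obtain ⟨Q, hQ, hQe⟩ := D.exists_chain
  have hc1 : Continuous fun z : (Fin m → ℝ) × (Fin h → ℝ) => ((z.1, (0 : Fin h → ℝ)), z.2) := by
    fun_prop
  have hc2 : Continuous fun z : (Fin m → ℝ) × (Fin h → ℝ) => (z, (0 : Fin h → ℝ)) := by
    fun_prop
  have e1 := hc2.continuousAt.preimage_mem_nhds (x := (x₀, 0)) hQ
  have e2 : ∀ᶠ z : (Fin m → ℝ) × (Fin h → ℝ) in 𝓝 (x₀, 0), z.1 ∈ M :=
    continuous_fst.continuousAt.preimage_mem_nhds (D.isOpen.mem_nhds D.mem)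
  have e3 := exists_chart_eq (crd := chartCoord ind σ) D.eventually_contDiffAt_backFlow
    (fun v hv => by
      obtain ⟨h1, h2⟩ := D.coeff_eq_zero D.jet_mem (a := v.1) (w := -v.2) fun r => by
        rw [← hv r, D.fderiv_backFlow_zero]
      exact Prod.ext h1 (neg_eq_zero.1 h2)) finrank_eq_card
      (inter_mem hZ (inter_mem e1 D.eventually_backFlow_stays))
  rw [D.backFlow_zero D.mem] at e3
  filter_upwards [(tendsto_chart D.tendsto_compFlow_prolong).eventually e3,
    hc1.continuousAt.preimage_mem_nhds (x := (x₀, 0)) hQ, e2]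
    with z ⟨z', ⟨hz', hz'Q, hz's⟩, he⟩ hzQ hz
  refine ⟨z', hz', ?_⟩
  have e4 := hQe _ hzQ _ hz'Q
  have hzm : backFlow Φ f z' ∈ jetSpace M N := D.chart.subset (hz's.2.2.mem hz's.2.1)
  simp only [D.compFlow_zero hzm, D.backFlow_zero hz] at e4
  exact e4 fun r => (he r).symm

end IsGenericPoint

end Families

/-! ### The flow times that lead to the jet of the initial map -/

section Times

variable {M : Set (Fin m → ℝ)} {N : Set (Fin n → ℝ)} {f : (Fin m → ℝ) → Fin n → ℝ}
  {G : Fin h → Fin n → Jet m n → ℝ} {lam : Fin h → Fin h → Fin h → ℝ}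
  {η : Fin h → Fin m → Jet m n → ℝ} {E : Fin h → Set (ℝ × Jet m n)}
  {Φ : Fin h → ℝ → Jet m n → Jet m n} {Ω₀ : Set (Jet m n)} {ind : Fin h → Fin n}
  {σ : Fin h → Fin m → ℕ} {T : Fin m ⊕ Fin h → Fin m ⊕ Fin h → Jet m n → ℝ} {x₀ : Fin m → ℝ}

/-- The components `u^{i_k}_{σ^k} - ∂^{σ^k} f^{i_k}(x)` of the deviation of a jet from the jet of
`f` at the same base point. -/
noncomputable def jetDefect (f : (Fin m → ℝ) → Fin n → ℝ) (ind : Fin h → Fin n)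
    (σ : Fin h → Fin m → ℕ) (q : Jet m n) (k : Fin h) : ℝ :=
  q (Sum.inr (ind k, σ k)) - prolong f (xpt q) (Sum.inr (ind k, σ k))

theorem jetDefect_congr {q q' : Jet m n}
    (hq : ∀ r, q (chartCoord ind σ r) = q' (chartCoord ind σ r)) :
    jetDefect f ind σ q = jetDefect f ind σ q' := by
  have hx : xpt q = xpt q' := funext fun l => hq (Sum.inl l)
  funext k
  have := hq (Sum.inr k)
  simp only [jetDefect, hx]
  rw [show q (Sum.inr (ind k, σ k)) = q' (Sum.inr (ind k, σ k)) from this]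

theorem jetDefect_prolong (x : Fin m → ℝ) : jetDefect f ind σ (prolong f x) = 0 := by
  funext k
  exact sub_self _

section

variable {P : Type*} [NormedAddCommGroup P] [NormedSpace ℝ P] {γ : P → Jet m n} {z : P}
  (hM : IsOpen M) (hf : ContDiffOn ℝ ∞ f M) (hγ : ∀ c, ContDiffAt ℝ ∞ (fun w => γ w c) z)
  (hz : xpt (γ z) ∈ M)
include hM hf hγ hz

theorem contDiffAt_jetDefect (k : Fin h) :
    ContDiffAt ℝ ∞ (fun w => jetDefect f ind σ (γ w) k) z :=
  (hγ _).sub (ContDiffAt.comp (g := fun y => prolong f y (Sum.inr (ind k, σ k)))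
    (f := fun w => xpt (γ w)) z (contDiffAt_prolong hM hf hz _)
    (contDiffAt_pi.2 fun l => hγ (Sum.inl l)))

theorem fderiv_jetDefect (k : Fin h) (v : P) :
    fderiv ℝ (fun w => jetDefect f ind σ (γ w) k) z v =
      fderiv ℝ (fun w => γ w (Sum.inr (ind k, σ k))) z v -
        ∑ l, fderiv ℝ (fun w => γ w (Sum.inl l)) z v *
          totalD l (Sum.inr (ind k, σ k)) (prolong f (xpt (γ z))) := by
  have hd : ∀ c, DifferentiableAt ℝ (fun w => γ w c) z := fun c => (hγ c).differentiableAt (by simp)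
  have e1 : HasFDerivAt (fun w => xpt (γ w)) _ z :=
    hasFDerivAt_pi.2 fun l => (hd (Sum.inl l)).hasFDerivAt
  have e2 := (hd (Sum.inr (ind k, σ k))).hasFDerivAt.sub
    (((contDiffAt_prolong hM hf hz (Sum.inr (ind k, σ k))).differentiableAt
      (by simp)).hasFDerivAt.comp z e1)
  rw [HasFDerivAt.fderiv (f := fun w => jetDefect f ind σ (γ w) k) e2]
  simp only [sub_apply, ContinuousLinearMap.comp_apply]
  rw [fderiv_prolong hM hf hz]
  rfl

end

variable (D : IsGenericPoint M N f G lam η E Φ Ω₀ ind σ T x₀)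
include D

namespace IsGenericPoint

omit D in
theorem xpt_prolong (x : Fin m → ℝ) : xpt (prolong f x) = x := rfl

/-- The equations that define the flow times, together with finitely many coordinates of the
initial point, have an invertible derivative. -/
theorem defect_injective (S : Finset (Coord m n)) (w : (S → ℝ) × (Fin h → ℝ))
    (hw : fderiv ℝ (fun z : (S → ℝ) × (Fin h → ℝ) => (z.1,
      jetDefect f ind σ (compFlow Φ z.2 (setCoords S (prolong f x₀) z.1))))
      (res S (prolong f x₀), 0) w = 0) : w = 0 := by
  have hp₀ := D.prolong_mem D.mem
  have hι : setCoords S (prolong f x₀) (res S (prolong f x₀)) = prolong f x₀ := setCoords_res S _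
  have hcf : compFlow Φ 0 (prolong f x₀) = prolong f x₀ := D.compFlow_zero hp₀
  have hγ : ∀ c, ContDiffAt ℝ ∞ (fun z : (S → ℝ) × (Fin h → ℝ) =>
      setCoords S (prolong f x₀) z.1 c) (res S (prolong f x₀), 0) := fun c =>
    ((contDiff_setCoords S _ c).comp contDiff_fst).contDiffAt
  have hdef : flowListDefined E Φ 0 (List.finRange h) (prolong f x₀) :=
    (D.system.eventually_stays D.chart.isOpen D.chart.subset (List.finRange h)
      D.jet_mem).self_of_nhds.defined
  have hγ2 : ∀ c, ContDiffAt ℝ ∞ (fun z : (S → ℝ) × (Fin h → ℝ) =>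
      compFlow Φ z.2 (setCoords S (prolong f x₀) z.1) c) (res S (prolong f x₀), 0) := fun c =>
    D.system.contDiffAt_flowList (γ := fun z : (S → ℝ) × (Fin h → ℝ) =>
      setCoords S (prolong f x₀) z.1) contDiffAt_snd hγ (by simpa only [hι] using hdef) c
  have hx : xpt (compFlow Φ 0 (setCoords S (prolong f x₀) (res S (prolong f x₀)))) = x₀ := by
    rw [hι, hcf, xpt_prolong]
  have hde : ∀ k, ContDiffAt ℝ ∞ (fun z : (S → ℝ) × (Fin h → ℝ) => jetDefect f ind σ
      (compFlow Φ z.2 (setCoords S (prolong f x₀) z.1)) k) (res S (prolong f x₀), 0) :=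
    contDiffAt_jetDefect D.isOpen D.smooth hγ2 (by simpa only [hx] using D.mem)
  have e1 : HasFDerivAt (fun z : (S → ℝ) × (Fin h → ℝ) => (z.1,
      jetDefect f ind σ (compFlow Φ z.2 (setCoords S (prolong f x₀) z.1)))) _
      (res S (prolong f x₀), 0) :=
    hasFDerivAt_fst.prodMk (hasFDerivAt_pi.2 fun k =>
      ((hde k).differentiableAt (by simp)).hasFDerivAt)
  rw [e1.fderiv] at hw
  have hw1 : w.1 = 0 := congrArg Prod.fst hw
  have hw2 : ∀ k, fderiv ℝ (fun z : (S → ℝ) × (Fin h → ℝ) => jetDefect f ind σ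
      (compFlow Φ z.2 (setCoords S (prolong f x₀) z.1)) k) (res S (prolong f x₀), 0) w = 0 :=
    fun k => congrFun (congrArg Prod.snd hw) k
  have hfd : ∀ c, fderiv ℝ (fun z : (S → ℝ) × (Fin h → ℝ) =>
      compFlow Φ z.2 (setCoords S (prolong f x₀) z.1) c) (res S (prolong f x₀), 0) w =
      ∑ s, w.2 s * charField (G s) (η s) c (prolong f x₀) := by
    intro c
    rw [D.fderiv_compFlow_zero (γ := fun z : (S → ℝ) × (Fin h → ℝ) =>
      setCoords S (prolong f x₀) z.1) contDiffAt_snd hγ rfl (by simpa only [hι] using hp₀),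
      fderiv_snd, hι]
    have e2 := HasFDerivAt.comp (g := fun v => setCoords S (prolong f x₀) v c)
      (res S (prolong f x₀), (0 : Fin h → ℝ))
      (((contDiff_setCoords S (prolong f x₀) c).differentiable (by simp))
        (res S (prolong f x₀))).hasFDerivAt
      (hasFDerivAt_fst (𝕜 := ℝ) (p := (res S (prolong f x₀), (0 : Fin h → ℝ))))
    rw [HasFDerivAt.fderiv (f := fun z : (S → ℝ) × (Fin h → ℝ) =>
      setCoords S (prolong f x₀) z.1 c) e2]
    simp [hw1]
  have key := (D.coeff_eq_zero D.jet_mem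
    (a := fun l => -∑ s, w.2 s * charField (G s) (η s) (Sum.inl l) (prolong f x₀)) (w := w.2) ?_).2
  · exact Prod.ext hw1 key
  rintro (l | k)
  · simp [chartCoord, totalD]
  · have e3 := hw2 k
    rw [fderiv_jetDefect D.isOpen D.smooth hγ2 (by simpa only [hx] using D.mem)] at e3
    simp only [hfd, hx] at e3
    simp only [chartCoord, Sum.elim_inr, neg_mul, Finset.sum_neg_distrib]
    linarith

/-- The equations `jetDefect f ind σ (𝚽_b(p)) = 0` determine `b` as a smooth function of `p`. -/
theorem exists_times : ∃ (a : Jet m n → Fin h → ℝ) (B : Set (Fin h → ℝ)) (W : Set (Jet m n)),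
    B ∈ 𝓝 0 ∧ IsOpen W ∧ prolong f x₀ ∈ W ∧ (∀ l, IsSmoothOn W (fun p => a p l)) ∧
    a (prolong f x₀) = 0 ∧
    ∀ p ∈ W, ∀ b ∈ B, jetDefect f ind σ (compFlow Φ b p) = 0 ↔ b = a p := by
  classical
  have hp₀ := D.prolong_mem D.mem
  choose S' hS' using fun r => D.system.exists_flowList_dependence (List.finRange h)
    (chartCoord ind σ r)
  let S := Finset.univ.biUnion S'
  set ι := setCoords S (prolong f x₀) with hιdef
  have hι : ι (res S (prolong f x₀)) = prolong f x₀ := setCoords_res S _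
  have hcf : compFlow Φ 0 (prolong f x₀) = prolong f x₀ := D.compFlow_zero hp₀
  have hstay := D.system.eventually_stays D.chart.isOpen D.chart.subset (List.finRange h) D.jet_mem
  have htι : Tendsto (fun z : (S → ℝ) × (Fin h → ℝ) => (z.2, ι z.1))
      (𝓝 (res S (prolong f x₀), 0)) (𝓝 (0, prolong f x₀)) := by
    have : Continuous fun z : (S → ℝ) × (Fin h → ℝ) => (z.2, ι z.1) :=
      continuous_snd.prodMk ((continuous_setCoords S _).comp continuous_fst)
    simpa only [hι] using this.tendsto (res S (prolong f x₀), (0 : Fin h → ℝ))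
  let Λ : (S → ℝ) × (Fin h → ℝ) → (S → ℝ) × (Fin h → ℝ) := fun z =>
    (z.1, jetDefect f ind σ (compFlow Φ z.2 (ι z.1)))
  have hΛ0 : Λ (res S (prolong f x₀), 0) = (res S (prolong f x₀), 0) := by
    simp only [Λ, hι, hcf, jetDefect_prolong]
  have hxM : ∀ᶠ z : (Fin h → ℝ) × Jet m n in 𝓝 (0, prolong f x₀),
      xpt (compFlow Φ z.1 z.2) ∈ M := by
    have : ∀ᶠ q : Jet m n in 𝓝 (prolong f x₀), xpt q ∈ M := by
      filter_upwards [D.system.isOpen.mem_nhds hp₀] with q hq using hq.1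
    exact (D.system.tendsto_flowList (List.finRange h) hp₀).eventually this
  have hΛ : ∀ᶠ z in 𝓝 (res S (prolong f x₀), (0 : Fin h → ℝ)), ContDiffAt ℝ ∞ Λ z := by
    filter_upwards [htι.eventually hstay, htι.eventually hxM] with z hz1 hz2
    refine contDiffAt_fst.prodMk (contDiffAt_pi.2 fun k =>
      contDiffAt_jetDefect (γ := fun z : (S → ℝ) × (Fin h → ℝ) => compFlow Φ z.2 (ι z.1))
        D.isOpen D.smooth (fun c => ?_) hz2 k)
    exact D.system.contDiffAt_flowList (γ := fun z : (S → ℝ) × (Fin h → ℝ) => ι z.1)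
      contDiffAt_snd (fun c => ((contDiff_setCoords S _ c).comp contDiff_fst).contDiffAt)
      hz1.defined c
  obtain ⟨Υ, hΥ0, -, hΥΛ, hΛΥ, hΥs⟩ := exists_local_inverse hΛ (D.defect_injective S) rfl
  rw [hΛ0] at hΥ0 hΛΥ hΥs
  have hres : Continuous fun p : Jet m n => (res S p, (0 : Fin h → ℝ)) :=
    (continuous_res S).prodMk continuous_const
  have hres2 : Continuous fun z : (Fin h → ℝ) × Jet m n => (res S z.2, z.1) :=
    ((continuous_res S).comp continuous_snd).prodMk continuous_fst
  have hres3 : Continuous fun z : (Fin h → ℝ) × Jet m n => (z.1, ι (res S z.2)) :=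
    continuous_fst.prodMk ((continuous_setCoords S _).comp ((continuous_res S).comp continuous_snd))
  have ht3 := hres3.tendsto (0, prolong f x₀)
  simp only [hι] at ht3
  have hV := (hstay.and (ht3.eventually hstay)).and
    ((hres2.tendsto (0, prolong f x₀)).eventually hΥΛ)
  rw [nhds_prod_eq, eventually_prod_iff] at hV
  obtain ⟨pB, hB, pW, hW, hBW⟩ := hV
  have hW2 := hW.and ((hres.tendsto (prolong f x₀)).eventually
    (hΛΥ.and hΥs))
  obtain ⟨W, hWsub, hWo, hWm⟩ := mem_nhds_iff.1 hW2
  refine ⟨fun p => (Υ (res S p, 0)).2, {b | pB b}, W, hB, hWo, hWm, fun l => ?_, ?_, ?_⟩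
  · refine ⟨S, fun v => (Υ (v, 0)).2 l, ?_, fun p _ => rfl⟩
    rintro _ ⟨p, hp, rfl⟩
    have e1 : ContDiffAt ℝ ∞ Υ (res S p, 0) := (hWsub hp).2.2
    have e2 : ContDiffAt ℝ ∞ (fun v : S → ℝ => (v, (0 : Fin h → ℝ))) (res S p) :=
      contDiffAt_id.prodMk contDiffAt_const
    exact (contDiffAt_pi.1 (ContDiffAt.snd (ContDiffAt.comp (res S p) e1 e2)) l).contDiffWithinAt
  · simp only [hΥ0]
  · intro p hp b hb
    obtain ⟨⟨hb1, hb2⟩, hb3⟩ := hBW hb (hWsub hp).1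
    -- only the coordinates in `S` matter
    have e1 : jetDefect f ind σ (compFlow Φ b p) =
        jetDefect f ind σ (compFlow Φ b (ι (res S p))) := by
      refine jetDefect_congr fun r => hS' r b _ _ hb1.defined hb2.defined fun c hc => ?_
      have hcS : c ∈ S := Finset.mem_biUnion.2 ⟨r, Finset.mem_univ r, hc⟩
      rw [hιdef, setCoords_apply _ _ hcS]
    have hb4 : Υ (res S p, jetDefect f ind σ (compFlow Φ b (ι (res S p)))) = (res S p, b) := hb3
    have e2 : Λ (Υ (res S p, 0)) = (res S p, 0) := (hWsub hp).2.1
    rw [e1]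
    constructor
    · intro h0
      rw [h0] at hb4
      simp only [hb4]
    · rintro rfl
      have e4 : (Υ (res S p, 0)).1 = res S p := congrArg Prod.fst e2
      have e3 : Υ (res S p, 0) = (res S p, (Υ (res S p, 0)).2) := Prod.ext e4 rfl
      rw [e3] at e2
      exact congrArg Prod.snd e2

end IsGenericPoint

end Times

/-! ### The evolution fields in adapted coordinates -/

section Adapted

variable {Ω : Set (Jet m n)} {G : Fin h → Fin n → Jet m n → ℝ} {lam : Fin h → Fin h → Fin h → ℝ}
  {η : Fin h → Fin m → Jet m n → ℝ} {a : Jet m n → Fin h → ℝ} {X : Set (Fin m → ℝ)}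
  {B : Set (Fin h → ℝ)} {U : Set (Jet m n)} {θ : (Fin m → ℝ) → (Fin h → ℝ) → Jet m n}
  {x₀ : Fin m → ℝ}

/-- The parametrization `θ` of the manifold swept out by the flows, with the functions `a` on an
open set `U` of jets, such that `(x, a)` is inverse to `θ`. The velocities of `θ` lie in the spans
of the frame fields that are stable under the flows involved, and the characteristic field of `G_i`
acts on `a` as `-∂_{a^i}` where `a^1 = ⋯ = a^{i-1} = 0`. -/
structure IsAdapted (Ω : Set (Jet m n)) (G : Fin h → Fin n → Jet m n → ℝ)
    (lam : Fin h → Fin h → Fin h → ℝ) (η : Fin h → Fin m → Jet m n → ℝ)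
    (a : Jet m n → Fin h → ℝ) (X : Set (Fin m → ℝ)) (B : Set (Fin h → ℝ)) (U : Set (Jet m n))
    (θ : (Fin m → ℝ) → (Fin h → ℝ) → Jet m n) : Prop where
  isOpen_X : IsOpen X
  convex_X : Convex ℝ X
  isOpen_B : IsOpen B
  isOpen_U : IsOpen U
  subset : U ⊆ Ω
  smooth_gen : ∀ i j, IsSmoothOn U (G i j)
  bracket_eq : ∀ i j s, ∀ p ∈ U, bracket (G i) (G j) s p = ∑ k, lam i j k * G k s p
  smooth_a : ∀ l, IsSmoothOn U (fun p => a p l)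
  smooth_θ : ∀ y ∈ X, ∀ b ∈ B, ∀ c,
    ContDiffAt ℝ ∞ (fun z : (Fin m → ℝ) × (Fin h → ℝ) => θ z.1 z.2 c) (y, b)
  mem : ∀ y ∈ X, ∀ b ∈ B, θ y b ∈ U
  x_eq : ∀ y ∈ X, ∀ b ∈ B, xpt (θ y b) = y
  a_eq : ∀ y ∈ X, ∀ b ∈ B, a (θ y b) = b
  inSpan : ∀ y ∈ X, ∀ b ∈ B, ∀ (R : Set (Fin m ⊕ Fin h)) (v : (Fin m → ℝ) × (Fin h → ℝ)),
    (∀ l, Sum.inl l ∈ R) →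
    (∀ j, b j = 0 ∨ ∀ k ∈ R, ∀ l ∉ R, ∀ p ∈ Ω, bracketCoeff G lam η j k l p = 0) →
    (∀ j, v.2 j = 0 ∨ Sum.inr j ∈ R) →
    InSpan G R (θ y b) (fun c =>
      fderiv ℝ (fun z : (Fin m → ℝ) × (Fin h → ℝ) => θ z.1 z.2 c) (y, b) v)
  act_charField : ∀ y ∈ X, ∀ b ∈ B, ∀ i, (∀ j, j < i → b j = 0) → ∀ l,
    act (charField (G i) (η i)) (fun p => a p l) (θ y b) = -(if l = i then 1 else 0)

theorem fderiv_fst_apply (l : Fin m) (z v : (Fin m → ℝ) × (Fin h → ℝ)) :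
    fderiv ℝ (fun z : (Fin m → ℝ) × (Fin h → ℝ) => z.1 l) z v = v.1 l := by
  rw [HasFDerivAt.fderiv (f := fun z : (Fin m → ℝ) × (Fin h → ℝ) => z.1 l)
    ((ContinuousLinearMap.proj (R := ℝ) (φ := fun _ : Fin m => ℝ) l).comp
      (ContinuousLinearMap.fst ℝ (Fin m → ℝ) (Fin h → ℝ))).hasFDerivAt]
  rfl

theorem fderiv_snd_apply (l : Fin h) (z v : (Fin m → ℝ) × (Fin h → ℝ)) :
    fderiv ℝ (fun z : (Fin m → ℝ) × (Fin h → ℝ) => z.2 l) z v = v.2 l := by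
  rw [HasFDerivAt.fderiv (f := fun z : (Fin m → ℝ) × (Fin h → ℝ) => z.2 l)
    ((ContinuousLinearMap.proj (R := ℝ) (φ := fun _ : Fin h => ℝ) l).comp
      (ContinuousLinearMap.snd ℝ (Fin m → ℝ) (Fin h → ℝ))).hasFDerivAt]
  rfl

namespace IsAdapted

variable (A : IsAdapted Ω G lam η a X B U θ)
include A

/-- The velocity of `θ` in terms of the frame; the coefficients of the fields `D_l` are given by
the motion of the base point. -/
theorem exists_velocity {y : Fin m → ℝ} (hy : y ∈ X) {b : Fin h → ℝ} (hb : b ∈ B)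
    {R : Set (Fin m ⊕ Fin h)} (hRD : ∀ l, Sum.inl l ∈ R) (v : (Fin m → ℝ) × (Fin h → ℝ))
    (hR : ∀ j, b j = 0 ∨ ∀ k ∈ R, ∀ l ∉ R, ∀ p ∈ Ω, bracketCoeff G lam η j k l p = 0)
    (hR' : ∀ j, v.2 j = 0 ∨ Sum.inr j ∈ R) :
    ∃ C : Fin h → ℝ, (∀ r, Sum.inr r ∉ R → C r = 0) ∧
      ∀ c, fderiv ℝ (fun z : (Fin m → ℝ) × (Fin h → ℝ) => θ z.1 z.2 c) (y, b) v =
        ∑ l, v.1 l * totalD l c (θ y b) + ∑ r, C r * evol (G r) c (θ y b) := by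
  obtain ⟨α, hα, hθ⟩ := A.inSpan y hy b hb R v hRD hR hR'
  refine ⟨fun r => α (Sum.inr r), fun r hr => hα _ hr, fun c => ?_⟩
  have hx : ∀ l, α (Sum.inl l) = v.1 l := by
    intro l
    have e1 : (fun z : (Fin m → ℝ) × (Fin h → ℝ) => θ z.1 z.2 (Sum.inl l)) =ᶠ[𝓝 (y, b)]
        fun z => z.1 l := by
      filter_upwards [(A.isOpen_X.prod A.isOpen_B).mem_nhds ⟨hy, hb⟩] with z hz
      exact congrFun (A.x_eq _ hz.1 _ hz.2) l
    have e2 := hθ (Sum.inl l)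
    simp only [e1.fderiv_eq, fderiv_fst_apply, Fintype.sum_sum_type, frame, Sum.elim_inl,
      Sum.elim_inr, totalD, evol, mul_ite, mul_one, mul_zero, Finset.sum_const_zero, add_zero,
      Finset.sum_ite_eq, Finset.mem_univ, if_true] at e2
    exact e2.symm
  refine (hθ c).trans ?_
  rw [Fintype.sum_sum_type]
  simp only [hx]
  rfl

theorem fderiv_comp {g : Jet m n → ℝ} (hg : IsSmoothOn U g) {y : Fin m → ℝ} (hy : y ∈ X)
    {b : Fin h → ℝ} (hb : b ∈ B) (v : (Fin m → ℝ) × (Fin h → ℝ)) :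
    fderiv ℝ (fun z : (Fin m → ℝ) × (Fin h → ℝ) => g (θ z.1 z.2)) (y, b) v =
      dirDeriv g (θ y b) (fun c =>
        fderiv ℝ (fun z : (Fin m → ℝ) × (Fin h → ℝ) => θ z.1 z.2 c) (y, b) v) :=
  hg.fderiv_comp A.isOpen_U (γ := fun z : (Fin m → ℝ) × (Fin h → ℝ) => θ z.1 z.2)
    (A.smooth_θ y hy b hb) (A.mem y hy b hb) v

theorem contDiffAt_comp {g : Jet m n → ℝ} (hg : IsSmoothOn U g) {y : Fin m → ℝ} (hy : y ∈ X)
    {b : Fin h → ℝ} (hb : b ∈ B) :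
    ContDiffAt ℝ ∞ (fun z : (Fin m → ℝ) × (Fin h → ℝ) => g (θ z.1 z.2)) (y, b) :=
  hg.contDiffAt_comp A.isOpen_U (γ := fun z : (Fin m → ℝ) × (Fin h → ℝ) => θ z.1 z.2)
    (A.smooth_θ y hy b hb) (A.mem y hy b hb)

/-- Along `θ`, the total derivatives are the partial derivatives by the base point. -/
theorem fderiv_base {g : Jet m n → ℝ} (hg : IsSmoothOn U g) {y : Fin m → ℝ} (hy : y ∈ X)
    {b : Fin h → ℝ} (hb : b ∈ B) (i : Fin m) :
    fderiv ℝ (fun z : (Fin m → ℝ) × (Fin h → ℝ) => g (θ z.1 z.2)) (y, b) (Pi.single i 1, 0) =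
      act (totalD i) g (θ y b) := by
  obtain ⟨C, hC, hθ⟩ := A.exists_velocity hy hb (R := range Sum.inl) (fun l => ⟨l, rfl⟩)
    (Pi.single i 1, 0) (fun j => Or.inr (by
      rintro _ ⟨k, rfl⟩ (l | s) hl p -
      · exact absurd ⟨l, rfl⟩ hl
      · rfl)) (fun j => Or.inl rfl)
  have hC0 : ∀ r, C r = 0 := fun r => hC r (by simp)
  rw [A.fderiv_comp hg hy hb]
  simp only [hθ, hC0, zero_mul, Finset.sum_const_zero, add_zero, Pi.single_apply, ite_mul, one_mul,
    Finset.sum_ite_eq', Finset.mem_univ, if_true]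
  rfl

theorem fderiv_slice {g : Jet m n → ℝ} (hg : IsSmoothOn U g) {y : Fin m → ℝ} (hy : y ∈ X)
    {b : Fin h → ℝ} (hb : b ∈ B) (v : Fin h → ℝ) :
    fderiv ℝ (fun b' => g (θ y b')) b v =
      fderiv ℝ (fun z : (Fin m → ℝ) × (Fin h → ℝ) => g (θ z.1 z.2)) (y, b) (0, v) := by
  have e1 := HasFDerivAt.comp (g := fun z : (Fin m → ℝ) × (Fin h → ℝ) => g (θ z.1 z.2))
    (f := fun b' => (y, b')) b
    ((A.contDiffAt_comp hg hy hb).differentiableAt (by simp)).hasFDerivAt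
    (hasFDerivAt_prodMk_right y b)
  rw [HasFDerivAt.fderiv (f := fun b' => g (θ y b')) e1]
  rfl

/-- The functions `a` are constant along the total derivatives on the image of `θ`. -/
theorem act_totalD_a {y : Fin m → ℝ} (hy : y ∈ X) {b : Fin h → ℝ} (hb : b ∈ B) (i : Fin m)
    (l : Fin h) : act (totalD i) (fun p => a p l) (θ y b) = 0 := by
  rw [← A.fderiv_base (A.smooth_a l) hy hb]
  have e1 : (fun z : (Fin m → ℝ) × (Fin h → ℝ) => a (θ z.1 z.2) l) =ᶠ[𝓝 (y, b)]
      fun z => z.2 l := by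
    filter_upwards [(A.isOpen_X.prod A.isOpen_B).mem_nhds ⟨hy, hb⟩] with z hz
    rw [A.a_eq _ hz.1 _ hz.2]
  rw [e1.fderiv_eq, fderiv_snd_apply]
  rfl

theorem isSmoothOn_act_evol (i : Fin h) {g : Jet m n → ℝ} (hg : IsSmoothOn U g) :
    IsSmoothOn U (act (evol (G i)) g) :=
  hg.act A.isOpen_U (isSmoothOn_evol A.isOpen_U (A.smooth_gen i))

/-- The matrix of the partial derivatives `∂_{a^l} θ` with respect to the evolution fields is
inverse to the matrix of the functions `V_{G_i}(a^l)`. -/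
theorem exists_velocity_matrix {y : Fin m → ℝ} (hy : y ∈ X) {b : Fin h → ℝ} (hb : b ∈ B) :
    ∃ C : Matrix (Fin h) (Fin h) ℝ,
      (∀ l c, fderiv ℝ (fun z : (Fin m → ℝ) × (Fin h → ℝ) => θ z.1 z.2 c) (y, b)
        (0, Pi.single l 1) = ∑ r, C l r * evol (G r) c (θ y b)) ∧
      C * Matrix.of (fun i l => act (evol (G i)) (fun p => a p l) (θ y b)) = 1 ∧
      ∀ k : Fin h, (∀ p q s, k ≤ p → k ≤ q → s < k → lam p q s = 0) → (∀ j, j < k → b j = 0) →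
        ∀ l r, k ≤ l → r < k → C l r = 0 := by
  have hall : ∀ l, ∃ C : Fin h → ℝ, ∀ c,
      fderiv ℝ (fun z : (Fin m → ℝ) × (Fin h → ℝ) => θ z.1 z.2 c) (y, b) (0, Pi.single l 1) =
        ∑ r, C r * evol (G r) c (θ y b) := by
    intro l
    obtain ⟨C, -, hθ⟩ := A.exists_velocity hy hb (R := univ) (fun l => mem_univ _)
      (0, Pi.single l 1) (fun j => Or.inr fun _ _ l hl => absurd (mem_univ l) hl)
      (fun j => Or.inr (mem_univ _))
    exact ⟨C, fun c => by simpa using hθ c⟩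
  choose C hC using hall
  have hmul : ∀ C' : Fin h → ℝ, ∀ l, (∀ c, fderiv ℝ (fun z : (Fin m → ℝ) × (Fin h → ℝ) =>
      θ z.1 z.2 c) (y, b) (0, Pi.single l 1) = ∑ r, C' r * evol (G r) c (θ y b)) → ∀ k,
      ∑ r, C' r * act (evol (G r)) (fun p => a p k) (θ y b) = if l = k then 1 else 0 := by
    intro C' l hC' k
    have e1 := A.fderiv_comp (A.smooth_a k) hy hb (0, Pi.single l 1)
    simp only [hC'] at e1
    rw [dirDeriv_sum_right A.isOpen_U (A.mem y hy b hb) (A.smooth_a k)] at e1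
    have e2 : (fun z : (Fin m → ℝ) × (Fin h → ℝ) => a (θ z.1 z.2) k) =ᶠ[𝓝 (y, b)]
        fun z => z.2 k := by
      filter_upwards [(A.isOpen_X.prod A.isOpen_B).mem_nhds ⟨hy, hb⟩] with z hz
      rw [A.a_eq _ hz.1 _ hz.2]
    rw [e2.fderiv_eq, fderiv_snd_apply] at e1
    simp only [act_eq_dirDeriv]
    rw [← e1]
    simp [Pi.single_apply, eq_comm]
  have hCF : Matrix.of C *
      Matrix.of (fun i l => act (evol (G i)) (fun p => a p l) (θ y b)) = 1 := by
    ext l k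
    simp only [Matrix.mul_apply, Matrix.of_apply, hmul _ _ (hC l) k, Matrix.one_apply]
  refine ⟨Matrix.of C, hC, hCF, fun k hlam hbk l r hl hr => ?_⟩
  let R : Set (Fin m ⊕ Fin h) := range Sum.inl ∪ {k' | ∃ r, k ≤ r ∧ k' = Sum.inr r}
  have hR : ∀ j, b j = 0 ∨ ∀ k ∈ R, ∀ l ∉ R, ∀ p ∈ Ω, bracketCoeff G lam η j k l p = 0 := by
    intro j
    rcases lt_or_ge j k with hj | hj
    · exact Or.inl (hbk j hj)
    · refine Or.inr ?_
      rintro k' hk' (l | s) hl p -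
      · exact absurd (Or.inl ⟨l, rfl⟩) hl
      · have hs : s < k := by
          by_contra hs
          exact hl (Or.inr ⟨s, not_lt.1 hs, rfl⟩)
        rcases hk' with ⟨l, rfl⟩ | ⟨r, hr, rfl⟩
        · rfl
        · exact hlam j r s hj hr hs
  have hR' : ∀ j, (Pi.single l 1 : Fin h → ℝ) j = 0 ∨ Sum.inr j ∈ R := by
    intro j
    by_cases hj : j = l
    · exact Or.inr (Or.inr ⟨l, hl, by rw [hj]⟩)
    · exact Or.inl (by simp [hj])
  obtain ⟨C', hC'0, hC'⟩ := A.exists_velocity hy hb (fun l => Or.inl ⟨l, rfl⟩)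
    (0, Pi.single l 1) hR hR'
  -- the coefficients are unique, as they form a left inverse of a square matrix
  have e1 : ∀ k, ∑ r, C' r * act (evol (G r)) (fun p => a p k) (θ y b) =
      ∑ r, C l r * act (evol (G r)) (fun p => a p k) (θ y b) := fun k => by
    rw [hmul _ _ (hC l), hmul C' l (fun c => by simpa using hC' c)]
  have e2 : Matrix.vecMul C'
      (Matrix.of (fun i l => act (evol (G i)) (fun p => a p l) (θ y b))) =
      Matrix.vecMul (C l)
      (Matrix.of (fun i l => act (evol (G i)) (fun p => a p l) (θ y b))) := funext e1
  have e3 : C' = C l := by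
    have := congrArg (fun w => Matrix.vecMul w (Matrix.of C)) e2
    simpa [Matrix.vecMul_vecMul, mul_eq_one_comm.1 hCF] using this
  rw [Matrix.of_apply, ← e3]
  refine hC'0 r ?_
  rintro (⟨l, hl⟩ | ⟨r', hr', hrr'⟩)
  · exact absurd hl (by simp)
  · obtain rfl := Sum.inr.inj hrr'
    exact absurd hr (not_lt.2 hr')

/-- The evolution fields are tangent to the image of `θ`. -/
theorem act_evol_eq_sum (i : Fin h) {g : Jet m n → ℝ} (hg : IsSmoothOn U g) {y : Fin m → ℝ}
    (hy : y ∈ X) {b : Fin h → ℝ} (hb : b ∈ B) :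
    act (evol (G i)) g (θ y b) = ∑ l, act (evol (G i)) (fun p => a p l) (θ y b) *
      fderiv ℝ (fun b' => g (θ y b')) b (Pi.single l 1) := by
  obtain ⟨C, hC, hCF, -⟩ := A.exists_velocity_matrix hy hb
  set F := Matrix.of (fun i l => act (evol (G i)) (fun p => a p l) (θ y b)) with hF
  have hFC : F * C = 1 := mul_eq_one_comm.1 hCF
  have e1 : ∀ l, fderiv ℝ (fun b' => g (θ y b')) b (Pi.single l 1) =
      ∑ r, C l r * act (evol (G r)) g (θ y b) := by
    intro l
    rw [A.fderiv_slice hg hy hb, A.fderiv_comp hg hy hb]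
    simp only [hC]
    rw [dirDeriv_sum_right A.isOpen_U (A.mem y hy b hb) hg]
    rfl
  have e2 : ∀ r, ∑ l, F i l * C l r = if i = r then 1 else 0 := fun r => by
    rw [← Matrix.mul_apply, hFC, Matrix.one_apply]
  calc act (evol (G i)) g (θ y b) = ∑ r, (∑ l, F i l * C l r) * act (evol (G r)) g (θ y b) := by
        simp [e2]
    _ = ∑ l, F i l * ∑ r, C l r * act (evol (G r)) g (θ y b) := by
        simp only [Finset.sum_mul, Finset.mul_sum, mul_assoc]
        exact Finset.sum_comm
    _ = _ := by simp only [e1]; rfl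

/-- The functions `V_{G_i}(a^l)` do not depend on the base point. Indeed, the fields `V_{G_i}` are
tangent to the image of `θ`, where `D_k(a^l) = 0`, and commute with `D_k`. -/
theorem act_evol_a_eq (i l : Fin h) {y y' : Fin m → ℝ} (hy : y ∈ X) (hy' : y' ∈ X)
    {b : Fin h → ℝ} (hb : b ∈ B) :
    act (evol (G i)) (fun p => a p l) (θ y b) = act (evol (G i)) (fun p => a p l) (θ y' b) := by
  have hF := A.isSmoothOn_act_evol i (A.smooth_a l)
  have key : ∀ y ∈ X, HasFDerivAt (fun y => act (evol (G i)) (fun p => a p l) (θ y b))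
      (0 : (Fin m → ℝ) →L[ℝ] ℝ) y := by
    intro y hy
    have e1 := HasFDerivAt.comp (g := fun z : (Fin m → ℝ) × (Fin h → ℝ) =>
      act (evol (G i)) (fun p => a p l) (θ z.1 z.2)) (f := fun y => (y, b)) y
      ((A.contDiffAt_comp hF hy hb).differentiableAt (by simp)).hasFDerivAt
      (hasFDerivAt_prodMk_left y b)
    refine HasFDerivAt.congr_fderiv e1 ?_
    refine ContinuousLinearMap.coe_injective (LinearMap.pi_ext' fun k => LinearMap.ext_ring ?_)
    have e2 := A.fderiv_base hF hy hb k
    have hD : IsSmoothOn U (act (totalD k) fun p => a p l) := (A.smooth_a l).act_totalD A.isOpen_U k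
    have e3 : (fun b' => act (totalD k) (fun p => a p l) (θ y b')) =ᶠ[𝓝 b] fun _ => (0 : ℝ) := by
      filter_upwards [A.isOpen_B.mem_nhds hb] with b' hb' using A.act_totalD_a hy hb' k l
    rw [← act_evol_totalD_comm A.isOpen_U (A.smooth_gen i) k (A.smooth_a l) (A.mem y hy b hb),
      A.act_evol_eq_sum i hD hy hb] at e2
    simp only [e3.fderiv_eq, fderiv_fun_const] at e2
    simpa using! e2
  refine A.isOpen_X.is_const_of_fderiv_eq_zero A.convex_X.isPreconnected
    (fun y hy => (key y hy).differentiableAt.differentiableWithinAt)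
    (fun y hy => (key y hy).fderiv) hy hy'

/-- The value of `V_{G_i}(a^l)` where `a^1 = ⋯ = a^{i-1} = 0`. -/
theorem act_evol_a_of_zero (i l : Fin h) {y : Fin m → ℝ} (hy : y ∈ X) {b : Fin h → ℝ} (hb : b ∈ B)
    (hbi : ∀ j, j < i → b j = 0) :
    act (evol (G i)) (fun p => a p l) (θ y b) = -(if l = i then 1 else 0) := by
  rw [← A.act_charField y hy b hb i hbi l,
    InfJet.act_charField A.isOpen_U (G i) (η i) (A.smooth_a l) (A.mem y hy b hb)]
  simp [A.act_totalD_a hy hb]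

/-- If the last generators span a subalgebra, then their fields do not move the first flow times,
where these vanish. -/
theorem act_evol_a_eq_zero {i k r : Fin h} (hk : k ≤ i) (hr : r < k)
    (hlam : ∀ p q s, k ≤ p → k ≤ q → s < k → lam p q s = 0) {y : Fin m → ℝ} (hy : y ∈ X)
    {b : Fin h → ℝ} (hb : b ∈ B) (hbk : ∀ j, j < k → b j = 0) :
    act (evol (G i)) (fun p => a p r) (θ y b) = 0 := by
  obtain ⟨C, -, hCF, hC0⟩ := A.exists_velocity_matrix hy hb
  set F := Matrix.of (fun i l => act (evol (G i)) (fun p => a p l) (θ y b)) with hF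
  have hCt : C.BlockTriangular (fun j => if k ≤ j then (1 : ℕ) else 0) := by
    intro l r hlr
    by_cases h1 : k ≤ l <;> by_cases h2 : k ≤ r <;> simp [h1, h2] at hlr
    exact hC0 k hlam hbk l r h1 (not_le.1 h2)
  have : Invertible C := invertibleOfRightInverse C F hCF
  have hFt := Matrix.blockTriangular_inv_of_blockTriangular hCt
  rw [Matrix.inv_eq_right_inv hCF] at hFt
  exact hFt (i := i) (j := r) (by simp [hk, hr])

section Coefficients

variable {φ : Fin h → Fin h → (Fin h → ℝ) → ℝ} (hx₀ : x₀ ∈ X)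
  (hφ : ∀ i l, ∀ b ∈ B, φ i l b = act (evol (G i)) (fun p => a p l) (θ x₀ b))
include hx₀ hφ

theorem contDiffAt_coeff (i l : Fin h) {b : Fin h → ℝ} (hb : b ∈ B) :
    ContDiffAt ℝ ∞ (φ i l) b := by
  have e1 := (A.isSmoothOn_act_evol i (A.smooth_a l)).contDiffAt_comp A.isOpen_U (γ := θ x₀)
    (z := b) (fun c => ContDiffAt.comp (g := fun z : (Fin m → ℝ) × (Fin h → ℝ) => θ z.1 z.2 c)
      (f := fun b => (x₀, b)) b (A.smooth_θ x₀ hx₀ b hb c)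
      (contDiffAt_const.prodMk contDiffAt_id)) (A.mem x₀ hx₀ b hb)
  refine e1.congr_of_eventuallyEq ?_
  filter_upwards [A.isOpen_B.mem_nhds hb] with b' hb' using hφ i l b' hb'

/-- In the coordinates `(x, a)`, the evolution fields are the fields `∑ φ^l_i ∂_{a^l}`. -/
theorem act_evol_eq_coeff (i : Fin h) {g : Jet m n → ℝ} (hg : IsSmoothOn U g) {y : Fin m → ℝ}
    (hy : y ∈ X) {b : Fin h → ℝ} (hb : b ∈ B) :
    act (evol (G i)) g (θ y b) =
      ∑ l, φ i l b * fderiv ℝ (fun b' => g (θ y b')) b (Pi.single l 1) := by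
  rw [A.act_evol_eq_sum i hg hy hb]
  simp only [hφ i _ b hb, A.act_evol_a_eq i _ hy hx₀ hb]

theorem coeff_of_zero (i l : Fin h) {b : Fin h → ℝ} (hb : b ∈ B) (hbi : ∀ j, j < i → b j = 0) :
    φ i l b = -(if l = i then 1 else 0) := by
  rw [hφ i l b hb, A.act_evol_a_of_zero i l hx₀ hb hbi]

theorem coeff_eq_zero {i k r : Fin h} (hk : k ≤ i) (hr : r < k)
    (hlam : ∀ p q s, k ≤ p → k ≤ q → s < k → lam p q s = 0)
    {b : Fin h → ℝ} (hb : b ∈ B) (hbk : ∀ j, j < k → b j = 0) : φ i r b = 0 := by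
  rw [hφ i r b hb, A.act_evol_a_eq_zero hk hr hlam hx₀ hb hbk]

/-- The commutator relations of the fields `∑ φ^l_i ∂_{a^l}`. -/
theorem coeff_bracket (i k l : Fin h) {b : Fin h → ℝ} (hb : b ∈ B) :
    ∑ r, φ k r b * fderiv ℝ (φ i l) b (Pi.single r 1) -
      ∑ r, φ i r b * fderiv ℝ (φ k l) b (Pi.single r 1) = ∑ p, lam k i p * φ p l b := by
  have e1 := act_evol_evol_sub A.isOpen_U A.smooth_gen A.bracket_eq k i (A.smooth_a l)
    (A.mem x₀ hx₀ b hb)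
  have e2 : ∀ j l, (fun b' => act (evol (G j)) (fun p => a p l) (θ x₀ b')) =ᶠ[𝓝 b] φ j l := by
    intro j l
    filter_upwards [A.isOpen_B.mem_nhds hb] with b' hb' using (hφ j l b' hb').symm
  rw [A.act_evol_eq_coeff hx₀ hφ k (A.isSmoothOn_act_evol i (A.smooth_a l)) hx₀ hb,
    A.act_evol_eq_coeff hx₀ hφ i (A.isSmoothOn_act_evol k (A.smooth_a l)) hx₀ hb] at e1
  simp only [(e2 _ _).fderiv_eq, ← hφ _ _ b hb] at e1
  exact e1

/-- The recursive system for the coefficients: the coefficients `φ^l_k` are constant, and all but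
one of them zero, where `a^1 = ⋯ = a^{k-1} = 0`. -/
theorem fderiv_coeff (i k l : Fin h) {b : Fin h → ℝ} (hb : b ∈ B) (hbk : ∀ j, j < k → b j = 0) :
    fderiv ℝ (φ i l) b (Pi.single k 1) = -(∑ p, lam k i p * φ p l b) -
      ∑ r with r ≠ k, φ i r b * fderiv ℝ (φ k l) b (Pi.single r 1) := by
  have e1 := A.coeff_bracket hx₀ hφ i k l hb
  have e2 : fderiv ℝ (φ k l) b (Pi.single k 1) = 0 := by
    have e3 : HasFDerivAt (φ k l) (fderiv ℝ (φ k l) b) (b + (0 : ℝ) • Pi.single k 1) := by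
      simpa using ((A.contDiffAt_coeff hx₀ hφ k l hb).differentiableAt (by simp)).hasFDerivAt
    have hl : HasDerivAt (fun ε : ℝ => b + ε • (Pi.single k 1 : Fin h → ℝ)) (Pi.single k 1) 0 :=
      hasDerivAt_line _
    have e4 := e3.comp_hasDerivAt (0 : ℝ) hl
    refine e4.unique ((hasDerivAt_const (0 : ℝ) (-(if l = k then (1 : ℝ) else 0))
      ).congr_of_eventuallyEq ?_)
    have hc : Continuous fun ε : ℝ => b + ε • (Pi.single k 1 : Fin h → ℝ) := by fun_prop
    filter_upwards [hc.continuousAt.preimage_mem_nhds (x := 0)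
      (A.isOpen_B.mem_nhds (by simpa using hb))] with ε hε
    refine A.coeff_of_zero hx₀ hφ k l hε fun j hj => ?_
    simp [hbk j hj, hj.ne]
  have e5 : ∑ r, φ k r b * fderiv ℝ (φ i l) b (Pi.single r 1) =
      -fderiv ℝ (φ i l) b (Pi.single k 1) := by
    simp [A.coeff_of_zero hx₀ hφ k _ hb hbk]
  have e6 : ∑ r, φ i r b * fderiv ℝ (φ k l) b (Pi.single r 1) =
      ∑ r with r ≠ k, φ i r b * fderiv ℝ (φ k l) b (Pi.single r 1) := by
    rw [Finset.sum_filter]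
    refine Finset.sum_congr rfl fun r _ => ?_
    by_cases hr : r = k
    · simp [hr, e2]
    · simp [hr]
  rw [e5, e6] at e1
  linarith

theorem fderiv_coeff_of_subalgebra {i k : Fin h} (l : Fin h) (hk : k ≤ i)
    (hlam : ∀ p q s, k ≤ p → k ≤ q → s < k → lam p q s = 0) {b : Fin h → ℝ} (hb : b ∈ B)
    (hbk : ∀ j, j < k → b j = 0) :
    fderiv ℝ (φ i l) b (Pi.single k 1) = -(∑ p, lam k i p * φ p l b) -
      ∑ r with k < r, φ i r b * fderiv ℝ (φ k l) b (Pi.single r 1) := by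
  rw [A.fderiv_coeff hx₀ hφ i k l hb hbk]
  congr 1
  refine (Finset.sum_subset (fun r hr => ?_) fun r hr hr' => ?_).symm
  · simp only [Finset.mem_filter, Finset.mem_univ, true_and] at hr ⊢
    exact hr.ne'
  · simp only [Finset.mem_filter, Finset.mem_univ, true_and, not_lt] at hr hr'
    rw [A.coeff_eq_zero hx₀ hφ hk (lt_of_le_of_ne hr' hr) hlam hb hbk, zero_mul]

end Coefficients

end IsAdapted

end Adapted

/-! ### Construction of the adapted coordinates -/

section Construction

variable {M : Set (Fin m → ℝ)} {N : Set (Fin n → ℝ)} {f : (Fin m → ℝ) → Fin n → ℝ}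
  {G : Fin h → Fin n → Jet m n → ℝ} {lam : Fin h → Fin h → Fin h → ℝ}
  {η : Fin h → Fin m → Jet m n → ℝ} {E : Fin h → Set (ℝ × Jet m n)}
  {Φ : Fin h → ℝ → Jet m n → Jet m n} {Ω₀ : Set (Jet m n)} {ind : Fin h → Fin n}
  {σ : Fin h → Fin m → ℕ} {T : Fin m ⊕ Fin h → Fin m ⊕ Fin h → Jet m n → ℝ} {x₀ : Fin m → ℝ}

theorem flowList_congr {b b' : Fin h → ℝ} {L : List (Fin h)} (hb : ∀ k ∈ L, b k = b' k)
    (p : Jet m n) : flowList Φ b L p = flowList Φ b' L p := by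
  induction L generalizing p with
  | nil => rfl
  | cons k ks ih =>
    rw [flowList, flowList, hb k (by simp)]
    exact ih (fun j hj => hb j (by simp [hj])) _

theorem flowListDefined.of_append {b : Fin h → ℝ} {L L' : List (Fin h)} {p : Jet m n}
    (hL : flowListDefined E Φ b (L ++ L') p) : flowListDefined E Φ b L' (flowList Φ b L p) := by
  induction L generalizing p with
  | nil => exact hL
  | cons k ks ih => exact ih hL.2

/-- The derivative of a composition of flows by the time of its `i`-th factor, if the times of all
later factors are zero. -/
theorem IsFlowSystem.hasDerivAt_flowList {Ω : Set (Jet m n)} (H : IsFlowSystem Ω G lam η E Φ)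
    {b : Fin h → ℝ} {L L' : List (Fin h)} {i : Fin h} (hL : ∀ k ∈ L, k ≠ i)
    (hL' : ∀ k ∈ L', k ≠ i ∧ b k = 0) {p : Jet m n}
    (hdef : flowListDefined E Φ b (L ++ i :: L') p) (c : Coord m n) :
    HasDerivAt (fun t : ℝ => flowList Φ (b + t • Pi.single i 1) (L ++ i :: L') p c)
      (charField (G i) (η i) c (flowList Φ b (L ++ i :: L') p)) 0 := by
  set q := flowList Φ b L p with hq
  have hq0 : (b i, q) ∈ E i := hdef.of_append.1
  have key : ∀ t : ℝ, (b i + t, q) ∈ E i →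
      flowList Φ (b + t • Pi.single i 1) (L ++ i :: L') p = Φ i (b i + t) q := by
    intro t ht
    rw [flowList_append, flowList_congr (b' := b) (L := L) fun k hk => by simp [hL k hk], ← hq,
      flowList]
    simp only [Pi.add_apply, Pi.smul_apply, Pi.single_eq_same, smul_eq_mul, mul_one]
    exact H.flowList_of_zero ((H.flow i).target _ _ ht) fun k hk => by simp [hL' k hk]
  have h0 : flowList Φ b (L ++ i :: L') p = Φ i (b i) q := by simpa using key 0 (by simpa using hq0)
  rw [h0]
  have e1 : HasDerivAt (fun t : ℝ => b i + t) 1 0 := (hasDerivAt_id (0 : ℝ)).const_add _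
  have e2 := HasDerivAt.comp_of_eq (0 : ℝ) ((H.flow i).deriv _ _ hq0 c) e1 (by simp)
  refine HasDerivAt.congr_of_eventuallyEq (e2.congr_deriv (mul_one _)) ?_
  have hc : Continuous fun t : ℝ => (b i + t, q) := by fun_prop
  filter_upwards [hc.continuousAt.preimage_mem_nhds (x := 0)
    ((H.flow i).isOpen.mem_nhds (by simpa using hq0))] with t ht
  rw [key t ht]
  rfl

variable (D : IsGenericPoint M N f G lam η E Φ Ω₀ ind σ T x₀)
include D

namespace IsGenericPoint

/-- Where the first flow times vanish, the `i`-th of them moves the point `backFlow Φ f z` along the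
characteristic field of `G_i`. -/
theorem hasDerivAt_backFlow {z : (Fin m → ℝ) × (Fin h → ℝ)} {i : Fin h}
    (hzi : ∀ j, j < i → z.2 j = 0)
    (hz : flowListDefined E Φ (-z.2) (List.finRange h).reverse (prolong f z.1)) (c : Coord m n) :
    HasDerivAt (fun t : ℝ => backFlow Φ f (z.1, z.2 - t • Pi.single i 1) c)
      (charField (G i) (η i) c (backFlow Φ f z)) 0 := by
  obtain ⟨L, L', hLL⟩ := List.append_of_mem (List.mem_reverse.2 (List.mem_finRange i))
  have hsort : (List.finRange h).reverse.Pairwise (fun j k => k < j) :=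
    List.pairwise_reverse.2 (List.pairwise_lt_finRange h)
  rw [hLL, List.pairwise_append, List.pairwise_cons] at hsort
  have hfun : (fun t : ℝ => backFlow Φ f (z.1, z.2 - t • Pi.single i 1) c) = fun t : ℝ =>
      flowList Φ (-z.2 + t • Pi.single i 1) (L ++ i :: L') (prolong f z.1) c := by
    funext t
    rw [backFlow, hLL]
    simp only [sub_eq_neg_add, neg_add_rev, neg_neg]
  have hback : backFlow Φ f z = flowList Φ (-z.2) (L ++ i :: L') (prolong f z.1) := by
    rw [backFlow, hLL]
  rw [hfun, hback]
  rw [hLL] at hz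
  refine D.system.hasDerivAt_flowList (fun k hk => (hsort.2.2 k hk i (by simp)).ne')
    (fun k hk => ?_) hz c
  have hki := hsort.2.1.1 k hk
  exact ⟨hki.ne, by simp [hzi k hki]⟩

/-- Near the base point, the inverse flows are parametrized by the base point of their values and
the flow times. -/
theorem exists_reparametrization :
    ∃ Υ : (Fin m → ℝ) × (Fin h → ℝ) → (Fin m → ℝ) × (Fin h → ℝ),
      Tendsto Υ (𝓝 (x₀, 0)) (𝓝 (x₀, 0)) ∧
      (∀ᶠ z in 𝓝 (x₀, 0), Υ (xpt (backFlow Φ f z), z.2) = z) ∧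
      (∀ᶠ w in 𝓝 (x₀, 0), (xpt (backFlow Φ f (Υ w)), (Υ w).2) = w) ∧
      ∀ᶠ w in 𝓝 (x₀, 0), ContDiffAt ℝ ∞ Υ w := by
  have hΞ : ∀ {z}, (∀ c, ContDiffAt ℝ ∞ (fun z => backFlow Φ f z c) z) →
      ContDiffAt ℝ ∞ (fun z => (xpt (backFlow Φ f z), z.2)) z := fun hz =>
    (contDiffAt_pi.2 fun l => hz (Sum.inl l)).prodMk contDiffAt_snd
  have h0 := D.eventually_contDiffAt_backFlow.self_of_nhds
  have hΞ0 : (xpt (backFlow Φ f (x₀, 0)), (0 : Fin h → ℝ)) = (x₀, 0) := by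
    rw [D.backFlow_zero D.mem, xpt_prolong]
  obtain ⟨Υ, -, h1, h2, h3, h4⟩ := exists_local_inverse
    (Λ := fun z : (Fin m → ℝ) × (Fin h → ℝ) => (xpt (backFlow Φ f z), z.2)) (a := (x₀, 0))
    (D.eventually_contDiffAt_backFlow.mono fun z hz => hΞ hz) (fun v hv => by
      have e1 : HasFDerivAt (fun z : (Fin m → ℝ) × (Fin h → ℝ) => (xpt (backFlow Φ f z), z.2)) _
          (x₀, 0) := (hasFDerivAt_pi.2 fun l =>
            ((h0 (Sum.inl l)).differentiableAt (by simp)).hasFDerivAt).prodMk hasFDerivAt_snd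
      rw [e1.fderiv] at hv
      have hv2 : v.2 = 0 := congrArg Prod.snd hv
      have hv1 : ∀ l, fderiv ℝ (fun z => backFlow Φ f z (Sum.inl l)) (x₀, 0) v = 0 := fun l =>
        congrFun (congrArg Prod.fst hv) l
      refine Prod.ext (funext fun l => ?_) hv2
      have := hv1 l
      rw [D.fderiv_backFlow_zero, hv2] at this
      simpa [totalD] using this) rfl
  simp only [hΞ0] at h1 h3 h4
  exact ⟨Υ, h1, h2, h3, h4⟩

theorem eventually_compFlow_backFlow : ∀ᶠ z : (Fin m → ℝ) × (Fin h → ℝ) in 𝓝 (x₀, 0),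
    compFlow Φ z.2 (backFlow Φ f z) = prolong f z.1 := by
  filter_upwards [D.tendsto_neg_prolong.eventually (D.system.eventually_flowList_neg
    (List.finRange h).reverse (D.prolong_mem D.mem))] with z hz
  simpa [compFlow, backFlow] using hz

/-- The neighbourhoods, the functions `a` and the parametrization `θ`. The set `U` consists of the
points of a small neighbourhood with `x` and `a` in balls, so that the range of `(x, a)` on the swept
manifold is a product. -/
theorem exists_adapted : ∃ (X₁ X : Set (Fin m → ℝ)) (B₁ B : Set (Fin h → ℝ)) (U : Set (Jet m n))
    (a : Jet m n → Fin h → ℝ) (θ : (Fin m → ℝ) → (Fin h → ℝ) → Jet m n),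
    IsOpen X₁ ∧ x₀ ∈ X₁ ∧ X₁ ⊆ M ∧ x₀ ∈ X ∧ X ⊆ M ∧ IsOpen B₁ ∧ 0 ∈ B₁ ∧ 0 ∈ B ∧ B ⊆ B₁ ∧
    prolong f x₀ ∈ U ∧
    (∀ x ∈ X₁, ∀ b ∈ B₁, compFlowDefined E Φ b (prolong f x)) ∧
    (∀ p ∈ U, ∀ b ∈ B₁, compFlowDefined E Φ b p) ∧
    (∀ p ∈ U, a p ∈ B) ∧
    (∀ p ∈ U, ∀ b ∈ B₁, jetDefect f ind σ (compFlow Φ b p) = 0 ↔ b = a p) ∧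
    flowOut Φ f X₁ B₁ ∩ U = {p | p ∈ U ∧ compFlow Φ (a p) p ∈ prolong f '' M} ∧
    IsCoordSystem (flowOut Φ f X₁ B₁ ∩ U) a X B θ ∧
    IsAdapted (jetSpace M N) G lam η a X B U θ := by
  have hp₀ := D.prolong_mem D.mem
  obtain ⟨a, Ba, Wa, hBa, hWa, hpWa, ha, ha0, hiff⟩ := D.exists_times
  obtain ⟨Υ, hΥt, hΥΞ, hΞΥ, hΥs⟩ := D.exists_reparametrization
  have hstay := D.system.eventually_stays D.chart.isOpen D.chart.subset (List.finRange h) D.jet_mem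
  have hMB : M ×ˢ Ba ∈ 𝓝 (x₀, (0 : Fin h → ℝ)) := prod_mem_nhds (D.isOpen.mem_nhds D.mem) hBa
  -- the set of times for which the composed flows are defined near the base point
  have hstay' := hstay
  rw [nhds_prod_eq, eventually_prod_iff] at hstay'
  obtain ⟨PB, hPB, PU, hPU, hdef⟩ := hstay'
  -- the parameters for which the inverse flows are indeed inverted by the composed flows
  let Z : Set ((Fin m → ℝ) × (Fin h → ℝ)) :=
    {z | z ∈ M ×ˢ Ba ∧ compFlow Φ z.2 (backFlow Φ f z) = prolong f z.1}
  have hZ : Z ∈ 𝓝 (x₀, 0) := (eventually_mem_set.2 hMB).and D.eventually_compFlow_backFlow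
  have hX₁ : ∀ᶠ z : (Fin m → ℝ) × (Fin h → ℝ) in 𝓝 (x₀, 0),
      (∃ z' ∈ Z, compFlow Φ z.2 (prolong f z.1) = backFlow Φ f z') ∧
      flowListStays Ω₀ E Φ z.2 (List.finRange h) (prolong f z.1) ∧ z ∈ M ×ˢ Ba ∧ PB z.2 :=
    (D.eventually_compFlow_mem hZ).and ((D.tendsto_snd_prolong.eventually hstay).and
      ((eventually_mem_set.2 hMB).and
        (continuous_snd.continuousAt.preimage_mem_nhds (x := (x₀, 0)) hPB)))
  obtain ⟨X₁, B₁, hX₁o, hxX₁, hB₁o, h0B₁, hXB₁⟩ := mem_nhds_prod_iff'.1 hX₁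
  replace hXB₁ : ∀ y ∈ X₁, ∀ b ∈ B₁,
      (∃ z' ∈ Z, compFlow Φ b (prolong f y) = backFlow Φ f z') ∧
      flowListStays Ω₀ E Φ b (List.finRange h) (prolong f y) ∧ (y, b) ∈ M ×ˢ Ba ∧ PB b :=
    fun y hy b hb => hXB₁ (mk_mem_prod hy hb)
  have hca : ContinuousAt a (prolong f x₀) := continuousAt_pi.2 fun l =>
    ((ha l).continuousOn hWa).continuousAt (hWa.mem_nhds hpWa)
  have hat : Tendsto (fun p => (a p, p)) (𝓝 (prolong f x₀)) (𝓝 (0, prolong f x₀)) := by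
    have := hca.tendsto
    rw [ha0] at this
    exact this.prodMk_nhds tendsto_id
  have hxt : Tendsto (xpt (m := m) (n := n)) (𝓝 (prolong f x₀)) (𝓝 x₀) :=
    tendsto_pi_nhds.2 fun l => (continuous_apply (Sum.inl l)).tendsto (prolong f x₀)
  have hζ : Tendsto (fun p => (xpt (compFlow Φ (a p) p), a p)) (𝓝 (prolong f x₀))
      (𝓝 (x₀, (0 : Fin h → ℝ))) := by
    refine (hxt.comp ((D.system.tendsto_flowList (List.finRange h) hp₀).comp hat)).prodMk_nhds ?_
    simpa only [ha0] using hca.tendsto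
  -- a neighbourhood of the jet of `f`, on which `p` is recovered from `𝚽_{a(p)}(p)`
  obtain ⟨U₀, hU₀, hU₀o, hpU₀⟩ := mem_nhds_iff.1 ((hζ.eventually ((D.eventually_backFlow_mem
    (prod_mem_nhds (hX₁o.mem_nhds hxX₁) (hB₁o.mem_nhds h0B₁))).and hΥΞ)).and
    ((hat.eventually (D.system.eventually_flowList_neg (List.finRange h) hp₀)).and
    ((eventually_mem_set.2 (hWa.mem_nhds hpWa)).and
    ((eventually_mem_set.2 (D.system.isOpen.mem_nhds hp₀)).and hPU))))
  have hU₀W : U₀ ⊆ Wa := fun p hp => (hU₀ hp).2.2.1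
  have hU₀Ω : U₀ ⊆ jetSpace M N := fun p hp => (hU₀ hp).2.2.2.1
  have hrec : ∀ p ∈ U₀, ∀ y, compFlow Φ (a p) p = prolong f y → p = backFlow Φ f (y, a p) ∧
      Υ (xpt p, a p) = (y, a p) ∧
      ∃ z' ∈ X₁ ×ˢ B₁, p = compFlow Φ z'.2 (prolong f z'.1) := by
    intro p hp y hy
    obtain ⟨⟨h1, h2⟩, h3, -⟩ := hU₀ hp
    have h4 : p = backFlow Φ f (y, a p) := by
      rw [backFlow, ← hy]
      exact h3.symm
    simp only [hy, xpt_prolong, ← h4] at h1 h2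
    exact ⟨h4, h2, h1⟩
  have hZa : ∀ z ∈ Z, backFlow Φ f z ∈ U₀ → a (backFlow Φ f z) = z.2 := by
    intro z hz hzU
    refine ((hiff _ (hU₀W hzU) _ hz.1.2).1 ?_).symm
    rw [hz.2, jetDefect_prolong]
  -- the parameter domain
  have hw : ∀ᶠ w in 𝓝 (x₀, (0 : Fin h → ℝ)), (xpt (backFlow Φ f (Υ w)), (Υ w).2) = w ∧
      ContDiffAt ℝ ∞ Υ w ∧ ((Υ w).1 ∈ M ∧ prolong f (Υ w).1 ∈ Ω₀ ∧
        flowListStays Ω₀ E Φ (-(Υ w).2) (List.finRange h).reverse (prolong f (Υ w).1)) ∧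
      (∀ᶠ z in 𝓝 (Υ w), z ∈ Z ∧ backFlow Φ f z ∈ U₀) ∧ w ∈ M ×ˢ B₁ :=
    hΞΥ.and (hΥs.and ((hΥt.eventually D.eventually_backFlow_stays).and
      ((hΥt.eventually (eventually_eventually_nhds.2 ((eventually_mem_set.2 hZ).and
        (D.tendsto_backFlow.eventually (eventually_mem_set.2 (hU₀o.mem_nhds hpU₀)))))).and
      (eventually_mem_set.2 (prod_mem_nhds (D.isOpen.mem_nhds D.mem) (hB₁o.mem_nhds h0B₁))))))
  obtain ⟨ε, hε, hεw⟩ := Metric.eventually_nhds_iff_ball.1 hw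
  rw [← ball_prod_same] at hεw
  set X := Metric.ball x₀ ε
  set B := Metric.ball (0 : Fin h → ℝ) ε
  have hx₀X : x₀ ∈ X := Metric.mem_ball_self hε
  have h0B : (0 : Fin h → ℝ) ∈ B := Metric.mem_ball_self hε
  let θ : (Fin m → ℝ) → (Fin h → ℝ) → Jet m n := fun y b => backFlow Φ f (Υ (y, b))
  let U : Set (Jet m n) := U₀ ∩ (fun p => (xpt p, a p)) ⁻¹' (X ×ˢ B)
  have hUo : IsOpen U := by
    refine ContinuousOn.isOpen_inter_preimage ?_ hU₀o (Metric.isOpen_ball.prod Metric.isOpen_ball)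
    refine ContinuousOn.prodMk (Continuous.continuousOn ?_) ?_
    · exact continuous_pi fun l => continuous_apply (Sum.inl l)
    · exact continuousOn_pi.2 fun l => ((ha l).continuousOn hWa).mono hU₀W
  have hθx : ∀ y ∈ X, ∀ b ∈ B, xpt (θ y b) = y := fun y hy b hb =>
    congrArg Prod.fst (hεw _ (mk_mem_prod hy hb)).1
  have hΥ2 : ∀ y ∈ X, ∀ b ∈ B, (Υ (y, b)).2 = b := fun y hy b hb =>
    congrArg Prod.snd (hεw _ (mk_mem_prod hy hb)).1
  have hθZ : ∀ y ∈ X, ∀ b ∈ B, Υ (y, b) ∈ Z ∧ θ y b ∈ U₀ := fun y hy b hb =>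
    (hεw _ (mk_mem_prod hy hb)).2.2.2.1.self_of_nhds
  have hθa : ∀ y ∈ X, ∀ b ∈ B, a (θ y b) = b := fun y hy b hb =>
    (hZa _ (hθZ y hy b hb).1 (hθZ y hy b hb).2).trans (hΥ2 y hy b hb)
  have hθU : ∀ y ∈ X, ∀ b ∈ B, θ y b ∈ U := by
    intro y hy b hb
    refine ⟨(hθZ y hy b hb).2, ?_⟩
    simpa only [mem_preimage, hθx y hy b hb, hθa y hy b hb] using mk_mem_prod hy hb
  have hθs : ∀ y ∈ X, ∀ b ∈ B, ∀ c, ContDiffAt ℝ ∞ (fun z => backFlow Φ f z c) (Υ (y, b)) := by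
    intro y hy b hb
    have h1 := (hεw _ (mk_mem_prod hy hb)).2.2.1
    exact D.contDiffAt_backFlow h1.1 h1.2.2.defined
  have hθc : ∀ y ∈ X, ∀ b ∈ B, ∀ c, ContDiffAt ℝ ∞
      (fun z : (Fin m → ℝ) × (Fin h → ℝ) => θ z.1 z.2 c) (y, b) := fun y hy b hb c =>
    ContDiffAt.comp (g := fun z => backFlow Φ f z c) (y, b) (hθs y hy b hb c)
      (hεw _ (mk_mem_prod hy hb)).2.1
  have hK : flowOut Φ f X₁ B₁ ∩ U = {p | p ∈ U ∧ compFlow Φ (a p) p ∈ prolong f '' M} := by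
    ext p
    constructor
    · rintro ⟨⟨b, hb, x, hx, hpx⟩, hpU⟩
      obtain ⟨z, hz, hzp⟩ := (hXB₁ x hx b hb).1
      rw [← hpx] at hzp
      have h1 : a p = z.2 := by
        rw [hzp]
        exact hZa z hz (hzp ▸ hpU.1)
      refine ⟨hpU, z.1, hz.1.1, ?_⟩
      rw [h1, ← hz.2, ← hzp]
    · rintro ⟨hpU, y, -, hyp⟩
      obtain ⟨-, -, z, hz, hzp⟩ := hrec p hpU.1 y hyp.symm
      exact ⟨⟨z.2, hz.2, z.1, hz.1, hzp⟩, hpU⟩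
  have hp₀U : prolong f x₀ ∈ U := by
    refine ⟨hpU₀, ?_⟩
    simpa only [mem_preimage, xpt_prolong, ha0] using mk_mem_prod hx₀X h0B
  refine ⟨X₁, X, B₁, B, U, a, θ, hX₁o, hxX₁, fun y hy => (hXB₁ y hy 0 h0B₁).2.2.1.1,
    hx₀X, fun y hy => (hεw _ (mk_mem_prod hy h0B)).2.2.2.2.1, hB₁o, h0B₁, h0B,
    fun b hb => (hεw _ (mk_mem_prod hx₀X hb)).2.2.2.2.2,
    hp₀U,
    fun x hx b hb => (hXB₁ x hx b hb).2.1.defined,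
    fun p hp b hb => (hdef (hXB₁ x₀ hxX₁ b hb).2.2.2 (hU₀ hp.1).2.2.2.2).defined,
    fun p hp => hp.2.2, fun p hp b hb => hiff p (hU₀W hp.1) b (hXB₁ x₀ hxX₁ b hb).2.2.1.2, hK,
    ?_, ?_⟩
  · rw [hK]
    refine ⟨fun c => fun z hz => (hθc z.1 hz.1 z.2 hz.2 c).contDiffWithinAt,
      fun y hy b hb => ⟨hθU y hy b hb, (Υ (y, b)).1, (hθZ y hy b hb).1.1.1, ?_⟩, hθx, hθa,
      fun p hp => hp.1.2.1, fun p hp => hp.1.2.2, ?_⟩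
    · rw [← (hθZ y hy b hb).1.2, hθa y hy b hb, hΥ2 y hy b hb]
    · rintro p ⟨hpU, y, -, hyp⟩
      obtain ⟨h1, h2, -⟩ := hrec p hpU.1 y hyp.symm
      exact (congrArg (backFlow Φ f) h2).trans h1.symm
  · have hUW : U ⊆ Wa := fun p hp => hU₀W hp.1
    have hUΩ : U ⊆ jetSpace M N := fun p hp => hU₀Ω hp.1
    refine ⟨Metric.isOpen_ball, convex_ball _ _, Metric.isOpen_ball, hUo, hUΩ,
      fun i j => (D.system.smooth_gen i j).mono hUΩ,
      fun i j s p hp => D.system.bracket_eq i j s p (hUΩ hp), fun l => (ha l).mono hUW, hθc, hθU,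
      hθx, hθa, ?_, ?_⟩
    · intro y hy b hb R v hRD hR hR'
      obtain ⟨-, hΥd, h1, -⟩ := hεw _ (mk_mem_prod hy hb)
      have e1 : ∀ c, fderiv ℝ (fun z : (Fin m → ℝ) × (Fin h → ℝ) => θ z.1 z.2 c) (y, b) v =
          fderiv ℝ (fun z => backFlow Φ f z c) (Υ (y, b)) (fderiv ℝ Υ (y, b) v) := by
        intro c
        have e2 := HasFDerivAt.comp (g := fun z => backFlow Φ f z c) (y, b)
          ((hθs y hy b hb c).differentiableAt (by simp)).hasFDerivAt
          (hΥd.differentiableAt (by simp)).hasFDerivAt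
        rw [HasFDerivAt.fderiv (f := fun z : (Fin m → ℝ) × (Fin h → ℝ) => θ z.1 z.2 c) e2]
        rfl
      have e2 : (fderiv ℝ Υ (y, b) v).2 = v.2 := by
        have e3 : (fun w => (Υ w).2) =ᶠ[𝓝 (y, b)] fun w => w.2 := by
          filter_upwards [(Metric.isOpen_ball.prod Metric.isOpen_ball).mem_nhds
            (mk_mem_prod hy hb)] with w hw using hΥ2 w.1 hw.1 w.2 hw.2
        have e4 := (hΥd.differentiableAt (by simp)).hasFDerivAt.snd
        have e5 := e4.fderiv.symm.trans (e3.fderiv_eq.trans fderiv_snd)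
        exact congrArg (fun L : (Fin m → ℝ) × (Fin h → ℝ) →L[ℝ] (Fin h → ℝ) => L v) e5
      simp only [e1]
      exact D.inSpan_backFlow hRD h1.1 h1.2.2 _ (by simpa only [hΥ2 y hy b hb] using hR)
        (by simpa only [e2] using hR')
    · intro y hy b hb i hbi l
      obtain ⟨-, -, h1, h2, -⟩ := hεw _ (mk_mem_prod hy hb)
      have hz0 : ((Υ (y, b)).1, (Υ (y, b)).2 - (0 : ℝ) • (Pi.single i 1 : Fin h → ℝ)) =
          Υ (y, b) := by simp
      have e1 := IsSmoothOn.hasDerivAt_comp hWa (ha l) (t := 0)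
        (γ := fun t : ℝ => backFlow Φ f ((Υ (y, b)).1, (Υ (y, b)).2 - t • Pi.single i 1))
        (D.hasDerivAt_backFlow (by simpa only [hΥ2 y hy b hb] using hbi) h1.2.2.defined)
        (by rw [hz0]; exact hUW (hθU y hy b hb))
      rw [hz0] at e1
      have hc : Continuous fun t : ℝ =>
          ((Υ (y, b)).1, (Υ (y, b)).2 - t • (Pi.single i 1 : Fin h → ℝ)) := by fun_prop
      have e2 : HasDerivAt (fun t : ℝ => (Υ (y, b)).2 l - t * (Pi.single i 1 : Fin h → ℝ) l)
          (-(Pi.single i 1 : Fin h → ℝ) l) 0 := by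
        simpa using ((hasDerivAt_id (0 : ℝ)).mul_const _).const_sub ((Υ (y, b)).2 l)
      refine (e1.unique (e2.congr_of_eventuallyEq ?_)).trans (by simp [Pi.single_apply])
      have h3 := hc.tendsto 0
      rw [hz0] at h3
      filter_upwards [h3.eventually h2] with t ht
      rw [hZa _ ht.1 ht.2]
      simp

end IsGenericPoint

end Construction

end InfJet

theorem theorem5 {m n h : ℕ}
    (M : Set (Fin m → ℝ)) (N : Set (Fin n → ℝ)) (hM : IsOpen M) (hN : IsOpen N)
    -- generators of the evolution fields; they span a Lie algebra
    (G : Fin h → Fin n → InfJet.Jet m n → ℝ)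
    (hG : ∀ i j, InfJet.IsSmoothOn (InfJet.jetSpace M N) (G i j))
    (lam : Fin h → Fin h → Fin h → ℝ)
    (hlam : ∀ i j s, ∀ p ∈ InfJet.jetSpace M N,
      InfJet.bracket (G i) (G j) s p = ∑ k, lam i j k * G k s p)
    -- characteristic vector fields and their flows, with a common filtration
    (η : Fin h → Fin m → InfJet.Jet m n → ℝ)
    (hη : ∀ i l, InfJet.IsSmoothOn (InfJet.jetSpace M N) (η i l))
    (E : Fin h → Set (ℝ × InfJet.Jet m n))
    (Φ : Fin h → ℝ → InfJet.Jet m n → InfJet.Jet m n)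
    (hΦ : ∀ i, InfJet.IsLocalFlow (InfJet.jetSpace M N) (InfJet.charField (G i) (η i)) (E i) (Φ i))
    (hfilt : InfJet.HasCommonFiltration (InfJet.jetSpace M N)
      (fun i => InfJet.charField (G i) (η i)))
    -- the initial map
    (f : (Fin m → ℝ) → (Fin n → ℝ)) (hf : ContDiffOn ℝ ∞ f M) (hfN : Set.MapsTo f M N)
    -- the nondegeneracy condition at a point
    (x₀ : Fin m → ℝ) (hx₀ : x₀ ∈ M)
    (ind : Fin h → Fin n) (σ : Fin h → Fin m → ℕ)
    (hdet : (Matrix.of fun r s : Fin h =>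
      InfJet.totalDPow (σ r) (G s (ind r)) (InfJet.prolong f x₀)).det ≠ 0) :
    ∃ (X₁ X : Set (Fin m → ℝ)) (B₁ B : Set (Fin h → ℝ)) (U : Set (InfJet.Jet m n))
      (a : InfJet.Jet m n → Fin h → ℝ) (θ : (Fin m → ℝ) → (Fin h → ℝ) → InfJet.Jet m n)
      (φ : Fin h → Fin h → (Fin h → ℝ) → ℝ),
      IsOpen X₁ ∧ x₀ ∈ X₁ ∧ X₁ ⊆ M ∧ IsOpen X ∧ x₀ ∈ X ∧ X ⊆ M ∧
      IsOpen B₁ ∧ 0 ∈ B₁ ∧ IsOpen B ∧ 0 ∈ B ∧ B ⊆ B₁ ∧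
      IsOpen U ∧ InfJet.prolong f x₀ ∈ U ∧ U ⊆ InfJet.jetSpace M N ∧
      -- the composed flows are defined
      (∀ x ∈ X₁, ∀ b ∈ B₁, InfJet.compFlowDefined E Φ b (InfJet.prolong f x)) ∧
      (∀ p ∈ U, ∀ b ∈ B₁, InfJet.compFlowDefined E Φ b p) ∧
      -- the functions `a` are smooth and are the unique solution of their defining equations
      (∀ l, InfJet.IsSmoothOn U (fun p => a p l)) ∧
      (∀ p ∈ U, a p ∈ B) ∧
      (∀ p ∈ U, ∀ b ∈ B₁,
        (∀ k, InfJet.compFlow Φ b p (Sum.inr (ind k, σ k)) =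
          InfJet.pdPow (σ k) (fun y => f y (ind k)) (InfJet.xpt (InfJet.compFlow Φ b p))) ↔
        b = a p) ∧
      -- the manifold `K`, swept out by the flows, is the set of points that `𝚽_{a(p)}` maps to `ℋ`
      InfJet.flowOut Φ f X₁ B₁ ∩ U =
        {p | p ∈ U ∧ InfJet.compFlow Φ (a p) p ∈ InfJet.prolong f '' M} ∧
      -- `(x, a)` is a coordinate system on `K`
      InfJet.IsCoordSystem (InfJet.flowOut Φ f X₁ B₁ ∩ U) a X B θ ∧
      -- the functions `a` are constant along the total derivatives on `K`
      (∀ i l, ∀ p ∈ InfJet.flowOut Φ f X₁ B₁ ∩ U,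
        InfJet.act (InfJet.totalD i) (fun q => a q l) p = 0) ∧
      -- the fields restrict to `φ^l_i(a) ∂_{a^l}`
      (∀ i l, ContDiffOn ℝ ∞ (φ i l) B) ∧
      (∀ i, ∀ g, InfJet.IsSmoothOn U g → ∀ y ∈ X, ∀ b ∈ B,
        InfJet.act (InfJet.evol (G i)) g (θ y b) =
          ∑ l, φ i l b * fderiv ℝ (fun b' => g (θ y b')) b (Pi.single l 1)) ∧
      -- the values of `φ`
      (∀ i l, ∀ b ∈ B, (∀ j, j < i → b j = 0) → φ i l b = -(if l = i then 1 else 0)) ∧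
      -- the recursive system
      (∀ i k l, ∀ b ∈ B, (∀ j, j < k → b j = 0) →
        fderiv ℝ (φ i l) b (Pi.single k 1) =
          -(∑ p, lam k i p * φ p l b) -
            ∑ r with r ≠ k, φ i r b * fderiv ℝ (φ k l) b (Pi.single r 1)) ∧
      -- where the last `h - k + 1` generators span a subalgebra, only `r > k` contributes
      (∀ i k l, k ≤ i → (∀ p q s, k ≤ p → k ≤ q → s < k → lam p q s = 0) →
        ∀ b ∈ B, (∀ j, j < k → b j = 0) →
        fderiv ℝ (φ i l) b (Pi.single k 1) =
          -(∑ p, lam k i p * φ p l b) -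
            ∑ r with k < r, φ i r b * fderiv ℝ (φ k l) b (Pi.single r 1)) := by
  have hΩ := InfJet.isOpen_jetSpace hM hN
  have D : InfJet.IsGenericPoint M N f G lam η E Φ _ ind σ _ x₀ :=
    ⟨hM, hf, hfN, hx₀, ⟨hΩ, hG, hlam, hη, hΦ, hfilt⟩, InfJet.isFrameChart hΩ hG ind σ,
      InfJet.prolong_mem hfN hx₀, by rwa [InfJet.det_frameMatrix]⟩
  obtain ⟨X₁, X, B₁, B, U, a, θ, hX₁, hxX₁, hX₁M, hxX, hXM, hB₁, h0B₁, h0B, hBB₁, hpU, hdefX, hdefU,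
    haB, hiff, hK, hcs, A⟩ := D.exists_adapted
  let φ : Fin h → Fin h → (Fin h → ℝ) → ℝ := fun i l b =>
    InfJet.act (InfJet.evol (G i)) (fun p => a p l) (θ x₀ b)
  have hφ : ∀ i l, ∀ b ∈ B,
      φ i l b = InfJet.act (InfJet.evol (G i)) (fun p => a p l) (θ x₀ b) := fun _ _ _ _ => rfl
  refine ⟨X₁, X, B₁, B, U, a, θ, φ, hX₁, hxX₁, hX₁M, A.isOpen_X, hxX, hXM, hB₁, h0B₁, A.isOpen_B,
    h0B, hBB₁, A.isOpen_U, hpU, A.subset, hdefX, hdefU, A.smooth_a, haB, fun p hp b hb => ?_, hK,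
    hcs, fun i l p hp => ?_, fun i l b hb => (A.contDiffAt_coeff hxX hφ i l hb).contDiffWithinAt,
    fun i g hg y hy b hb => A.act_evol_eq_coeff hxX hφ i hg hy hb,
    fun i l b hb hbi => A.coeff_of_zero hxX hφ i l hb hbi,
    fun i k l b hb hbk => A.fderiv_coeff hxX hφ i k l hb hbk,
    fun i k l hk hlam' b hb hbk => A.fderiv_coeff_of_subalgebra hxX hφ l hk hlam' hb hbk⟩
  · rw [← hiff p hp b hb, funext_iff]
    simp only [InfJet.jetDefect, Pi.zero_apply, sub_eq_zero]
    rfl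
  · rw [← hcs.inv p hp]
    exact A.act_totalD_a (hcs.x_mem p hp) (hcs.a_mem p hp) i l
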